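/- Let $\Sigma$ be a compact connected Riemann surface of genus $g>1$ with canonical bundle $K$, let $n\ge 2$ be an integer, and assume $(n,g)\neq(2,2)$. Let $a_j\in H^0(\Sigma,K^j)$ for $2\le j\le n$, let $\pi:K\to\Sigma$ also denote the projection of the total space of $K$, let $\lambda$ be the tautological section of $\pi^*K$ on this total space, and let $$s=\lambda^n+\pi^*(a_2)\lambda^{n-2}+\dots+\pi^*(a_n)\in H^0(K,\pi^*(K^n)).$$ Let $S\subset K$ be the zero locus of $s$ (the spectral curve of $(a_2,\dots,a_n)$), and suppose that $S$ is non-singular, i.e. the differential of $s$ does not vanish at any zero of $s$, so that $S$ is a compact Riemann surface. Then $S$ is not hyperelliptic, i.e. it is not a Riemann surface of genus at least $2$ admitting a holomorphic map of degree $2$ to the Riemann sphere. -/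

import Mathlib

open scoped Manifold Topology ContDiff

noncomputable section

namespace RiemannSurface

/-! ### Differentials on a Riemann surface -/

section Differentials

variable (X : Type*) [TopologicalSpace X] [ChartedSpace ℂ X] [IsManifold 𝓘(ℂ) ω X]

/-- `H⁰(X, K^j)`: holomorphic sections of the `j`-th power of the canonical (holomorphic cotangent)
bundle.  As the tangent spaces are lines, an element of `K_x^j` is the same as a function
`T_x X → ℂ` that is homogeneous of degree `j`; a holomorphic section of `K^j` is a holomorphic
function on the total space of the tangent bundle that is homogeneous of degree `j` on
every tangent line. -/
def differentials (j : ℕ) : Submodule ℂ (TangentBundle 𝓘(ℂ) X → ℂ) where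
  carrier := {f | ContMDiff (𝓘(ℂ).prod 𝓘(ℂ)) 𝓘(ℂ) ω f ∧
    ∀ (x : X) (c : ℂ) (v : TangentSpace 𝓘(ℂ) x), f ⟨x, c • v⟩ = c ^ j * f ⟨x, v⟩}
  add_mem' := by
    rintro f g ⟨hf, hf'⟩ ⟨hg, hg'⟩
    refine ⟨hf.add hg, fun x c v => ?_⟩
    simp only [Pi.add_apply, hf', hg']
    ring
  zero_mem' := ⟨contMDiff_const, fun x c v => by simp⟩
  smul_mem' := by
    rintro r f ⟨hf, hf'⟩
    refine ⟨(contMDiff_const (c := r)).mul hf, fun x c v => ?_⟩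
    simp only [Pi.smul_apply, hf', smul_eq_mul]
    ring

/-- The genus of a compact Riemann surface: the dimension of its space of holomorphic
one-forms. -/
def genus : ℕ := Module.finrank ℂ (differentials X 1)

end Differentials

/-! ### Hyperelliptic Riemann surfaces -/

section Hyperelliptic

/-- The coordinate `z` of the Riemann sphere `ℂ ∪ {∞}`, defined away from `∞`. -/
def sphereCoord (q : OnePoint ℂ) : ℂ := q.elim 0 id

/-- The coordinate `1 / z` of the Riemann sphere `ℂ ∪ {∞}`, defined away from `0`
(and equal to `0` at `∞`). -/
def sphereCoordInv (q : OnePoint ℂ) : ℂ := q.elim 0 (fun z => z⁻¹)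

variable {Y : Type*} [TopologicalSpace Y] [ChartedSpace ℂ Y]

/-- A holomorphic map from a Riemann surface to the Riemann sphere. -/
structure IsHolomorphicToSphere (f : Y → OnePoint ℂ) : Prop where
  continuous : Continuous f
  holomorphic_coord : ∀ y, f y ≠ OnePoint.infty →
    MDifferentiableAt 𝓘(ℂ) 𝓘(ℂ) (fun t => sphereCoord (f t)) y
  holomorphic_coordInv : ∀ y, f y ≠ ((0 : ℂ) : OnePoint ℂ) →
    MDifferentiableAt 𝓘(ℂ) 𝓘(ℂ) (fun t => sphereCoordInv (f t)) y

variable (Y) in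
/-- A compact Riemann surface is hyperelliptic if its genus is at least two and it admits a
holomorphic map of degree two to the Riemann sphere: all but finitely many
points of the sphere have exactly two preimages. -/
def IsHyperelliptic [IsManifold 𝓘(ℂ) ω Y] : Prop :=
  2 ≤ genus Y ∧ ∃ f : Y → OnePoint ℂ, IsHolomorphicToSphere f ∧
    {q : OnePoint ℂ | (f ⁻¹' {q}).encard ≠ 2}.Finite

end Hyperelliptic

/-! ### Spectral curves -/

section Spectral

variable (X : Type*) [TopologicalSpace X] [ChartedSpace ℂ X] [IsManifold 𝓘(ℂ) ω X]

/-- The total space of the canonical bundle `K` (the holomorphic cotangent bundle). -/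
abbrev CanonicalBundle : Type _ :=
  Bundle.TotalSpace (ℂ →L[ℂ] ℂ)
    (fun x : X => TangentSpace 𝓘(ℂ) x →L[ℂ] Bundle.Trivial X ℂ x)

/-- The model with corners of the complex surface `CanonicalBundle X`. -/
abbrev canonicalModel : ModelWithCorners ℂ (ℂ × (ℂ →L[ℂ] ℂ)) (ModelProd ℂ (ℂ →L[ℂ] ℂ)) :=
  𝓘(ℂ).prod 𝓘(ℂ, ℂ →L[ℂ] ℂ)

/-- The base `⨁_{j=2}^n H⁰(X, K^j)` of the Hitchin system: the tuples `(a_2, …, a_n)`. -/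
abbrev HitchinBase (n : ℕ) : Type _ := (j : Finset.Icc 2 n) → differentials X (j : ℕ)

variable {X} {n : ℕ}

/-- The section `s = λ^n + a_2 λ^{n-2} + ⋯ + a_n` of the pull-back of `K^n` to the total space of
`K`, at the point `q = (x, ℓ)`, as a homogeneous function of degree `n` on the tangent
line `T_x X`; the tautological section `λ` takes the value `ℓ` at `q`. -/
def spectralSection (a : HitchinBase X n) (q : CanonicalBundle X)
    (v : TangentSpace 𝓘(ℂ) q.proj) : ℂ :=
  (q.snd v : ℂ) ^ n + ∑ j : Finset.Icc 2 n,
    (a j : TangentBundle 𝓘(ℂ) X → ℂ) ⟨q.proj, v⟩ * (q.snd v : ℂ) ^ (n - (j : ℕ))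

/-- The zero locus of the section `s` in the total space of `K`. -/
def spectralSet (a : HitchinBase X n) : Set (CanonicalBundle X) :=
  {q | ∀ v, spectralSection a q v = 0}

/-- The holomorphic coordinate vector field `∂/∂z` of the preferred chart at `x₀`. -/
def coordField (x₀ x : X) : TangentSpace 𝓘(ℂ) x :=
  (trivializationAt ℂ (TangentSpace (M := X) 𝓘(ℂ)) x₀).symmL ℂ x (1 : ℂ)

/-- The holomorphic function that represents the section `s` in the local frame `(dz)^n`
of `K^n` near `x₀`. -/
def localEquation (a : HitchinBase X n) (x₀ : X) (q : CanonicalBundle X) : ℂ :=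
  spectralSection a q (coordField x₀ q.proj)

/-- The spectral curve, i.e. the zero scheme of `s`, is non-singular: the differential of `s` (read
in a local frame) does not vanish at any zero of `s`. -/
def IsNonsingular (a : HitchinBase X n) : Prop :=
  ∀ q ∈ spectralSet a, mfderiv (canonicalModel) 𝓘(ℂ) (localEquation a q.proj) q ≠ 0

theorem contMDiffAt_coordField (x₀ x : X)
    (hx : x ∈ (trivializationAt ℂ (TangentSpace (M := X) 𝓘(ℂ)) x₀).baseSet) :
    ContMDiffAt 𝓘(ℂ) (𝓘(ℂ).prod 𝓘(ℂ)) ω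
      (fun y => (⟨y, coordField x₀ y⟩ : TangentBundle 𝓘(ℂ) X)) x := by
  have h := (trivializationAt ℂ (TangentSpace (M := X) 𝓘(ℂ)) x₀).contMDiffOn_symm
    (IB := 𝓘(ℂ)) (n := ω)
  have h2 : ContMDiffAt 𝓘(ℂ) (𝓘(ℂ).prod 𝓘(ℂ)) ω
      (fun y : X => (trivializationAt ℂ (TangentSpace (M := X) 𝓘(ℂ)) x₀).toOpenPartialHomeomorph.symm
        (y, (1 : ℂ))) x := by
    have hmem : (x, (1 : ℂ)) ∈ (trivializationAt ℂ (TangentSpace (M := X) 𝓘(ℂ)) x₀).target := by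
      rw [Bundle.Trivialization.mem_target]; exact hx
    have h3 := h.contMDiffAt
      ((trivializationAt ℂ (TangentSpace (M := X) 𝓘(ℂ)) x₀).open_target.mem_nhds hmem)
    exact h3.comp x (contMDiffAt_id.prodMk contMDiffAt_const)
  refine h2.congr_of_eventuallyEq ?_
  filter_upwards [(trivializationAt ℂ (TangentSpace (M := X) 𝓘(ℂ)) x₀).open_baseSet.mem_nhds hx]
    with y hy
  have := (trivializationAt ℂ (TangentSpace (M := X) 𝓘(ℂ)) x₀).mk_symm hy (1 : ℂ)
  rw [← this, coordField]
  exact congrArg _ ((trivializationAt ℂ (TangentSpace (M := X) 𝓘(ℂ)) x₀).symmL_apply hy 1)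

theorem contMDiffAt_localEquation (a : HitchinBase X n) (x₀ : X) (q : CanonicalBundle X)
    (hq : q.proj ∈ (trivializationAt ℂ (TangentSpace (M := X) 𝓘(ℂ)) x₀).baseSet) :
    ContMDiffAt (canonicalModel) 𝓘(ℂ) ω (localEquation a x₀) q := by
  have hproj : ContMDiffAt (canonicalModel) 𝓘(ℂ) ω
      (fun q : CanonicalBundle X => q.proj) q :=
    Bundle.contMDiffAt_proj _
  have hfield : ContMDiffAt (canonicalModel) (𝓘(ℂ).prod 𝓘(ℂ)) ω
      (fun q : CanonicalBundle X => (⟨q.proj, coordField x₀ q.proj⟩ : TangentBundle 𝓘(ℂ) X)) q :=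
    (contMDiffAt_coordField x₀ q.proj hq).comp q hproj
  have htaut : ContMDiffAt (canonicalModel) 𝓘(ℂ) ω
      (fun q : CanonicalBundle X => (q.snd (coordField x₀ q.proj) : ℂ)) q := by
    have h := ContMDiffAt.clm_bundle_apply (F₁ := ℂ) (F₂ := ℂ) (IB := 𝓘(ℂ))
      (E₁ := fun x : X => TangentSpace 𝓘(ℂ) x) (E₂ := Bundle.Trivial X ℂ)
      (b := fun q : CanonicalBundle X => q.proj) (ϕ := fun q => q.snd)
      (v := fun q => coordField x₀ q.proj) (x := q) (IM := canonicalModel) (n := ω)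
      contMDiffAt_id hfield
    rw [Bundle.contMDiffAt_totalSpace] at h
    exact h.2
  unfold localEquation spectralSection
  refine (htaut.pow n).add (contMDiffAt_finsetSum fun j _ => ?_)
  exact (((a j).2.1 _).comp q hfield).mul (htaut.pow _)

theorem spectralSection_smul (a : HitchinBase X n) (q : CanonicalBundle X) (c : ℂ)
    (v : TangentSpace 𝓘(ℂ) q.proj) :
    spectralSection a q (c • v) = c ^ n * spectralSection a q v := by
  have h1 : (q.snd (c • v) : ℂ) = c * q.snd v := by
    rw [map_smul]; rfl
  unfold spectralSection
  rw [h1, mul_add, mul_pow, Finset.mul_sum]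
  congr 1
  refine Finset.sum_congr rfl fun j _ => ?_
  rw [(a j).2.2, mul_pow]
  have : c ^ n = c ^ (j : ℕ) * c ^ (n - (j : ℕ)) := by
    rw [← pow_add, Nat.add_sub_cancel' (Finset.mem_Icc.1 j.2).2]
  rw [this]
  ring

theorem mem_spectralSet_iff (a : HitchinBase X n) (x₀ : X) (q : CanonicalBundle X)
    (hq : q.proj ∈ (trivializationAt ℂ (TangentSpace (M := X) 𝓘(ℂ)) x₀).baseSet) :
    q ∈ spectralSet a ↔ localEquation a x₀ q = 0 := by
  refine ⟨fun h => h _, fun h v => ?_⟩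
  set T := trivializationAt ℂ (TangentSpace (M := X) 𝓘(ℂ)) x₀
  have hv : v = (T.continuousLinearMapAt ℂ q.proj v : ℂ) • coordField x₀ q.proj := by
    unfold coordField
    rw [← map_smul, smul_eq_mul, mul_one, T.symmL_continuousLinearMapAt hq]
  rw [hv, spectralSection_smul]
  exact mul_eq_zero_of_right _ h

theorem exists_straightening {H : ℂ × (ℂ →L[ℂ] ℂ) → ℂ} {x : ℂ × (ℂ →L[ℂ] ℂ)}
    (hH : ContDiffAt ℂ ω H x) (hx : fderiv ℂ H x ≠ 0) {U : Set (ℂ × (ℂ →L[ℂ] ℂ))}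
    (hU : U ∈ 𝓝 x) :
    ∃ Ψ : OpenPartialHomeomorph (ℂ × (ℂ →L[ℂ] ℂ)) (ℂ × ℂ), x ∈ Ψ.source ∧ Ψ.source ⊆ U ∧
      (∀ y ∈ Ψ.source, (Ψ y).1 = H y) ∧ (∀ y ∈ Ψ.source, ContDiffAt ℂ ω Ψ y) ∧
      ∀ z ∈ Ψ.target, ContDiffAt ℂ ω Ψ.symm z := by
  set f' := fderiv ℂ H x with hf'
  have hdec : ∀ y : ℂ × (ℂ →L[ℂ] ℂ),
      y = y.1 • ((1, 0) : ℂ × (ℂ →L[ℂ] ℂ)) + (y.2 1) • ((0, 1) : ℂ × (ℂ →L[ℂ] ℂ)) := by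
    intro y
    refine Prod.ext (by simp) ?_
    ext
    simp
  obtain ⟨L, hL⟩ : ∃ L : ℂ × (ℂ →L[ℂ] ℂ) →L[ℂ] ℂ, Function.Injective (f'.prod L) := by
    by_cases h : f' (1, 0) = 0
    · have h2 : f' (0, 1) ≠ 0 := by
        intro h2
        apply hx
        refine ContinuousLinearMap.ext fun y => ?_
        rw [hdec y, map_add, map_smul, map_smul, h, h2]
        simp
      refine ⟨ContinuousLinearMap.fst ℂ _ _, ?_⟩
      rw [injective_iff_map_eq_zero]
      intro y hy
      have hy1 : f' y = 0 := congrArg Prod.fst hy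
      have hy2 : y.1 = 0 := congrArg Prod.snd hy
      rw [hdec y, map_add, map_smul, map_smul, hy2] at hy1
      have hy3 : y.2 1 = 0 := by simpa [h2] using hy1
      exact Prod.ext hy2 (ContinuousLinearMap.ext_ring hy3)
    · refine ⟨(ContinuousLinearMap.apply ℂ ℂ (1 : ℂ)).comp (ContinuousLinearMap.snd ℂ _ _), ?_⟩
      rw [injective_iff_map_eq_zero]
      intro y hy
      have hy1 : f' y = 0 := congrArg Prod.fst hy
      have hy2 : y.2 1 = 0 := congrArg Prod.snd hy
      rw [hdec y, map_add, map_smul, map_smul, hy2] at hy1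
      have hy3 : y.1 = 0 := by simpa [h] using hy1
      exact Prod.ext hy3 (ContinuousLinearMap.ext_ring hy2)
  have hfin : Module.finrank ℂ (ℂ × (ℂ →L[ℂ] ℂ)) = Module.finrank ℂ (ℂ × ℂ) := by
    rw [Module.finrank_prod, Module.finrank_prod]
    congr 1
    exact (LinearMap.toContinuousLinearMap (𝕜 := ℂ) (E := ℂ) (F' := ℂ)).symm.finrank_eq.trans
      (by simp)
  let A : (ℂ × (ℂ →L[ℂ] ℂ)) ≃L[ℂ] ℂ × ℂ :=
    (LinearEquiv.ofInjectiveOfFinrankEq (f'.prod L).toLinearMap hL hfin).toContinuousLinearEquiv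
  have hA : (A : (ℂ × (ℂ →L[ℂ] ℂ)) →L[ℂ] ℂ × ℂ) = f'.prod L := by
    exact ContinuousLinearMap.ext fun y => rfl
  have hΦ : ContDiffAt ℂ ω (fun y => (H y, L y)) x := hH.prodMk L.contDiff.contDiffAt
  have hΦ' : HasFDerivAt (fun y => (H y, L y)) (A : (ℂ × (ℂ →L[ℂ] ℂ)) →L[ℂ] ℂ × ℂ) x := by
    rw [hA]
    exact ((hH.differentiableAt (by simp)).hasFDerivAt).prodMk L.hasFDerivAt
  let Ψ₀ := hΦ.toOpenPartialHomeomorph _ hΦ' (by simp)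
  have hΨ₀ : ∀ y, Ψ₀ y = (H y, L y) := fun y => rfl
  have hx₀ : x ∈ Ψ₀.source := hΦ.mem_toOpenPartialHomeomorph_source hΦ' (by simp)
  have hinv : ContDiffAt ℂ ω Ψ₀.symm (Ψ₀ x) := hΦ.to_localInverse hΦ' (by simp)
  have h1 : ∀ᶠ y in 𝓝 x, ContDiffAt ℂ ω (fun y => (H y, L y)) y := hΦ.eventually (by simp)
  have h2 : ∀ᶠ y in 𝓝 x, ContDiffAt ℂ ω Ψ₀.symm (Ψ₀ y) :=
    (Ψ₀.continuousAt hx₀).eventually (hinv.eventually (by simp))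
  obtain ⟨V, hV, hVo, hxV⟩ := mem_nhds_iff.1 (Filter.inter_mem hU (Filter.inter_mem h1 h2))
  refine ⟨Ψ₀.restrOpen V hVo, ⟨hx₀, hxV⟩, fun y hy => (hV hy.2).1, fun y _ => rfl,
    fun y hy => (hV hy.2).2.1, fun z hz => ?_⟩
  have hz' := (Ψ₀.restrOpen V hVo).map_target hz
  have h3 := (hV hz'.2).2.2
  have h4 : Ψ₀ ((Ψ₀.restrOpen V hVo).symm z) = z := (Ψ₀.restrOpen V hVo).right_inv hz
  change ContDiffAt ℂ ω Ψ₀.symm (Ψ₀ ((Ψ₀.restrOpen V hVo).symm z)) at h3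
  rw [h4] at h3
  exact h3

/-- The spectral curve `S ⊂ K` of `(a_2, …, a_n)`, in the case that it is non-singular. -/
def SpectralCurve (a : HitchinBase X n) (_ha : IsNonsingular a) : Type _ := spectralSet a

variable (a : HitchinBase X n) (ha : IsNonsingular a)

instance : TopologicalSpace (SpectralCurve a ha) :=
  inferInstanceAs (TopologicalSpace (spectralSet a))

/-- The inclusion of the spectral curve into the total space of `K`. -/
def SpectralCurve.incl (p : SpectralCurve a ha) : CanonicalBundle X :=
  Subtype.val (p := (· ∈ spectralSet a)) p

/-- The charts of the spectral curve as a complex submanifold of `K`: homeomorphisms between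
open sets of `S` and of `ℂ` that are locally restrictions of holomorphic functions on `K`, and
whose inverses are holomorphic as maps to `K`. -/
def spectralAtlas : Set (OpenPartialHomeomorph (SpectralCurve a ha) ℂ) :=
  {e | (∀ z ∈ e.target, ContMDiffAt 𝓘(ℂ) (canonicalModel) ω
      (fun t => SpectralCurve.incl a ha (e.symm t)) z) ∧
    ∀ p ∈ e.source, ∃ G : CanonicalBundle X → ℂ,
      ContMDiffAt (canonicalModel) 𝓘(ℂ) ω G (SpectralCurve.incl a ha p) ∧
      ∀ᶠ p' in 𝓝 p, e p' = G (SpectralCurve.incl a ha p')}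

theorem exists_mem_spectralAtlas (p : SpectralCurve a ha) :
    ∃ e ∈ spectralAtlas a ha, p ∈ e.source := by
  set q := SpectralCurve.incl a ha p with hq
  have hqS : q ∈ spectralSet a := Subtype.prop (p := (· ∈ spectralSet a)) p
  have hcont : Continuous (SpectralCurve.incl a ha) := continuous_subtype_val
  set T := trivializationAt ℂ (TangentSpace (M := X) 𝓘(ℂ)) q.proj with hT
  have hqT : q.proj ∈ T.baseSet := FiberBundle.mem_baseSet_trivializationAt' _
  set ψ := extChartAt canonicalModel q with hψ
  set H : ℂ × (ℂ →L[ℂ] ℂ) → ℂ := fun y => localEquation a q.proj (ψ.symm y) with hHdef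
  have hq0 : q ∈ ψ.source := mem_extChartAt_source q
  have hy0 : ψ q ∈ ψ.target := mem_extChartAt_target q
  have hψt : IsOpen ψ.target := isOpen_extChartAt_target q
  have hψs : IsOpen ψ.source := isOpen_extChartAt_source q
  have hψc : ContinuousOn ψ.symm ψ.target := continuousOn_extChartAt_symm q
  have hψsymm : ContMDiffOn 𝓘(ℂ, ℂ × (ℂ →L[ℂ] ℂ)) canonicalModel ω ψ.symm ψ.target :=
    contMDiffOn_extChartAt_symm q
  have hψm : ContMDiffOn canonicalModel 𝓘(ℂ, ℂ × (ℂ →L[ℂ] ℂ)) ω ψ ψ.source := by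
    have := contMDiffOn_extChartAt (I := canonicalModel) (n := ω) (x := q)
    rwa [← extChartAt_source canonicalModel q] at this
  have hproj : Continuous (fun q : CanonicalBundle X => q.proj) :=
    FiberBundle.continuous_proj _ _
  have hback : ψ.symm (ψ q) = q := ψ.left_inv hq0
  have hloc : ContMDiffAt canonicalModel 𝓘(ℂ) ω (localEquation a q.proj) (ψ.symm (ψ q)) := by
    rw [hback]
    exact contMDiffAt_localEquation a q.proj q hqT
  have hH : ContDiffAt ℂ ω H (ψ q) := by
    rw [← contMDiffAt_iff_contDiffAt]
    exact hloc.comp (ψ q) (hψsymm.contMDiffAt (hψt.mem_nhds hy0))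
  have hH' : fderiv ℂ H (ψ q) ≠ 0 := by
    intro h0
    apply ha q hqS
    have hHd : MDifferentiableAt 𝓘(ℂ, ℂ × (ℂ →L[ℂ] ℂ)) 𝓘(ℂ) H (ψ q) :=
      (hH.differentiableAt (by simp)).mdifferentiableAt
    have hψd : MDifferentiableAt canonicalModel 𝓘(ℂ, ℂ × (ℂ →L[ℂ] ℂ)) ψ q :=
      (hψm.contMDiffAt (hψs.mem_nhds hq0)).mdifferentiableAt (by simp)
    have hEq : localEquation a q.proj =ᶠ[𝓝 q] H ∘ ψ := by
      filter_upwards [hψs.mem_nhds hq0] with r hr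
      simp only [hHdef, Function.comp_apply]
      rw [ψ.left_inv hr]
    rw [hEq.mfderiv_eq, mfderiv_comp q hHd hψd, mfderiv_eq_fderiv, h0]
    exact ContinuousLinearMap.zero_comp _
  have hU : ψ.target ∩ ψ.symm ⁻¹' {r : CanonicalBundle X | r.proj ∈ T.baseSet} ∈ 𝓝 (ψ q) := by
    refine (hψc.isOpen_inter_preimage hψt (T.open_baseSet.preimage hproj)).mem_nhds ⟨hy0, ?_⟩
    rw [Set.mem_preimage, hback]
    exact hqT
  obtain ⟨Ψ, hxΨ, hΨU, hΨ1, hΨs, hΨt⟩ := exists_straightening hH hH' hU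
  have hmem : ∀ t : ℂ, ((0 : ℂ), t) ∈ Ψ.target → ψ.symm (Ψ.symm (0, t)) ∈ spectralSet a := by
    intro t ht
    have h1 := Ψ.map_target ht
    rw [mem_spectralSet_iff a q.proj _ (hΨU h1).2]
    have h2 := hΨ1 _ h1
    rw [Ψ.right_inv ht] at h2
    exact h2.symm
  have hzero : ∀ p' : SpectralCurve a ha, SpectralCurve.incl a ha p' ∈ ψ.source →
      ψ (SpectralCurve.incl a ha p') ∈ Ψ.source →
      Ψ (ψ (SpectralCurve.incl a ha p')) = (0, (Ψ (ψ (SpectralCurve.incl a ha p'))).2) := by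
    intro p' h1 h2
    refine Prod.ext ?_ rfl
    rw [hΨ1 _ h2]
    simp only [hHdef]
    rw [ψ.left_inv h1]
    have h3 := (hΨU h2).2
    rw [Set.mem_preimage, ψ.left_inv h1] at h3
    exact (mem_spectralSet_iff a q.proj _ h3).1 (Subtype.prop (p := (· ∈ spectralSet a)) p')
  have hex : ∀ t : ℂ, ∃ r : SpectralCurve a ha, ((0 : ℂ), t) ∈ Ψ.target →
      SpectralCurve.incl a ha r = ψ.symm (Ψ.symm (0, t)) := by
    intro t
    by_cases h : ((0 : ℂ), t) ∈ Ψ.target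
    · exact ⟨⟨_, hmem t h⟩, fun _ => rfl⟩
    · exact ⟨p, fun h' => absurd h' h⟩
  choose inv hinv using hex
  have hψcont : ContinuousOn ψ ψ.source := continuousOn_extChartAt q
  have hopenK : IsOpen (ψ.source ∩ ψ ⁻¹' Ψ.source) :=
    hψcont.isOpen_inter_preimage hψs Ψ.open_source
  have hemb : Continuous (fun t : ℂ => ((0 : ℂ), t)) := by fun_prop
  let e : OpenPartialHomeomorph (SpectralCurve a ha) ℂ :=
    { toFun := fun p' => (Ψ (ψ (SpectralCurve.incl a ha p'))).2
      invFun := inv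
      source := SpectralCurve.incl a ha ⁻¹' (ψ.source ∩ ψ ⁻¹' Ψ.source)
      target := (fun t : ℂ => ((0 : ℂ), t)) ⁻¹' Ψ.target
      map_source' := by
        rintro p' ⟨h1, h2⟩
        change ((0 : ℂ), _) ∈ Ψ.target
        rw [← hzero p' h1 h2]
        exact Ψ.map_source h2
      map_target' := by
        intro t ht
        have h1 := Ψ.map_target ht
        have h2 := (hΨU h1).1
        rw [Set.mem_preimage]
        rw [hinv t ht]
        refine ⟨ψ.map_target h2, ?_⟩
        rw [Set.mem_preimage, ψ.right_inv h2]
        exact h1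
      left_inv' := by
        rintro p' ⟨h1, h2⟩
        apply Subtype.val_injective (p := (· ∈ spectralSet a))
        change SpectralCurve.incl a ha (inv _) = SpectralCurve.incl a ha p'
        have h3 := hzero p' h1 h2
        rw [hinv, ← h3, Ψ.left_inv h2, ψ.left_inv h1]
        rw [← h3]
        exact Ψ.map_source h2
      right_inv' := by
        intro t ht
        rw [hinv t ht, ψ.right_inv (hΨU (Ψ.map_target ht)).1, Ψ.right_inv ht]
      open_source := hopenK.preimage hcont
      open_target := Ψ.open_target.preimage hemb
      continuousOn_toFun := by
        refine continuous_snd.comp_continuousOn ?_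
        refine Ψ.continuousOn.comp (hψcont.comp hcont.continuousOn fun _ h => h.1) fun _ h => h.2
      continuousOn_invFun := by
        refine (Topology.IsEmbedding.subtypeVal.isInducing.continuousOn_iff).2 ?_
        have h1 : ContinuousOn (fun t : ℂ => ψ.symm (Ψ.symm (0, t)))
            ((fun t : ℂ => ((0 : ℂ), t)) ⁻¹' Ψ.target) :=
          hψc.comp (Ψ.symm.continuousOn.comp hemb.continuousOn fun _ h => h)
            fun t ht => (hΨU (Ψ.map_target ht)).1
        exact h1.congr fun t ht => hinv t ht }
  refine ⟨e, ⟨fun t ht => ?_, fun p' hp' => ?_⟩, ⟨hq0, hxΨ⟩⟩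
  · have h1 : ContMDiffAt 𝓘(ℂ) canonicalModel ω (fun t : ℂ => ψ.symm (Ψ.symm (0, t))) t := by
      have h2 : ContMDiffAt 𝓘(ℂ) 𝓘(ℂ, ℂ × (ℂ →L[ℂ] ℂ)) ω (fun t : ℂ => Ψ.symm (0, t)) t := by
        rw [contMDiffAt_iff_contDiffAt]
        exact (hΨt _ ht).comp t (contDiffAt_const.prodMk contDiffAt_id)
      exact (hψsymm.contMDiffAt (hψt.mem_nhds (hΨU (Ψ.map_target ht)).1)).comp t h2
    refine h1.congr_of_eventuallyEq ?_
    filter_upwards [e.open_target.mem_nhds ht] with s hs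
    exact hinv s hs
  · refine ⟨fun r => (Ψ (ψ r)).2, ?_, Filter.Eventually.of_forall fun _ => rfl⟩
    have h2 : ContMDiffAt 𝓘(ℂ, ℂ × (ℂ →L[ℂ] ℂ)) 𝓘(ℂ) ω (fun y => (Ψ y).2)
        (ψ (SpectralCurve.incl a ha p')) := by
      rw [contMDiffAt_iff_contDiffAt]
      exact contDiffAt_snd.comp _ (hΨs _ hp'.2)
    exact h2.comp _ (hψm.contMDiffAt (hψs.mem_nhds hp'.1))

/-- The spectral curve as a complex submanifold of the total space of `K`. -/
instance : ChartedSpace ℂ (SpectralCurve a ha) where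
  atlas := spectralAtlas a ha
  chartAt p := (exists_mem_spectralAtlas a ha p).choose
  mem_chart_source p := (exists_mem_spectralAtlas a ha p).choose_spec.2
  chart_mem_atlas p := (exists_mem_spectralAtlas a ha p).choose_spec.1

instance : IsManifold 𝓘(ℂ) ω (SpectralCurve a ha) := by
  refine isManifold_of_contDiffOn _ _ _ fun e e' he he' => ?_
  simp only [modelWithCornersSelf_coe, modelWithCornersSelf_coe_symm, Function.comp_id,
    Function.id_comp, Set.range_id, Set.inter_univ, Set.preimage_id]
  intro z hz
  refine ContDiffAt.contDiffWithinAt ?_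
  have hz1 : z ∈ e.target := by
    have := hz; simp only [mfld_simps] at this; exact this.1
  have hz2 : e.symm z ∈ e'.source := by
    have := hz; simp only [mfld_simps] at this; exact this.2
  obtain ⟨G, hG, hGe⟩ := he'.2 _ hz2
  have h1 : ContMDiffAt 𝓘(ℂ) 𝓘(ℂ) ω (fun t => G (SpectralCurve.incl a ha (e.symm t))) z :=
    ContMDiffAt.comp z hG (he.1 z hz1)
  refine (contMDiffAt_iff_contDiffAt.1 h1).congr_of_eventuallyEq ?_
  exact (e.symm.continuousAt hz1).eventually hGe

end Spectral

end RiemannSurface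

end

set_option linter.unusedSectionVars false

namespace RiemannSurface

open Filter Set

/-! ### Complex analysis in one variable -/

/-! Suppose that f maps S to the sphere with degree two. The trace under f of a holomorphic one-form
θ on S is a holomorphic one-form on the sphere, hence zero. So θ/df is anti-invariant: it takes
opposite values at the two points of a general fibre
(`IsQuotientByDifferential.exists_forall_add_eq_zero`). The base supplies one-forms on S of two
kinds: pull-backs π*η, and Poincaré residues β/(∂s/∂λ) with β a section of K^n. The residues are
holomorphic because dx/P_y = -dy/P_x on the curve P(x, y) = 0, whose partial derivatives have no
common zero (`exists_analyticAt_residue`).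

For n ≥ 3, take independent one-forms η₁, η₂ on the base and φ = η₂/η₁. Comparing π*η₁ with π*η₂
shows that φ is invariant, hence so is dφ/df. Comparing π*η₁ with the residue of η₁^n shows that
η₁^(n-1)/(∂s/∂λ) is invariant. Their product is thus invariant. But it is also anti-invariant,
because η₁^(n-1) dφ = η₁^(n-3) W, with W the Wronskian, a section of K³, so that its residue is a
holomorphic one-form. The product would vanish on general fibres, yet none of its factors does
(`not_isHyperelliptic_of_three_le`).

For n = 2 and genus at least three, let σ be the involution λ ↦ -λ. Take a general fibre f⁻¹(c) =
{p₁, p₂} and set N = 1/(f-c) - 1/(f∘σ-c). If η vanishes at π(p₁), it vanishes at π(p₂) by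
anti-invariance. Then (η/λ)N has no poles: the zeros of η cancel the simple poles of N, and N, being
odd under σ, cancels the simple poles of 1/λ at the fixed points of σ. So ηN = kλ near p₁ with k
constant. The space of such η has dimension at least two. As N is not identically zero near p₁, two
of them would be proportional (`not_isHyperelliptic_of_three_le_genus`).

Connectedness of S is not needed: values taken by f on an open set, if any, are put into a finite
exceptional set. -/

theorem exists_differentiable_eqOn_compl (E : Finset ℂ) : ∀ t : ℂ → ℂ,
    (∀ w ∉ E, DifferentiableAt ℂ t w) →
    (∀ e ∈ E, Tendsto (fun w => (w - e) * t w) (𝓝[≠] e) (𝓝 0)) →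
    ∃ T : ℂ → ℂ, Differentiable ℂ T ∧ ∀ w ∉ E, T w = t w := by
  induction E using Finset.induction_on with
  | empty => exact fun t hd _ => ⟨t, fun w => hd w (by simp), fun _ _ => rfl⟩
  | insert c E hc ih =>
    -- Growth o(1/(w - c)) makes the singularity at c removable. The function is changed at c only,
    -- and the modified function is passed to the induction hypothesis; this is why t is quantified
    -- inside the induction.
    intro t hd ho
    have hEc : (↑E : Set ℂ)ᶜ ∈ 𝓝 c := E.finite_toSet.isClosed.isOpen_compl.mem_nhds hc
    have hlim : Tendsto (fun w => (w - c) * (t w - t c)) (𝓝[≠] c) (𝓝 0) := by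
      have h1 : Tendsto (fun w => (w - c) * t c) (𝓝[≠] c) (𝓝 0) := by
        have : ContinuousAt (fun w => (w - c) * t c) c := by fun_prop
        simpa using this.tendsto.mono_left nhdsWithin_le_nhds
      simpa [mul_sub] using (ho c (by simp)).sub h1
    have hlo : (fun z => t z - t c) =o[𝓝[≠] c] fun z => (z - c)⁻¹ := by
      refine (Asymptotics.isLittleO_iff_tendsto' ?_).2 ?_
      · filter_upwards [self_mem_nhdsWithin] with z hz h0
        exact absurd h0 (inv_ne_zero (sub_ne_zero.2 hz))
      · refine hlim.congr fun z => ?_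
        rw [div_inv_eq_mul, mul_comm]
    have hdiff := Complex.differentiableOn_update_limUnder_of_isLittleO hEc
      (fun w hw => (hd w (by
        rw [Finset.mem_insert, not_or]; exact ⟨hw.2, hw.1⟩)).differentiableWithinAt) hlo
    set t' := Function.update t c (limUnder (𝓝[≠] c) t)
    obtain ⟨T, hT, hTt⟩ := ih t'
      (fun w hw => hdiff.differentiableAt (E.finite_toSet.isClosed.isOpen_compl.mem_nhds hw))
      (fun e he => by
        have hec : e ≠ c := fun h => hc (h ▸ he)
        refine (ho e (by simp [he])).congr' ?_
        filter_upwards [mem_nhdsWithin_of_mem_nhds (isOpen_ne.mem_nhds hec)] with w hw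
        simp [t', Function.update_of_ne hw])
    refine ⟨T, hT, fun w hw => ?_⟩
    rw [Finset.mem_insert, not_or] at hw
    rw [hTt w hw.2]
    exact Function.update_of_ne hw.1 _ _

/-- If F - F(z₀) vanishes to order m + 1, then F' vanishes to order m, so the quotient has a simple
zero; if F is locally constant the numerator is zero. This bounds the poles of θ/df at the
ramification points of f. -/
theorem _root_.AnalyticAt.tendsto_sub_div_deriv {F : ℂ → ℂ} {z₀ : ℂ} (hF : AnalyticAt ℂ F z₀) :
    Tendsto (fun z => (F z - F z₀) / deriv F z) (𝓝 z₀) (𝓝 0) := by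
  have hG : AnalyticAt ℂ (fun z => F z - F z₀) z₀ := hF.sub analyticAt_const
  by_cases h0 : ∀ᶠ z in 𝓝 z₀, F z - F z₀ = 0
  · refine tendsto_const_nhds.congr' ?_
    filter_upwards [h0] with z hz
    simp [hz]
  · obtain ⟨m, g, hg, hg0, hFg⟩ := hG.exists_eventuallyEq_pow_smul_nonzero_iff.2 h0
    obtain ⟨m, rfl⟩ : ∃ k, m = k + 1 := by
      rcases m with _ | k
      · exact absurd (by simpa using hFg.self_of_nhds) hg0.symm
      · exact ⟨k, rfl⟩
    have hder : ∀ᶠ z in 𝓝 z₀, deriv F z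
        = (z - z₀) ^ m * ((m + 1) * g z + (z - z₀) * deriv g z) := by
      filter_upwards [hFg.eventually_nhds, hg.eventually_analyticAt] with z hz hgz
      have h1 : deriv F z = deriv (fun z => F z - F z₀) z := by simp
      rw [h1, EventuallyEq.deriv_eq hz]
      have h2 : HasDerivAt (fun x => (x - z₀) ^ (m + 1) • g x)
          (((m + 1 : ℕ) * (z - z₀) ^ m * 1) * g z + (z - z₀) ^ (m + 1) * deriv g z) z :=
        (((hasDerivAt_id z).sub_const z₀).pow (m + 1)).mul hgz.differentiableAt.hasDerivAt
      rw [h2.deriv]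
      push_cast
      ring
    have hlim : Tendsto (fun z => (z - z₀) * g z / ((m + 1) * g z + (z - z₀) * deriv g z))
        (𝓝 z₀) (𝓝 0) := by
      have hm : ((m : ℂ) + 1) * g z₀ ≠ 0 := mul_ne_zero (Nat.cast_add_one_ne_zero m) hg0
      have : ContinuousAt
          (fun z => (z - z₀) * g z / ((m + 1) * g z + (z - z₀) * deriv g z)) z₀ := by
        have := hg.continuousAt
        have := hg.deriv.continuousAt
        refine ContinuousAt.div (by fun_prop) (by fun_prop) (by simpa using hm)
      simpa [ContinuousAt] using this
    refine hlim.congr' ?_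
    filter_upwards [hFg, hder] with z h1 h2
    rw [h1, h2, smul_eq_mul]
    by_cases hz : z = z₀
    · simp [hz]
    · rw [pow_succ, mul_assoc, mul_div_mul_left]
      exact pow_ne_zero _ (sub_ne_zero.2 hz)

theorem _root_.AnalyticAt.eventually_eq_of_deriv {F : ℂ → ℂ} {z₀ : ℂ} (hF : AnalyticAt ℂ F z₀)
    (h : ∀ᶠ z in 𝓝 z₀, deriv F z = 0) : ∀ᶠ z in 𝓝 z₀, F z = F z₀ := by
  obtain ⟨r, hr, hball⟩ := Metric.eventually_nhds_iff_ball.1 (h.and hF.eventually_analyticAt)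
  filter_upwards [Metric.ball_mem_nhds z₀ hr] with z hz
  exact Metric.isOpen_ball.is_const_of_deriv_eq_zero (convex_ball z₀ r).isPreconnected
    (fun w hw => (hball w hw).2.differentiableAt.differentiableWithinAt)
    (fun w hw => (hball w hw).1) hz (Metric.mem_ball_self hr)

/-! ### Charts -/

section Charts

variable {Y : Type*} [TopologicalSpace Y] [ChartedSpace ℂ Y] [IsManifold 𝓘(ℂ) ω Y]
variable {N : Type*} [TopologicalSpace N] [ChartedSpace ℂ N] [IsManifold 𝓘(ℂ) ω N]

/-- The derivative of a map between Riemann surfaces, in the preferred charts at `p` and at its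
image. -/
noncomputable def speed (g : Y → N) (p : Y) : ℂ :=
  mfderiv 𝓘(ℂ) 𝓘(ℂ) g p (1 : ℂ)

theorem mdifferentiableAt_chartAt {p₀ p : Y} (hp : p ∈ (chartAt ℂ p₀).source) :
    MDifferentiableAt 𝓘(ℂ) 𝓘(ℂ) (chartAt ℂ p₀) p :=
  mdifferentiableAt_atlas (chart_mem_atlas _ _) hp

theorem mdifferentiableAt_chartAt_symm {p₀ p : Y} (hp : p ∈ (chartAt ℂ p₀).source) :
    MDifferentiableAt 𝓘(ℂ) 𝓘(ℂ) (chartAt ℂ p₀).symm (chartAt ℂ p₀ p) :=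
  mdifferentiableAt_atlas_symm (chart_mem_atlas _ _) ((chartAt ℂ p₀).map_source hp)

theorem eventuallyEq_comp_chartAt {Z : Type*} (g : Y → Z) {p₀ p : Y}
    (hp : p ∈ (chartAt ℂ p₀).source) :
    g =ᶠ[𝓝 p] (g ∘ (chartAt ℂ p₀).symm) ∘ chartAt ℂ p₀ := by
  filter_upwards [(chartAt ℂ p₀).open_source.mem_nhds hp] with q hq
  simp [(chartAt ℂ p₀).left_inv hq]

theorem mdifferentiableAt_comp_chartAt_symm_iff {g : Y → N} {p₀ p : Y}
    (hp : p ∈ (chartAt ℂ p₀).source) :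
    MDifferentiableAt 𝓘(ℂ) 𝓘(ℂ) (g ∘ (chartAt ℂ p₀).symm) (chartAt ℂ p₀ p) ↔
      MDifferentiableAt 𝓘(ℂ) 𝓘(ℂ) g p := by
  refine ⟨fun h => ?_, fun h => ?_⟩
  · exact (h.comp p (mdifferentiableAt_chartAt hp)).congr_of_eventuallyEq
      (eventuallyEq_comp_chartAt g hp)
  · refine MDifferentiableAt.comp (chartAt ℂ p₀ p) ?_ (mdifferentiableAt_chartAt_symm hp)
    rwa [(chartAt ℂ p₀).left_inv hp]

theorem differentiableAt_comp_chartAt_symm_iff {g : Y → ℂ} {p₀ p : Y}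
    (hp : p ∈ (chartAt ℂ p₀).source) :
    DifferentiableAt ℂ (g ∘ (chartAt ℂ p₀).symm) (chartAt ℂ p₀ p) ↔
      MDifferentiableAt 𝓘(ℂ) 𝓘(ℂ) g p := by
  rw [← mdifferentiableAt_comp_chartAt_symm_iff hp, mdifferentiableAt_iff_differentiableAt]

theorem speed_comp {M : Type*} [TopologicalSpace M] [ChartedSpace ℂ M]
    {g : Y → N} {s : M → Y} {p : M} (hg : MDifferentiableAt 𝓘(ℂ) 𝓘(ℂ) g (s p))
    (hs : MDifferentiableAt 𝓘(ℂ) 𝓘(ℂ) s p) :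
    speed (g ∘ s) p = speed s p * speed g (s p) := by
  refine (mfderiv_comp_apply p hg hs (1 : ℂ)).trans ?_
  have h : speed s p = speed s p • (1 : ℂ) := by simp
  exact (congrArg (fun v : ℂ => mfderiv 𝓘(ℂ) 𝓘(ℂ) g (s p) v) h).trans
    (map_smul (mfderiv 𝓘(ℂ) 𝓘(ℂ) g (s p)) (speed s p) (1 : ℂ))

theorem speed_eq_deriv (F : ℂ → ℂ) (z : ℂ) : speed F z = deriv F z := by
  unfold speed
  rw [mfderiv_eq_fderiv]
  rfl

theorem speed_congr {g g' : Y → N} {p : Y} (h : g =ᶠ[𝓝 p] g') : speed g p = speed g' p := by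
  unfold speed
  have := h.mfderiv_eq (I := 𝓘(ℂ)) (I' := 𝓘(ℂ))
  exact congrArg (fun L : ℂ →L[ℂ] ℂ => L 1) this

/-- `speed` is normalised at each point by that point's own preferred chart, which need not vary
continuously. The factor `speed (chartAt ℂ p₀) p` passes to a fixed chart; it cancels in quotients
of one-forms. -/
theorem speed_eq_chartAt {g : Y → N} {p₀ p : Y}
    (hp : p ∈ (chartAt ℂ p₀).source) (hg : MDifferentiableAt 𝓘(ℂ) 𝓘(ℂ) g p) :
    speed g p = speed (chartAt ℂ p₀) p * speed (g ∘ (chartAt ℂ p₀).symm) (chartAt ℂ p₀ p) := by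
  rw [speed_congr (eventuallyEq_comp_chartAt g hp),
    speed_comp ((mdifferentiableAt_comp_chartAt_symm_iff hp).2 hg)
    (mdifferentiableAt_chartAt hp)]

theorem speed_eq_chartAt_deriv {g : Y → ℂ} {p₀ p : Y}
    (hp : p ∈ (chartAt ℂ p₀).source) (hg : MDifferentiableAt 𝓘(ℂ) 𝓘(ℂ) g p) :
    speed g p = speed (chartAt ℂ p₀) p * deriv (g ∘ (chartAt ℂ p₀).symm) (chartAt ℂ p₀ p) := by
  rw [speed_eq_chartAt hp hg, speed_eq_deriv]

theorem speed_chartAt_self (p : Y) : speed (chartAt ℂ p) p = 1 := by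
  have h1 : MDifferentiableAt 𝓘(ℂ) 𝓘(ℂ) (chartAt ℂ p) p :=
    mdifferentiableAt_chartAt (mem_chart_source ℂ p)
  unfold speed
  rw [h1.mfderiv]
  have : writtenInExtChartAt 𝓘(ℂ) 𝓘(ℂ) p (chartAt ℂ p) =ᶠ[𝓝 (extChartAt 𝓘(ℂ) p p)] id := by
    filter_upwards [extChartAt_target_mem_nhds (I := 𝓘(ℂ)) p] with z hz
    simp only [mfld_simps] at hz
    simp only [writtenInExtChartAt, mfld_simps, (chartAt ℂ p).right_inv hz]
    rfl
  have h2 : fderivWithin ℂ (writtenInExtChartAt 𝓘(ℂ) 𝓘(ℂ) p (chartAt ℂ p)) (range 𝓘(ℂ))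
      (extChartAt 𝓘(ℂ) p p) = ContinuousLinearMap.id ℂ ℂ := by
    simp only [modelWithCornersSelf_coe, range_id, fderivWithin_univ]
    rw [this.fderiv_eq, fderiv_id]
  exact congrArg (fun L : ℂ →L[ℂ] ℂ => L 1) h2

/-- Factoring the preferred chart at p through the chart at p₀ writes 1 as a multiple of this
derivative. -/
theorem speed_chartAt_ne_zero {p₀ p : Y} (hp : p ∈ (chartAt ℂ p₀).source) :
    speed (chartAt ℂ p₀) p ≠ 0 := by
  intro h0
  have h1 := speed_eq_chartAt hp (mdifferentiableAt_chartAt (mem_chart_source ℂ p))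
  rw [h0, zero_mul, speed_chartAt_self] at h1
  exact one_ne_zero h1

end Charts

/-! ### The trace of one-forms under a map to the sphere. -/

section Trace

variable {Y : Type*} [TopologicalSpace Y] [ChartedSpace ℂ Y] [IsManifold 𝓘(ℂ) ω Y]

theorem tendsto_chartAt (p₀ : Y) : Tendsto (chartAt ℂ p₀) (𝓝 p₀) (𝓝 (chartAt ℂ p₀ p₀)) :=
  (chartAt ℂ p₀).continuousAt (mem_chart_source ℂ p₀)

theorem tendsto_chartAt_symm (p₀ : Y) :
    Tendsto (chartAt ℂ p₀).symm (𝓝 (chartAt ℂ p₀ p₀)) (𝓝 p₀) := by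
  have := (chartAt ℂ p₀).symm.continuousAt (mem_chart_target ℂ p₀)
  simpa [ContinuousAt] using this

theorem eventually_mem_chart_source (p₀ : Y) : ∀ᶠ p in 𝓝 p₀, p ∈ (chartAt ℂ p₀).source :=
  chart_source_mem_nhds ℂ p₀

theorem tendsto_chartAt_punctured (p₀ : Y) :
    Tendsto (chartAt ℂ p₀) (𝓝[≠] p₀) (𝓝[≠] (chartAt ℂ p₀ p₀)) := by
  refine tendsto_nhdsWithin_iff.2 ⟨(tendsto_chartAt p₀).mono_left nhdsWithin_le_nhds, ?_⟩
  filter_upwards [self_mem_nhdsWithin,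
    nhdsWithin_le_nhds (eventually_mem_chart_source p₀)] with p hp hps h
  exact hp ((chartAt ℂ p₀).injOn hps (mem_chart_source ℂ p₀) h)

theorem analyticAt_comp_chartAt_symm {g : Y → ℂ} {p₀ : Y}
    (h : ∀ᶠ p in 𝓝 p₀, MDifferentiableAt 𝓘(ℂ) 𝓘(ℂ) g p) :
    AnalyticAt ℂ (g ∘ (chartAt ℂ p₀).symm) (chartAt ℂ p₀ p₀) := by
  rw [Complex.analyticAt_iff_eventually_differentiableAt]
  filter_upwards [(tendsto_chartAt_symm p₀).eventually h, chart_target_mem_nhds ℂ p₀] with z hz hzt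
  have := (differentiableAt_comp_chartAt_symm_iff (g := g) ((chartAt ℂ p₀).map_target hzt)).2 hz
  rwa [(chartAt ℂ p₀).right_inv hzt] at this

theorem nhds_le_of_punctured {p₀ : Y} {Q : Y → Prop} (h : ∀ᶠ p in 𝓝[≠] p₀, Q p) (h0 : Q p₀) :
    ∀ᶠ p in 𝓝 p₀, Q p := by
  rw [eventually_nhdsWithin_iff] at h
  filter_upwards [h] with p hp
  by_cases hpp : p = p₀
  · rwa [hpp]
  · exact hp hpp

theorem coe_sphereCoord {q : OnePoint ℂ} (hq : q ≠ OnePoint.infty) :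
    ((sphereCoord q : ℂ) : OnePoint ℂ) = q := by
  induction q using OnePoint.rec with
  | infty => exact absurd rfl hq
  | coe x => rfl

theorem sphereCoord_eq_inv (q : OnePoint ℂ) : sphereCoord q = (sphereCoordInv q)⁻¹ := by
  induction q using OnePoint.rec with
  | infty => simp [sphereCoord, sphereCoordInv]
  | coe x => simp [sphereCoord, sphereCoordInv]

theorem sphereCoordInv_eq_zero {q : OnePoint ℂ} (hq : q ≠ ((0 : ℂ) : OnePoint ℂ)) :
    sphereCoordInv q = 0 ↔ q = OnePoint.infty := by
  induction q using OnePoint.rec with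
  | infty => simp [sphereCoordInv]
  | coe x =>
    have : x ≠ 0 := fun h => hq (h ▸ rfl)
    simp [sphereCoordInv, this]

variable {f : Y → OnePoint ℂ}

theorem IsHolomorphicToSphere.eventually_coord (hf : IsHolomorphicToSphere f) {p₀ : Y}
    (hp : f p₀ ≠ OnePoint.infty) :
    ∀ᶠ p in 𝓝 p₀, f p ≠ OnePoint.infty ∧
      MDifferentiableAt 𝓘(ℂ) 𝓘(ℂ) (fun t => sphereCoord (f t)) p := by
  filter_upwards [hf.continuous.continuousAt.eventually (isOpen_ne.mem_nhds hp)] with p h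
  exact ⟨h, hf.holomorphic_coord p h⟩

theorem IsHolomorphicToSphere.eventually_coordInv (hf : IsHolomorphicToSphere f) {p₀ : Y}
    (hp : f p₀ ≠ ((0 : ℂ) : OnePoint ℂ)) :
    ∀ᶠ p in 𝓝 p₀, f p ≠ ((0 : ℂ) : OnePoint ℂ) ∧
      MDifferentiableAt 𝓘(ℂ) 𝓘(ℂ) (fun t => sphereCoordInv (f t)) p := by
  filter_upwards [hf.continuous.continuousAt.eventually (isOpen_ne.mem_nhds hp)] with p h
  exact ⟨h, hf.holomorphic_coordInv p h⟩

/-- The coordinate of `f`, read in the preferred chart at `p₀`. -/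
noncomputable def localCoord (f : Y → OnePoint ℂ) (p₀ : Y) : ℂ → ℂ :=
  (fun t => sphereCoord (f t)) ∘ (chartAt ℂ p₀).symm

/-- The inverse coordinate of `f`, read in the preferred chart at `p₀`. -/
noncomputable def localCoordInv (f : Y → OnePoint ℂ) (p₀ : Y) : ℂ → ℂ :=
  (fun t => sphereCoordInv (f t)) ∘ (chartAt ℂ p₀).symm

theorem localCoord_apply_chartAt {p₀ p : Y} (hp : p ∈ (chartAt ℂ p₀).source) :
    localCoord f p₀ (chartAt ℂ p₀ p) = sphereCoord (f p) := by
  simp [localCoord, (chartAt ℂ p₀).left_inv hp]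

theorem localCoordInv_apply_chartAt {p₀ p : Y} (hp : p ∈ (chartAt ℂ p₀).source) :
    localCoordInv f p₀ (chartAt ℂ p₀ p) = sphereCoordInv (f p) := by
  simp [localCoordInv, (chartAt ℂ p₀).left_inv hp]

theorem localCoord_eq_inv (p₀ : Y) : localCoord f p₀ = (localCoordInv f p₀)⁻¹ := by
  funext z
  exact sphereCoord_eq_inv _

theorem deriv_localCoord {p₀ : Y} {z : ℂ} (h : DifferentiableAt ℂ (localCoordInv f p₀) z)
    (h0 : localCoordInv f p₀ z ≠ 0) :
    deriv (localCoord f p₀) z = - deriv (localCoordInv f p₀) z / localCoordInv f p₀ z ^ 2 := by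
  rw [localCoord_eq_inv, deriv_inv'' h h0]

theorem infty_ne_zero : (OnePoint.infty : OnePoint ℂ) ≠ ((0 : ℂ) : OnePoint ℂ) :=
  OnePoint.infty_ne_coe 0

/-- Zeros of the analytic derivative are isolated unless it vanishes identically. At a pole the same
argument runs with 1/f, and F' = -(1/F)'/(1/F)² transfers the result. Both alternatives are needed
since the surface is not assumed connected. -/
theorem IsHolomorphicToSphere.eventually_const_or_regular (hf : IsHolomorphicToSphere f) (p₀ : Y) :
    (∀ᶠ p in 𝓝 p₀, f p = f p₀) ∨ ∀ᶠ p in 𝓝[≠] p₀, f p ≠ OnePoint.infty ∧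
      deriv (localCoord f p₀) (chartAt ℂ p₀ p) ≠ 0 := by
  by_cases hp : f p₀ = OnePoint.infty
  · have hp' : f p₀ ≠ ((0 : ℂ) : OnePoint ℂ) := hp ▸ infty_ne_zero
    have hev := hf.eventually_coordInv hp'
    have hA : AnalyticAt ℂ (localCoordInv f p₀) (chartAt ℂ p₀ p₀) :=
      analyticAt_comp_chartAt_symm (hev.mono fun p h => h.2)
    have h0 : localCoordInv f p₀ (chartAt ℂ p₀ p₀) = 0 := by
      rw [localCoordInv_apply_chartAt (mem_chart_source ℂ p₀), hp]
      rfl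
    have hconst : (∀ᶠ z in 𝓝 (chartAt ℂ p₀ p₀), localCoordInv f p₀ z = 0) →
        ∀ᶠ p in 𝓝 p₀, f p = f p₀ := by
      intro h
      filter_upwards [(tendsto_chartAt p₀).eventually h, eventually_mem_chart_source p₀, hev]
        with p h1 h2 h3
      rw [localCoordInv_apply_chartAt h2, sphereCoordInv_eq_zero h3.1] at h1
      rw [h1, hp]
    rcases hA.eventually_eq_zero_or_eventually_ne_zero with h | h
    · exact Or.inl (hconst h)
    rcases hA.deriv.eventually_eq_zero_or_eventually_ne_zero with h' | h'
    · left
      apply hconst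
      simpa [h0] using hA.eventually_eq_of_deriv h'
    · right
      filter_upwards [(tendsto_chartAt_punctured p₀).eventually (h.and (h'.and
        (nhdsWithin_le_nhds hA.eventually_analyticAt))),
        nhdsWithin_le_nhds (eventually_mem_chart_source p₀), nhdsWithin_le_nhds hev] with p h1 h2 h3
      refine ⟨fun hinf => h1.1 ?_, ?_⟩
      · rw [localCoordInv_apply_chartAt h2, hinf]
        rfl
      · rw [deriv_localCoord h1.2.2.differentiableAt h1.1]
        exact div_ne_zero (neg_ne_zero.2 h1.2.1) (pow_ne_zero _ h1.1)
  · have hev := hf.eventually_coord hp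
    have hA : AnalyticAt ℂ (localCoord f p₀) (chartAt ℂ p₀ p₀) :=
      analyticAt_comp_chartAt_symm (hev.mono fun p h => h.2)
    rcases hA.deriv.eventually_eq_zero_or_eventually_ne_zero with h | h
    · left
      filter_upwards [(tendsto_chartAt p₀).eventually (hA.eventually_eq_of_deriv h),
        eventually_mem_chart_source p₀, hev] with p h1 h2 h3
      rw [localCoord_apply_chartAt h2, localCoord_apply_chartAt (mem_chart_source ℂ p₀)] at h1
      rw [← coe_sphereCoord h3.1, h1, coe_sphereCoord hp]
    · right
      filter_upwards [(tendsto_chartAt_punctured p₀).eventually h, nhdsWithin_le_nhds hev]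
        with p h1 h2
      exact ⟨h2.1, h1⟩

/-- `h` is the quotient of a holomorphic one-form on `Y` by the differential of `f`, away from a
discrete set. -/
def IsQuotientByDifferential (f : Y → OnePoint ℂ) (h : Y → ℂ) : Prop :=
  ∀ p₀ : Y, ∃ k : ℂ → ℂ, AnalyticAt ℂ k (chartAt ℂ p₀ p₀) ∧
    ∀ᶠ p in 𝓝[≠] p₀, h p = k (chartAt ℂ p₀ p) / deriv (localCoord f p₀) (chartAt ℂ p₀ p)

/-- With h = k/F' in the chart, the product is k·(F - F(z₀))/F', which tends to 0 even at a
ramification point. -/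
theorem IsQuotientByDifferential.eventually_norm_mul_lt {h : Y → ℂ}
    (hh : IsQuotientByDifferential f h) (hf : IsHolomorphicToSphere f) {p₀ : Y}
    (hp : f p₀ ≠ OnePoint.infty) {ε : ℝ} (hε : 0 < ε) :
    ∀ᶠ p in 𝓝 p₀, ‖(sphereCoord (f p) - sphereCoord (f p₀)) * h p‖ < ε := by
  obtain ⟨k, hk, hkh⟩ := hh p₀
  have hA : AnalyticAt ℂ (localCoord f p₀) (chartAt ℂ p₀ p₀) :=
    analyticAt_comp_chartAt_symm ((hf.eventually_coord hp).mono fun p h => h.2)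
  have hlim := (hk.continuousAt.tendsto.mul hA.tendsto_sub_div_deriv).comp (tendsto_chartAt p₀)
  rw [mul_zero] at hlim
  refine nhds_le_of_punctured ?_ (by simpa using hε)
  filter_upwards [hkh, nhdsWithin_le_nhds (eventually_mem_chart_source p₀),
    nhdsWithin_le_nhds (hlim.norm.eventually_lt_const (by simpa using hε))] with p h1 h2 h3
  rw [Function.comp_apply, localCoord_apply_chartAt h2,
    localCoord_apply_chartAt (mem_chart_source ℂ p₀)] at h3
  rw [h1]
  refine lt_of_eq_of_lt (congrArg _ ?_) h3
  ring

/-- Put G = 1/F, so that F' = -G'/G² and h = -(kG)·(G/G'); both G and G/G' tend to 0 at a pole of f.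
-/
theorem IsQuotientByDifferential.eventually_norm_lt {h : Y → ℂ}
    (hh : IsQuotientByDifferential f h) (hf : IsHolomorphicToSphere f) {p₀ : Y}
    (hp : f p₀ = OnePoint.infty) {ε : ℝ} (hε : 0 < ε) :
    ∀ᶠ p in 𝓝 p₀, f p ≠ OnePoint.infty → ‖h p‖ < ε := by
  obtain ⟨k, hk, hkh⟩ := hh p₀
  have hp' : f p₀ ≠ ((0 : ℂ) : OnePoint ℂ) := hp ▸ infty_ne_zero
  have hev := hf.eventually_coordInv hp'
  have hA : AnalyticAt ℂ (localCoordInv f p₀) (chartAt ℂ p₀ p₀) :=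
    analyticAt_comp_chartAt_symm (hev.mono fun p h => h.2)
  have h0 : localCoordInv f p₀ (chartAt ℂ p₀ p₀) = 0 := by
    rw [localCoordInv_apply_chartAt (mem_chart_source ℂ p₀), hp]
    rfl
  have hlim := ((hk.continuousAt.tendsto.mul hA.continuousAt.tendsto).mul
    hA.tendsto_sub_div_deriv).comp (tendsto_chartAt p₀)
  rw [mul_zero] at hlim
  refine nhds_le_of_punctured ?_ (fun h => absurd hp h)
  filter_upwards [hkh, nhdsWithin_le_nhds (eventually_mem_chart_source p₀),
    nhdsWithin_le_nhds ((tendsto_chartAt p₀).eventually hA.eventually_analyticAt),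
    nhdsWithin_le_nhds hev,
    nhdsWithin_le_nhds (hlim.norm.eventually_lt_const (by simpa using hε))] with p h1 h2 h3 h4 h5 h6
  have hne : localCoordInv f p₀ (chartAt ℂ p₀ p) ≠ 0 := by
    rw [localCoordInv_apply_chartAt h2, Ne, sphereCoordInv_eq_zero h4.1]
    exact h6
  rw [Function.comp_apply, h0, sub_zero] at h5
  rw [h1, deriv_localCoord h3.differentiableAt hne, ← norm_neg]
  refine lt_of_eq_of_lt (congrArg _ ?_) h5
  rw [neg_div, div_neg, neg_neg, div_div_eq_mul_div]
  ring

/-- Near each p₀ the property can fail only at points where f takes the value f p₀. By compactness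
finitely many such values suffice. -/
theorem exists_finset_forall_of_eventually [CompactSpace Y] {Q : Y → Prop}
    (h : ∀ p₀, (∀ᶠ p in 𝓝 p₀, f p = f p₀) ∨ ∀ᶠ p in 𝓝[≠] p₀, Q p) :
    ∃ E : Finset (OnePoint ℂ), ∀ p, f p ∉ E → Q p := by
  classical
  have key : ∀ p₀, ∀ᶠ p in 𝓝 p₀, f p ≠ f p₀ → Q p := by
    intro p₀
    rcases h p₀ with h | h
    · exact h.mono fun p hp hp' => absurd hp hp'
    · exact nhds_le_of_punctured (h.mono fun p hp _ => hp) fun h => absurd rfl h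
  obtain ⟨t, -, ht⟩ := isCompact_univ.elim_nhds_subcover (fun p₀ => {p | f p ≠ f p₀ → Q p})
    fun p₀ _ => key p₀
  refine ⟨t.image f, fun p hp => ?_⟩
  obtain ⟨p₀, hp₀, hpp⟩ := mem_iUnion₂.1 (ht (mem_univ p))
  exact hpp fun heq => hp (heq ▸ Finset.mem_image_of_mem f hp₀)

theorem IsHolomorphicToSphere.speed_eq (hf : IsHolomorphicToSphere f) {p₀ p : Y}
    (hp : p ∈ (chartAt ℂ p₀).source) (hp' : f p ≠ OnePoint.infty) :
    speed (fun t => sphereCoord (f t)) p =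
      speed (chartAt ℂ p₀) p * deriv (localCoord f p₀) (chartAt ℂ p₀ p) :=
  speed_eq_chartAt_deriv hp (hf.holomorphic_coord p hp')

/-- The inverse function theorem, applied to f read in the preferred chart. -/
theorem IsHolomorphicToSphere.exists_local_section (hf : IsHolomorphicToSphere f) {p₀ : Y}
    (hp : f p₀ ≠ OnePoint.infty) (h0 : speed (fun t => sphereCoord (f t)) p₀ ≠ 0) :
    ∃ s : ℂ → Y, s (sphereCoord (f p₀)) = p₀ ∧
      (∀ᶠ w in 𝓝 (sphereCoord (f p₀)), MDifferentiableAt 𝓘(ℂ) 𝓘(ℂ) s w) ∧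
      ∀ᶠ w in 𝓝 (sphereCoord (f p₀)), f (s w) = (w : OnePoint ℂ) := by
  have hA : AnalyticAt ℂ (localCoord f p₀) (chartAt ℂ p₀ p₀) :=
    analyticAt_comp_chartAt_symm ((hf.eventually_coord hp).mono fun p h => h.2)
  have hd : deriv (localCoord f p₀) (chartAt ℂ p₀ p₀) ≠ 0 := fun h => h0 (by
    rw [hf.speed_eq (mem_chart_source ℂ p₀) hp, h, mul_zero])
  have hstr : HasStrictDerivAt (localCoord f p₀) (deriv (localCoord f p₀) (chartAt ℂ p₀ p₀))
    (chartAt ℂ p₀ p₀) := hA.hasStrictDerivAt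
  obtain ⟨r, hr, hr0, hrr⟩ : ∃ r : ℂ → ℂ, AnalyticAt ℂ r (sphereCoord (f p₀)) ∧
      r (sphereCoord (f p₀)) = chartAt ℂ p₀ p₀ ∧
      ∀ᶠ w in 𝓝 (sphereCoord (f p₀)), localCoord f p₀ (r w) = w := by
    rw [← localCoord_apply_chartAt (f := f) (mem_chart_source ℂ p₀)]
    exact ⟨_, hA.analyticAt_localInverse hd, HasStrictFDerivAt.localInverse_apply_image ..,
      HasStrictDerivAt.eventually_right_inverse ..⟩
  have hrt : Tendsto r (𝓝 (sphereCoord (f p₀))) (𝓝 (chartAt ℂ p₀ p₀)) := by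
    simpa [ContinuousAt, hr0] using hr.continuousAt
  refine ⟨(chartAt ℂ p₀).symm ∘ r, ?_, ?_, ?_⟩
  · simp [hr0]
  · filter_upwards [hr.eventually_analyticAt, hrt.eventually (chart_target_mem_nhds ℂ p₀)]
      with w h1 h2
    exact (mdifferentiableAt_atlas_symm (chart_mem_atlas _ _) h2).comp w
      h1.differentiableAt.mdifferentiableAt
  · filter_upwards [hrr, ((tendsto_chartAt_symm p₀).comp hrt).eventually (hf.eventually_coord hp)]
      with w h1 h2
    rw [← coe_sphereCoord h2.1]
    exact congrArg _ h1

theorem IsHolomorphicToSphere.analyticAt_localCoord (hf : IsHolomorphicToSphere f) {p₀ p : Y}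
    (hp : p ∈ (chartAt ℂ p₀).source) (hp' : f p ≠ OnePoint.infty) :
    AnalyticAt ℂ (localCoord f p₀) (chartAt ℂ p₀ p) := by
  rw [Complex.analyticAt_iff_eventually_differentiableAt]
  have h1 : Tendsto (chartAt ℂ p₀).symm (𝓝 (chartAt ℂ p₀ p)) (𝓝 p) := by
    have := (chartAt ℂ p₀).symm.continuousAt ((chartAt ℂ p₀).map_source hp)
    simpa [ContinuousAt, (chartAt ℂ p₀).left_inv hp] using this
  filter_upwards [h1.eventually (hf.eventually_coord hp'),
    (chartAt ℂ p₀).open_target.mem_nhds ((chartAt ℂ p₀).map_source hp)] with z hz hzt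
  have := (differentiableAt_comp_chartAt_symm_iff (g := fun t => sphereCoord (f t))
    ((chartAt ℂ p₀).map_target hzt)).2 hz.2
  rwa [(chartAt ℂ p₀).right_inv hzt] at this

theorem eventually_punctured_eventually [T1Space Y] {p₀ : Y} {Q : Y → Prop}
    (h : ∀ᶠ p in 𝓝[≠] p₀, Q p) : ∀ᶠ p in 𝓝[≠] p₀, ∀ᶠ p' in 𝓝 p, Q p' := by
  filter_upwards [eventually_eventually_nhdsWithin.2 h, self_mem_nhdsWithin] with p hp hne
  rwa [IsOpen.nhdsWithin_eq isOpen_compl_singleton hne] at hp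

/-- `p` is a regular point of the finite coordinate of `f`. -/
def IsRegularPoint (f : Y → OnePoint ℂ) (p : Y) : Prop :=
  f p ≠ OnePoint.infty ∧ speed (fun t => sphereCoord (f t)) p ≠ 0

theorem IsHolomorphicToSphere.eventually_const_or_isRegularPoint
    (hf : IsHolomorphicToSphere f) (p₀ : Y) :
    (∀ᶠ p in 𝓝 p₀, f p = f p₀) ∨ ∀ᶠ p in 𝓝[≠] p₀, IsRegularPoint f p := by
  refine (hf.eventually_const_or_regular p₀).imp_right fun h => ?_
  filter_upwards [h, nhdsWithin_le_nhds (eventually_mem_chart_source p₀)] with p h1 h2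
  refine ⟨h1.1, ?_⟩
  rw [hf.speed_eq h2 h1.1]
  exact mul_ne_zero (speed_chartAt_ne_zero h2) h1.2

theorem IsQuotientByDifferential.eventually_const_or_regular [T1Space Y] {h : Y → ℂ}
    (hh : IsQuotientByDifferential f h) (hf : IsHolomorphicToSphere f) (p₀ : Y) :
    (∀ᶠ p in 𝓝 p₀, f p = f p₀) ∨ ∀ᶠ p in 𝓝[≠] p₀, IsRegularPoint f p ∧
      MDifferentiableAt 𝓘(ℂ) 𝓘(ℂ) h p := by
  rcases hf.eventually_const_or_regular p₀ with h1 | h1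
  · exact Or.inl h1
  rcases hf.eventually_const_or_isRegularPoint p₀ with h2 | h2
  · exact Or.inl h2
  right
  obtain ⟨k, hk, hkh⟩ := hh p₀
  filter_upwards [h1, h2, eventually_punctured_eventually hkh,
    nhdsWithin_le_nhds (eventually_mem_chart_source p₀),
    nhdsWithin_le_nhds ((tendsto_chartAt p₀).eventually hk.eventually_analyticAt)]
    with p h1 h2 h3 h4 h5
  refine ⟨h2, MDifferentiableAt.congr_of_eventuallyEq ?_ h3⟩
  have h6 : DifferentiableAt ℂ (fun z => k z / deriv (localCoord f p₀) z) (chartAt ℂ p₀ p) :=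
    h5.differentiableAt.div (hf.analyticAt_localCoord h4 h1.1).deriv.differentiableAt h1.2
  exact h6.mdifferentiableAt.comp p (mdifferentiableAt_chartAt h4)

/-- The trace to the sphere of a holomorphic one-form under a map with two-point general fibres
vanishes. -/
theorem IsQuotientByDifferential.exists_forall_add_eq_zero [CompactSpace Y] [T2Space Y] {h : Y → ℂ}
    (hh : IsQuotientByDifferential f h) (hf : IsHolomorphicToSphere f)
    (hfib : {q : OnePoint ℂ | (f ⁻¹' {q}).encard ≠ 2}.Finite) :
    ∃ E : Finset (OnePoint ℂ), ∀ p₁ p₂, p₁ ≠ p₂ → f p₁ = f p₂ → f p₁ ∉ E → h p₁ + h p₂ = 0 := by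
  classical
  obtain ⟨E₁, hE₁⟩ := exists_finset_forall_of_eventually (hh.eventually_const_or_regular hf)
  set E : Finset (OnePoint ℂ) := hfib.toFinset ∪ E₁ ∪ {OnePoint.infty} with hE
  have hEreg : ∀ p, f p ∉ E → IsRegularPoint f p ∧ MDifferentiableAt 𝓘(ℂ) 𝓘(ℂ) h p :=
    fun p hp => hE₁ p fun h => hp (by simp [hE, h])
  have hEfib : ∀ q ∉ E, (f ⁻¹' {q}).encard = 2 := by
    intro q hq
    by_contra h
    exact hq (by simp [hE, h])
  set Ec : Finset ℂ := E.preimage (fun w : ℂ => (w : OnePoint ℂ)) OnePoint.coe_injective.injOn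
  have hEc : ∀ {w : ℂ}, w ∈ Ec ↔ (w : OnePoint ℂ) ∈ E := Finset.mem_preimage
  -- The trace, as a coefficient of dw. Summing over the fibre as a set avoids ordering its two
  -- points.
  set t : ℂ → ℂ := fun w => ∑ᶠ p ∈ f ⁻¹' {(w : OnePoint ℂ)}, h p with ht
  have hpair : ∀ (w : ℂ) (p₁ p₂ : Y), w ∉ Ec → p₁ ≠ p₂ → f p₁ = w → f p₂ = w →
      t w = h p₁ + h p₂ := by
    intro w p₁ p₂ hw hne h1 h2
    have h3 : ({p₁, p₂} : Set Y) = f ⁻¹' {(w : OnePoint ℂ)} := by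
      refine Set.Finite.eq_of_subset_of_encard_le' (Set.finite_of_encard_eq_coe (k := 2) (hEfib _ fun h => hw (hEc.2 h))) ?_ ?_
      · rintro x (rfl | rfl)
        · exact h1
        · exact h2
      · rw [hEfib _ (fun h => hw (hEc.2 h)), Set.encard_pair hne]
    rw [ht]
    simp only
    rw [← h3, finsum_mem_pair hne]
  have hex : ∀ w ∉ Ec, ∃ p₁ p₂ : Y, p₁ ≠ p₂ ∧ f p₁ = w ∧ f p₂ = w := by
    intro w hw
    obtain ⟨x, y, hxy, h1⟩ := Set.encard_eq_two.1 (hEfib _ (fun h => hw (hEc.2 h)))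
    refine ⟨x, y, hxy, ?_, ?_⟩
    · have : x ∈ f ⁻¹' {(w : OnePoint ℂ)} := by rw [h1]; simp
      exact this
    · have : y ∈ f ⁻¹' {(w : OnePoint ℂ)} := by rw [h1]; simp
      exact this
  have hEnhds : ∀ w ∉ Ec, ∀ᶠ w' in 𝓝 w, w' ∉ Ec := fun w hw =>
    Ec.finite_toSet.isClosed.isOpen_compl.mem_nhds hw
  have hdiff : ∀ w ∉ Ec, DifferentiableAt ℂ t w := by
    intro w hw
    obtain ⟨p₁, p₂, hne, h1, h2⟩ := hex w hw
    have hsec : ∀ p, f p = w → ∃ s : ℂ → Y, s w = p ∧ DifferentiableAt ℂ (h ∘ s) w ∧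
        ContinuousAt s w ∧ ∀ᶠ w' in 𝓝 w, f (s w') = (w' : OnePoint ℂ) := by
      intro p hp
      have hp' : sphereCoord (f p) = w := by rw [hp]; rfl
      obtain ⟨⟨hr1, hr2⟩, hr3⟩ := hEreg p (fun h => hw (hEc.2 (hp ▸ h)))
      obtain ⟨s, hs1, hs2, hs3⟩ := hf.exists_local_section hr1 hr2
      rw [hp'] at hs1 hs2 hs3
      refine ⟨s, hs1, ?_, hs2.self_of_nhds.continuousAt, hs3⟩
      rw [← hs1] at hr3
      exact (hr3.comp w hs2.self_of_nhds).differentiableAt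
    obtain ⟨s₁, ha1, ha2, ha3, ha4⟩ := hsec p₁ h1
    obtain ⟨s₂, hb1, hb2, hb3, hb4⟩ := hsec p₂ h2
    -- Local sections through the two points stay distinct nearby, so they exhaust the neighbouring
    -- fibres and t is the sum of h along them.
    have hsne : ∀ᶠ w' in 𝓝 w, s₁ w' ≠ s₂ w' :=
      (ha3.prodMk hb3).eventually (isClosed_diagonal.isOpen_compl.mem_nhds (by
        simpa [ha1, hb1] using hne))
    have hev : t =ᶠ[𝓝 w] fun w' => (h ∘ s₁) w' + (h ∘ s₂) w' := by
      filter_upwards [hEnhds w hw, ha4, hb4, hsne] with w' e1 e2 e3 e4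
      exact hpair w' _ _ e1 e4 e2 e3
    exact (ha2.add hb2).congr_of_eventuallyEq hev
  -- As f is closed, an estimate near every point of one fibre holds on all neighbouring fibres.
  have hclosed : IsClosedMap f := hf.continuous.isClosedMap
  have hpole : ∀ e ∈ Ec, Tendsto (fun w => (w - e) * t w) (𝓝[≠] e) (𝓝 0) := by
    intro e _
    rw [Metric.tendsto_nhds]
    intro ε hε
    have h1 : ∀ᶠ q in 𝓝 (e : OnePoint ℂ), ∀ p ∈ f ⁻¹' {q},
        ‖(sphereCoord (f p) - e) * h p‖ < ε / 2 := by
      refine hclosed.eventually_nhds_fiber _ fun p hp => ?_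
      have hp : f p = e := hp
      have h2 := hh.eventually_norm_mul_lt hf (p₀ := p) (hp ▸ OnePoint.coe_ne_infty e)
        (half_pos hε)
      rwa [hp] at h2
    have h3 : ∀ᶠ w in 𝓝[≠] e, w ∉ Ec := by
      have := (Ec.erase e).finite_toSet.isClosed.isOpen_compl.mem_nhds (x := e) (by simp)
      filter_upwards [nhdsWithin_le_nhds this, self_mem_nhdsWithin] with w hw hne hwE
      exact hw (Finset.mem_coe.2 (Finset.mem_erase.2 ⟨hne, hwE⟩))
    filter_upwards [h3, nhdsWithin_le_nhds
      ((OnePoint.continuous_coe.continuousAt (x := e)).eventually h1)] with w hw hb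
    obtain ⟨p₁, p₂, hne, h1, h2⟩ := hex w hw
    have hb1 := hb p₁ h1
    have hb2 := hb p₂ h2
    rw [h1] at hb1
    rw [h2] at hb2
    rw [hpair w p₁ p₂ hw hne h1 h2, dist_zero_right, mul_add]
    have hcoe : sphereCoord (w : OnePoint ℂ) = w := rfl
    rw [hcoe] at hb1 hb2
    linarith [norm_add_le ((w - e) * h p₁) ((w - e) * h p₂)]
  have hinf : Tendsto t (cocompact ℂ) (𝓝 0) := by
    rw [Metric.tendsto_nhds]
    intro ε hε
    have h1 : ∀ᶠ q in 𝓝 (OnePoint.infty : OnePoint ℂ), ∀ p ∈ f ⁻¹' {q},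
        f p ≠ OnePoint.infty → ‖h p‖ < ε / 2 :=
      hclosed.eventually_nhds_fiber _ fun p hp => hh.eventually_norm_lt hf hp (half_pos hε)
    have h2 : Tendsto (fun w : ℂ => (w : OnePoint ℂ)) (cocompact ℂ) (𝓝 OnePoint.infty) := by
      rw [← coclosedCompact_eq_cocompact]
      exact OnePoint.tendsto_coe_infty
    filter_upwards [h2.eventually h1, Ec.finite_toSet.isCompact.compl_mem_cocompact] with w hb hw
    obtain ⟨p₁, p₂, hne, h1, h2⟩ := hex w hw
    have hb1 := hb p₁ h1 (h1 ▸ OnePoint.coe_ne_infty w)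
    have hb2 := hb p₂ h2 (h2 ▸ OnePoint.coe_ne_infty w)
    rw [hpair w p₁ p₂ hw hne h1 h2, dist_zero_right]
    linarith [norm_add_le (h p₁) (h p₂)]
  -- After removal of singularities the trace is entire and tends to 0 at infinity, so it vanishes
  -- by Liouville's theorem.
  obtain ⟨T, hT, hTt⟩ := exists_differentiable_eqOn_compl Ec t hdiff hpole
  have hTinf : Tendsto T (cocompact ℂ) (𝓝 0) := by
    refine hinf.congr' ?_
    filter_upwards [Ec.finite_toSet.isCompact.compl_mem_cocompact] with w hw
    exact (hTt w hw).symm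
  refine ⟨E, fun p₁ p₂ hne h12 hp => ?_⟩
  have hne' : f p₁ ≠ OnePoint.infty := fun h => hp (by simp [hE, h])
  have hc := coe_sphereCoord hne'
  have hw : sphereCoord (f p₁) ∉ Ec := fun h => hp (hc ▸ hEc.1 h)
  rw [← hpair _ p₁ p₂ hw hne hc.symm (h12 ▸ hc.symm), ← hTt _ hw]
  exact hT.apply_eq_of_tendsto_cocompact _ hTinf

end Trace

/-! ### Differentials in local coordinates. -/

section Forms

variable {X : Type*} [TopologicalSpace X] [ChartedSpace ℂ X] [IsManifold 𝓘(ℂ) ω X]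

/-- The value of a differential of degree `j` at `x` on the multiple `v` of the unit tangent vector
of the preferred chart at `x`. -/
noncomputable def formEval {j : ℕ} (η : differentials X j) (x : X) (v : ℂ) : ℂ :=
  (η : TangentBundle 𝓘(ℂ) X → ℂ) ⟨x, v⟩

theorem formEval_mul {j : ℕ} (η : differentials X j) (x : X) (c v : ℂ) :
    formEval η x (c * v) = c ^ j * formEval η x v :=
  η.2.2 x c v

theorem formEval_eq {j : ℕ} (η : differentials X j) (x : X) (v : ℂ) :
    formEval η x v = v ^ j * formEval η x 1 := by
  rw [← formEval_mul, mul_one]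

theorem formEval_add {j : ℕ} (η η' : differentials X j) (x : X) (v : ℂ) :
    formEval (η + η') x v = formEval η x v + formEval η' x v := rfl

theorem formEval_smul {j : ℕ} (c : ℂ) (η : differentials X j) (x : X) (v : ℂ) :
    formEval (c • η) x v = c * formEval η x v := rfl

/-- The coordinate vector field of the preferred chart at `x₀`, as a multiple of the unit tangent
vector of the preferred chart at `x`. -/
noncomputable def frame (x₀ x : X) : ℂ := coordField x₀ x

/-- The coordinate field ∂/∂z is dual to the differential of the chart. -/
theorem speed_chartAt_mul_frame {x₀ x : X} (hx : x ∈ (chartAt ℂ x₀).source) :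
    speed (chartAt ℂ x₀) x * frame x₀ x = 1 := by
  have hb : x ∈ (trivializationAt ℂ (TangentSpace (M := X) 𝓘(ℂ)) x₀).baseSet := by
    rwa [TangentBundle.trivializationAt_baseSet]
  have h1 := (trivializationAt ℂ (TangentSpace (M := X) 𝓘(ℂ)) x₀).continuousLinearMapAt_symmL
    (R := ℂ) hb (1 : ℂ)
  rw [TangentBundle.continuousLinearMapAt_trivializationAt hx] at h1
  have h2 : frame x₀ x = frame x₀ x • (1 : ℂ) := by simp
  have h3 := (congrArg (fun v : ℂ => mfderiv 𝓘(ℂ) 𝓘(ℂ) (extChartAt 𝓘(ℂ) x₀) x v) h2).trans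
    (map_smul (mfderiv 𝓘(ℂ) 𝓘(ℂ) (extChartAt 𝓘(ℂ) x₀) x) (frame x₀ x) (1 : ℂ))
  have h4 : (mfderiv 𝓘(ℂ) 𝓘(ℂ) (extChartAt 𝓘(ℂ) x₀) x (1 : ℂ) : ℂ) =
      speed (chartAt ℂ x₀) x := by
    simp only [mfld_simps]; rfl
  rw [mul_comm]
  exact (h3.trans (congrArg (fun t : ℂ => frame x₀ x * t) h4)).symm.trans h1

theorem frame_ne_zero {x₀ x : X} (hx : x ∈ (chartAt ℂ x₀).source) : frame x₀ x ≠ 0 := fun h => by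
  simpa [h] using speed_chartAt_mul_frame hx

theorem speed_eq_deriv_mul_frame {γ : ℂ → X} {x₀ : X} {z : ℂ}
    (hz : γ z ∈ (chartAt ℂ x₀).source) (hγ : MDifferentiableAt 𝓘(ℂ) 𝓘(ℂ) γ z) :
    speed γ z = deriv (chartAt ℂ x₀ ∘ γ) z * frame x₀ (γ z) := by
  rw [← speed_eq_deriv, speed_comp (mdifferentiableAt_chartAt hz) hγ, mul_assoc,
    speed_chartAt_mul_frame hz, mul_one]

/-- The coefficient of a differential in the preferred chart at `x₀`. -/
noncomputable def localCoeff {j : ℕ} (η : differentials X j) (x₀ : X) (z : ℂ) : ℂ :=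
  formEval η ((chartAt ℂ x₀).symm z) (frame x₀ ((chartAt ℂ x₀).symm z))

theorem localCoeff_apply {j : ℕ} (η : differentials X j) {x₀ x : X}
    (hx : x ∈ (chartAt ℂ x₀).source) :
    localCoeff η x₀ (chartAt ℂ x₀ x) = formEval η x (frame x₀ x) := by
  rw [localCoeff, (chartAt ℂ x₀).left_inv hx]

theorem localCoeff_apply_eq_zero_iff {j : ℕ} (η : differentials X j) {x₀ x : X}
    (hx : x ∈ (chartAt ℂ x₀).source) :
    localCoeff η x₀ (chartAt ℂ x₀ x) = 0 ↔ formEval η x 1 = 0 := by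
  rw [localCoeff_apply η hx, formEval_eq, mul_eq_zero, or_iff_right]
  exact pow_ne_zero _ (frame_ne_zero hx)

theorem contMDiffAt_formEval_frame {j : ℕ} (η : differentials X j) {x₀ x : X}
    (hx : x ∈ (chartAt ℂ x₀).source) :
    ContMDiffAt 𝓘(ℂ) 𝓘(ℂ) ω (fun x => formEval η x (frame x₀ x)) x := by
  have hb : x ∈ (trivializationAt ℂ (TangentSpace (M := X) 𝓘(ℂ)) x₀).baseSet := by
    rwa [TangentBundle.trivializationAt_baseSet]
  exact (η.2.1 _).comp x (contMDiffAt_coordField x₀ x hb)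

theorem analyticAt_localCoeff {j : ℕ} (η : differentials X j) {x₀ : X} {z : ℂ}
    (hz : z ∈ (chartAt ℂ x₀).target) : AnalyticAt ℂ (localCoeff η x₀) z := by
  have h1 := contMDiffAt_formEval_frame η ((chartAt ℂ x₀).map_target hz)
  have h2 : ContMDiffAt 𝓘(ℂ) 𝓘(ℂ) ω (chartAt ℂ x₀).symm z :=
    (contMDiffOn_chart_symm (I := 𝓘(ℂ)) (n := ω) (x := x₀)).contMDiffAt
      ((chartAt ℂ x₀).open_target.mem_nhds hz)
  exact (contMDiffAt_iff_contDiffAt.1 (h1.comp z h2)).analyticAt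

theorem eventually_formEval_eq_zero_or_ne {j : ℕ} (η : differentials X j) (x₀ : X) :
    (∀ᶠ x in 𝓝 x₀, formEval η x 1 = 0) ∨ ∀ᶠ x in 𝓝[≠] x₀, formEval η x 1 ≠ 0 := by
  have hA := analyticAt_localCoeff η (mem_chart_target ℂ x₀)
  rcases hA.eventually_eq_zero_or_eventually_ne_zero with h | h
  · left
    filter_upwards [(tendsto_chartAt x₀).eventually h, eventually_mem_chart_source x₀]
      with x h1 h2
    rwa [localCoeff_apply_eq_zero_iff η h2] at h1
  · right
    filter_upwards [(tendsto_chartAt_punctured x₀).eventually h,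
      nhdsWithin_le_nhds (eventually_mem_chart_source x₀)] with x h1 h2
    rwa [Ne, localCoeff_apply_eq_zero_iff η h2] at h1

/-- A Riemann surface has no isolated points, so a property holding on a punctured neighbourhood
holds somewhere. -/
instance neBot_nhdsNE (x₀ : X) : NeBot (𝓝[≠] x₀) := by
  have h : Tendsto (chartAt ℂ x₀).symm (𝓝[≠] (chartAt ℂ x₀ x₀)) (𝓝[≠] x₀) := by
    refine tendsto_nhdsWithin_iff.2 ⟨(tendsto_chartAt_symm x₀).mono_left nhdsWithin_le_nhds, ?_⟩
    filter_upwards [self_mem_nhdsWithin, nhdsWithin_le_nhds (chart_target_mem_nhds ℂ x₀)]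
      with z hz hzt hx
    refine hz ?_
    have hx : (chartAt ℂ x₀).symm z = x₀ := hx
    exact ((chartAt ℂ x₀).right_inv hzt).symm.trans (congrArg _ hx)
  exact h.neBot

/-- Identity theorem: a holomorphic differential that vanishes on a non-empty open set is zero. -/
theorem eq_zero_of_eventually_formEval_eq_zero [ConnectedSpace X] {j : ℕ} (η : differentials X j)
    {x₀ : X} (h : ∀ᶠ x in 𝓝 x₀, formEval η x 1 = 0) : η = 0 := by
  set U : Set X := {x | ∀ᶠ x' in 𝓝 x, formEval η x' 1 = 0}
  have hUo : IsOpen U := isOpen_setOfPred_eventually_nhds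
  have hUc : IsClosed U := by
    -- At a point outside U the zeros are isolated, so no nearby point has a neighbourhood of zeros.
    rw [← isOpen_compl_iff, isOpen_iff_mem_nhds]
    intro x hx
    rcases eventually_formEval_eq_zero_or_ne η x with h1 | h1
    · exact absurd h1 hx
    · refine nhds_le_of_punctured (Q := fun x => x ∈ Uᶜ) ?_ hx
      exact h1.mono fun x' h2 h3 => h2 h3.self_of_nhds
  have hU : U = univ := IsClopen.eq_univ ⟨hUc, hUo⟩ ⟨x₀, h⟩
  apply Subtype.ext
  funext v
  have h1 : v.proj ∈ U := hU ▸ mem_univ _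
  have h2 : formEval η v.proj v.snd = 0 :=
    (formEval_eq η v.proj v.snd).trans (by rw [h1.self_of_nhds, mul_zero])
  exact h2

theorem eventually_formEval_ne_zero [ConnectedSpace X] {j : ℕ} {η : differentials X j} (hη : η ≠ 0)
    (x₀ : X) : ∀ᶠ x in 𝓝[≠] x₀, formEval η x 1 ≠ 0 :=
  (eventually_formEval_eq_zero_or_ne η x₀).resolve_left fun h =>
    hη (eq_zero_of_eventually_formEval_eq_zero η h)

end Forms

/-! ### Coordinates on the total space of the canonical bundle. -/

section Canonical

variable {X : Type*} [TopologicalSpace X] [ChartedSpace ℂ X] [IsManifold 𝓘(ℂ) ω X]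

/-- The value of the covector `q` on the multiple `v` of the unit tangent vector of the preferred
chart. -/
noncomputable def taut (q : CanonicalBundle X) (v : ℂ) : ℂ := q.snd v

theorem taut_mul (q : CanonicalBundle X) (c v : ℂ) : taut q (c * v) = c * taut q v :=
  map_smul q.snd c v

theorem taut_eq (q : CanonicalBundle X) (v : ℂ) : taut q v = v * taut q 1 := by
  rw [← taut_mul, mul_one]

theorem ext_taut {q q' : CanonicalBundle X} (h1 : q.proj = q'.proj) (h2 : taut q 1 = taut q' 1) :
    q = q' := by
  obtain ⟨x, l⟩ := q
  obtain ⟨x', l'⟩ := q'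
  obtain rfl : x = x' := h1
  congr 1
  exact ContinuousLinearMap.ext_ring (R₁ := ℂ) (M₁ := ℂ) h2

theorem contMDiffAt_taut_frame {x₀ : X} {q : CanonicalBundle X}
    (hq : q.proj ∈ (chartAt ℂ x₀).source) :
    ContMDiffAt canonicalModel 𝓘(ℂ) ω
      (fun q : CanonicalBundle X => taut q (frame x₀ q.proj)) q := by
  have hproj : ContMDiffAt (canonicalModel) 𝓘(ℂ) ω
      (fun q : CanonicalBundle X => q.proj) q :=
    Bundle.contMDiffAt_proj _
  have hb : q.proj ∈ (trivializationAt ℂ (TangentSpace (M := X) 𝓘(ℂ)) x₀).baseSet := by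
    rwa [TangentBundle.trivializationAt_baseSet]
  have hfield : ContMDiffAt (canonicalModel) (𝓘(ℂ).prod 𝓘(ℂ)) ω
      (fun q : CanonicalBundle X => (⟨q.proj, coordField x₀ q.proj⟩ : TangentBundle 𝓘(ℂ) X)) q :=
    (contMDiffAt_coordField x₀ q.proj hb).comp q hproj
  have h := ContMDiffAt.clm_bundle_apply (F₁ := ℂ) (F₂ := ℂ) (IB := 𝓘(ℂ))
    (E₁ := fun x : X => TangentSpace 𝓘(ℂ) x) (E₂ := Bundle.Trivial X ℂ)
    (b := fun q : CanonicalBundle X => q.proj) (ϕ := fun q => q.snd)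
    (v := fun q => coordField x₀ q.proj) (x := q) (IM := canonicalModel) (n := ω)
    contMDiffAt_id hfield
  rw [Bundle.contMDiffAt_totalSpace] at h
  exact h.2

theorem contMDiffAt_proj_canonical (q : CanonicalBundle X) :
    ContMDiffAt canonicalModel 𝓘(ℂ) ω (fun q : CanonicalBundle X => q.proj) q :=
  Bundle.contMDiffAt_proj _

/-- The trivialisation of the cotangent bundle reads a covector through its value on ∂/∂z. The
coordinates on K are therefore x and y = λ(∂/∂z). -/
theorem trivializationAt_canonical_apply (x₀ : X) (q : CanonicalBundle X) :
    (trivializationAt (ℂ →L[ℂ] ℂ)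
      (fun x : X => TangentSpace 𝓘(ℂ) x →L[ℂ] Bundle.Trivial X ℂ x) x₀ q) =
      (q.proj, ContinuousLinearMap.toSpanSingleton ℂ (taut q (frame x₀ q.proj))) := by
  rw [hom_trivializationAt_apply]
  refine Prod.ext rfl ?_
  refine ContinuousLinearMap.ext_ring ?_
  simp only [ContinuousLinearMap.inCoordinates]
  simp
  rfl

theorem extChartAt_canonical_apply (q₀ q : CanonicalBundle X) :
    extChartAt canonicalModel q₀ q = (chartAt ℂ q₀.proj q.proj,
      ContinuousLinearMap.toSpanSingleton ℂ (taut q (frame q₀.proj q.proj))) := by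
  rw [FiberBundle.extChartAt]
  simp only [mfld_simps, trivializationAt_canonical_apply]

end Canonical

/-! ### The spectral curve inside the canonical bundle. -/

section Curve

variable {X : Type*} [TopologicalSpace X] [ChartedSpace ℂ X] [IsManifold 𝓘(ℂ) ω X]
variable {n : ℕ} {a : HitchinBase X n} {ha : IsNonsingular a}

/-- The projection of the spectral curve to the base. -/
noncomputable def SpectralCurve.proj (p : SpectralCurve a ha) : X := (SpectralCurve.incl a ha p).proj

theorem continuous_incl : Continuous (SpectralCurve.incl a ha) := continuous_subtype_val

theorem incl_injective : Function.Injective (SpectralCurve.incl a ha) :=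
  Subtype.val_injective (p := (· ∈ spectralSet a))

theorem isInducing_incl : Topology.IsInducing (SpectralCurve.incl a ha) :=
  Topology.IsEmbedding.subtypeVal.isInducing

theorem incl_mem (p : SpectralCurve a ha) : SpectralCurve.incl a ha p ∈ spectralSet a :=
  Subtype.prop (p := (· ∈ spectralSet a)) p

theorem chartAt_mem_spectralAtlas (p : SpectralCurve a ha) :
    chartAt ℂ p ∈ spectralAtlas a ha := chart_mem_atlas ℂ p

theorem contMDiff_incl : ContMDiff 𝓘(ℂ) canonicalModel ω (SpectralCurve.incl a ha) := by
  intro p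
  have h1 := (chartAt_mem_spectralAtlas p).1 _ (mem_chart_target ℂ p)
  have h2 : ContMDiffAt 𝓘(ℂ) 𝓘(ℂ) ω (chartAt ℂ p) p :=
    (contMDiffOn_chart (I := 𝓘(ℂ)) (n := ω) (x := p)).contMDiffAt (chart_source_mem_nhds ℂ p)
  exact (h1.comp p h2).congr_of_eventuallyEq
    (eventuallyEq_comp_chartAt (SpectralCurve.incl a ha) (mem_chart_source ℂ p))

/-- Charts of the curve are locally restrictions of holomorphic functions on K, so holomorphy of a
map into the curve can be tested in K. -/
theorem contMDiffAt_of_incl_comp {E : Type*} [NormedAddCommGroup E] [NormedSpace ℂ E]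
    {H : Type*} [TopologicalSpace H] {I : ModelWithCorners ℂ E H}
    {M : Type*} [TopologicalSpace M] [ChartedSpace H M] {g : M → SpectralCurve a ha} {m : M}
    (hg : ContMDiffAt I canonicalModel ω (fun t => SpectralCurve.incl a ha (g t)) m) :
    ContMDiffAt I 𝓘(ℂ) ω g m := by
  have hc : ContinuousAt g m := (isInducing_incl.continuousAt_iff).2 hg.continuousAt
  obtain ⟨G, hG, hGe⟩ := (chartAt_mem_spectralAtlas (g m)).2 _ (mem_chart_source ℂ (g m))
  rw [contMDiffAt_iff_target]
  refine ⟨hc, ?_⟩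
  refine (ContMDiffAt.comp m hG hg).congr_of_eventuallyEq ?_
  filter_upwards [hc.eventually hGe] with t ht
  simpa using ht

theorem contMDiff_proj : ContMDiff 𝓘(ℂ) 𝓘(ℂ) ω (SpectralCurve.proj (a := a) (ha := ha)) :=
  fun p => (contMDiffAt_proj_canonical _).comp p (contMDiff_incl p)

theorem continuous_proj : Continuous (SpectralCurve.proj (a := a) (ha := ha)) :=
  contMDiff_proj.continuous

theorem mdifferentiableAt_proj (p : SpectralCurve a ha) :
    MDifferentiableAt 𝓘(ℂ) 𝓘(ℂ) (SpectralCurve.proj (a := a) (ha := ha)) p :=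
  (contMDiff_proj p).mdifferentiableAt (by simp)

theorem spectralSection_eq (q : CanonicalBundle X) (v : ℂ) :
    spectralSection a q v = taut q v ^ n +
      ∑ j : Finset.Icc 2 n, formEval (a j) q.proj v * taut q v ^ (n - (j : ℕ)) := rfl

theorem spectral_equation (p : SpectralCurve a ha) (v : ℂ) :
    taut (SpectralCurve.incl a ha p) v ^ n + ∑ j : Finset.Icc 2 n,
      formEval (a j) (SpectralCurve.proj p) v *
        taut (SpectralCurve.incl a ha p) v ^ (n - (j : ℕ)) = 0 :=
  incl_mem p v

/-- The derivative `∂s/∂λ` of the spectral section in the direction of the fibres. -/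
noncomputable def fibreDeriv (a : HitchinBase X n) (q : CanonicalBundle X) (v : ℂ) : ℂ :=
  n * taut q v ^ (n - 1) + ∑ j : Finset.Icc 2 n,
    formEval (a j) q.proj v * (((n - j : ℕ) : ℂ) * taut q v ^ (n - (j : ℕ) - 1))

theorem fibreDeriv_mul (q : CanonicalBundle X) (c v : ℂ) :
    fibreDeriv a q (c * v) = c ^ (n - 1) * fibreDeriv a q v := by
  unfold fibreDeriv
  rw [mul_add, Finset.mul_sum, taut_mul, mul_pow]
  congr 1
  · ring
  refine Finset.sum_congr rfl fun j _ => ?_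
  rw [formEval_mul, mul_pow]
  have hj := Finset.mem_Icc.1 j.2
  -- For j = n the factor n - j vanishes, so the truncated exponent n - j - 1 plays no role.
  rcases eq_or_ne (n - (j : ℕ)) 0 with h | h
  · simp [h]
  · have : c ^ (n - 1) = c ^ (j : ℕ) * c ^ (n - (j : ℕ) - 1) := by
      rw [← pow_add]
      congr 1
      omega
    rw [this]
    ring

/-! ### Local coordinates on the spectral curve -/

/-- The coordinate of the base, read in the preferred chart of the spectral curve at `p₀`. -/
noncomputable def localX (p₀ : SpectralCurve a ha) : ℂ → ℂ :=
  chartAt ℂ (SpectralCurve.proj p₀) ∘ SpectralCurve.proj ∘ (chartAt ℂ p₀).symm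

/-- The fibre coordinate, read in the preferred chart of the spectral curve at `p₀`. -/
noncomputable def localY (p₀ : SpectralCurve a ha) : ℂ → ℂ :=
  (fun p => taut (SpectralCurve.incl a ha p)
    (frame (SpectralCurve.proj p₀) (SpectralCurve.proj p))) ∘ (chartAt ℂ p₀).symm

theorem localX_apply {p₀ p : SpectralCurve a ha} (hp : p ∈ (chartAt ℂ p₀).source) :
    localX p₀ (chartAt ℂ p₀ p) = chartAt ℂ (SpectralCurve.proj p₀) (SpectralCurve.proj p) := by
  simp [localX, (chartAt ℂ p₀).left_inv hp]

theorem localY_apply {p₀ p : SpectralCurve a ha} (hp : p ∈ (chartAt ℂ p₀).source) :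
    localY p₀ (chartAt ℂ p₀ p) = taut (SpectralCurve.incl a ha p)
      (frame (SpectralCurve.proj p₀) (SpectralCurve.proj p)) := by
  simp [localY, (chartAt ℂ p₀).left_inv hp]

theorem eventually_proj_mem_source (p₀ : SpectralCurve a ha) :
    ∀ᶠ p in 𝓝 p₀, SpectralCurve.proj p ∈ (chartAt ℂ (SpectralCurve.proj p₀)).source :=
  continuous_proj.continuousAt.eventually (eventually_mem_chart_source _)

theorem analyticAt_localX (p₀ : SpectralCurve a ha) :
    AnalyticAt ℂ (localX p₀) (chartAt ℂ p₀ p₀) := by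
  refine analyticAt_comp_chartAt_symm
    (g := chartAt ℂ (SpectralCurve.proj p₀) ∘ SpectralCurve.proj) ?_
  filter_upwards [eventually_proj_mem_source p₀] with p hp
  exact (mdifferentiableAt_chartAt hp).comp p (mdifferentiableAt_proj p)

theorem mdifferentiableAt_taut_frame {x₀ : X} {p : SpectralCurve a ha}
    (hp : SpectralCurve.proj p ∈ (chartAt ℂ x₀).source) :
    MDifferentiableAt 𝓘(ℂ) 𝓘(ℂ) (fun p => taut (SpectralCurve.incl a ha p)
      (frame x₀ (SpectralCurve.proj p))) p :=
  ((contMDiffAt_taut_frame hp).comp p (contMDiff_incl p)).mdifferentiableAt (by simp)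

theorem analyticAt_localY (p₀ : SpectralCurve a ha) :
    AnalyticAt ℂ (localY p₀) (chartAt ℂ p₀ p₀) := by
  refine analyticAt_comp_chartAt_symm ?_
  filter_upwards [eventually_proj_mem_source p₀] with p hp
  exact mdifferentiableAt_taut_frame hp

/-- The spectral equation in the preferred chart of the base at `x₀`. -/
noncomputable def localPoly (a : HitchinBase X n) (x₀ : X) (x y : ℂ) : ℂ :=
  y ^ n + ∑ j : Finset.Icc 2 n, localCoeff (a j) x₀ x * y ^ (n - (j : ℕ))

/-- The partial derivative of the local spectral equation along the base. -/
noncomputable def localPolyX (a : HitchinBase X n) (x₀ : X) (x y : ℂ) : ℂ :=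
  ∑ j : Finset.Icc 2 n, deriv (localCoeff (a j) x₀) x * y ^ (n - (j : ℕ))

/-- The partial derivative of the local spectral equation along the fibres. -/
noncomputable def localPolyY (a : HitchinBase X n) (x₀ : X) (x y : ℂ) : ℂ :=
  n * y ^ (n - 1) + ∑ j : Finset.Icc 2 n,
    localCoeff (a j) x₀ x * (((n - j : ℕ) : ℂ) * y ^ (n - (j : ℕ) - 1))

theorem hasFDerivAt_localPoly (a : HitchinBase X n) {x₀ : X} {x : ℂ}
    (hx : x ∈ (chartAt ℂ x₀).target) (y : ℂ) :
    HasFDerivAt (fun t : ℂ × ℂ => localPoly a x₀ t.1 t.2)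
      (localPolyX a x₀ x y • ContinuousLinearMap.fst ℂ ℂ ℂ +
        localPolyY a x₀ x y • ContinuousLinearMap.snd ℂ ℂ ℂ) (x, y) := by
  have hpow : ∀ m : ℕ, HasFDerivAt (fun t : ℂ × ℂ => t.2 ^ m)
      (((m : ℂ) * y ^ (m - 1)) • ContinuousLinearMap.snd ℂ ℂ ℂ) (x, y) := fun m =>
    (hasDerivAt_pow m y).comp_hasFDerivAt (x, y) hasFDerivAt_snd
  have hco : ∀ j : Finset.Icc 2 n, HasFDerivAt (fun t : ℂ × ℂ => localCoeff (a j) x₀ t.1)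
      (deriv (localCoeff (a j) x₀) x • ContinuousLinearMap.fst ℂ ℂ ℂ) (x, y) := fun j =>
    HasDerivAt.comp_hasFDerivAt (h₂ := localCoeff (a j) x₀) (f := Prod.fst) (x, y)
      (analyticAt_localCoeff (a j) hx).differentiableAt.hasDerivAt hasFDerivAt_fst
  have h := (hpow n).add (HasFDerivAt.fun_sum (u := Finset.univ) fun j _ =>
    (hco j).mul (hpow (n - (j : ℕ))))
  refine h.congr_fderiv ?_
  refine ContinuousLinearMap.ext fun v => ?_
  simp only [localPolyX, localPolyY, add_apply, smul_apply, sum_apply, ContinuousLinearMap.coe_fst', ContinuousLinearMap.coe_snd',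
    smul_eq_mul, Finset.sum_mul, Finset.sum_add_distrib, add_mul]
  rw [← add_assoc, add_comm]
  congr 1
  · refine Finset.sum_congr rfl fun j _ => by ring
  · congr 1
    refine Finset.sum_congr rfl fun j _ => by ring

theorem localX_mem_target (p₀ : SpectralCurve a ha) :
    ∀ᶠ z in 𝓝 (chartAt ℂ p₀ p₀), localX p₀ z ∈ (chartAt ℂ (SpectralCurve.proj p₀)).target := by
  filter_upwards [(tendsto_chartAt_symm p₀).eventually (eventually_proj_mem_source p₀)] with z hz
  exact (chartAt ℂ (SpectralCurve.proj p₀)).map_source hz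

theorem eventually_localPoly_eq_zero (p₀ : SpectralCurve a ha) :
    ∀ᶠ z in 𝓝 (chartAt ℂ p₀ p₀),
      localPoly a (SpectralCurve.proj p₀) (localX p₀ z) (localY p₀ z) = 0 := by
  filter_upwards [(tendsto_chartAt_symm p₀).eventually (eventually_proj_mem_source p₀)] with z hz
  have h := spectral_equation ((chartAt ℂ p₀).symm z)
    (frame (SpectralCurve.proj p₀) (SpectralCurve.proj ((chartAt ℂ p₀).symm z)))
  rw [← h]
  unfold localPoly
  congr 1
  refine Finset.sum_congr rfl fun j _ => ?_
  congr 1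
  exact localCoeff_apply _ hz

/-- Differentiation of P(x(z), y(z)) = 0 along the curve. -/
theorem eventually_localPoly_deriv (p₀ : SpectralCurve a ha) :
    ∀ᶠ z in 𝓝 (chartAt ℂ p₀ p₀),
      localPolyX a (SpectralCurve.proj p₀) (localX p₀ z) (localY p₀ z) * deriv (localX p₀) z +
      localPolyY a (SpectralCurve.proj p₀) (localX p₀ z) (localY p₀ z) * deriv (localY p₀) z
        = 0 := by
  filter_upwards [(eventually_localPoly_eq_zero p₀).eventually_nhds, localX_mem_target p₀,
    (analyticAt_localX p₀).eventually_analyticAt, (analyticAt_localY p₀).eventually_analyticAt]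
    with z h1 h2 h3 h4
  have h5 := (hasFDerivAt_localPoly a h2 (localY p₀ z)).comp_hasDerivAt z
    (h3.differentiableAt.hasDerivAt.prodMk h4.differentiableAt.hasDerivAt)
  have h6 : ((fun t : ℂ × ℂ => localPoly a (SpectralCurve.proj p₀) t.1 t.2) ∘
      fun z => (localX p₀ z, localY p₀ z)) =ᶠ[𝓝 z] fun _ => 0 := h1
  have h7 := h5.deriv
  rw [h6.deriv_eq, deriv_const] at h7
  simpa using h7.symm

/-- Nonsingularity in the coordinates (x, y): the local equation of the curve is P composed with
these coordinates, so if both partial derivatives vanished, so would its differential. -/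
theorem localPoly_partial_ne_zero (p₀ : SpectralCurve a ha) :
    ¬ (localPolyX a (SpectralCurve.proj p₀) (localX p₀ (chartAt ℂ p₀ p₀))
        (localY p₀ (chartAt ℂ p₀ p₀)) = 0 ∧
      localPolyY a (SpectralCurve.proj p₀) (localX p₀ (chartAt ℂ p₀ p₀))
        (localY p₀ (chartAt ℂ p₀ p₀)) = 0) := by
  rintro ⟨h1, h2⟩
  set q := SpectralCurve.incl a ha p₀ with hq
  refine ha q (incl_mem p₀) ?_
  set x₀ := SpectralCurve.proj p₀ with hx₀
  have hqx : q.proj ∈ (chartAt ℂ x₀).source := mem_chart_source ℂ x₀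
  have hc : ContMDiffAt canonicalModel 𝓘(ℂ, ℂ × ℂ) ω
      (fun q : CanonicalBundle X => (chartAt ℂ x₀ q.proj, taut q (frame x₀ q.proj))) q := by
    refine ContMDiffAt.prodMk_space ?_ (contMDiffAt_taut_frame hqx)
    exact ContMDiffAt.comp (I' := 𝓘(ℂ)) q ((contMDiffOn_chart (I := 𝓘(ℂ)) (n := ω)
      (x := x₀)).contMDiffAt ((chartAt ℂ x₀).open_source.mem_nhds hqx))
      (contMDiffAt_proj_canonical q)
  have hP := hasFDerivAt_localPoly a ((chartAt ℂ x₀).map_source hqx) (taut q (frame x₀ q.proj))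
  rw [localX_apply (mem_chart_source ℂ p₀), localY_apply (mem_chart_source ℂ p₀)] at h1 h2
  have hP0 : HasFDerivAt (fun t : ℂ × ℂ => localPoly a x₀ t.1 t.2) (0 : ℂ × ℂ →L[ℂ] ℂ)
      (chartAt ℂ x₀ q.proj, taut q (frame x₀ q.proj)) := by
    refine hP.congr_fderiv ?_
    have h1' : localPolyX a x₀ (chartAt ℂ x₀ q.proj) (taut q (frame x₀ q.proj)) = 0 := h1
    have h2' : localPolyY a x₀ (chartAt ℂ x₀ q.proj) (taut q (frame x₀ q.proj)) = 0 := h2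
    rw [h1', h2']
    refine ContinuousLinearMap.ext fun v => ?_
    simp
  have hEq : localEquation a q.proj =ᶠ[𝓝 q] (fun t : ℂ × ℂ => localPoly a x₀ t.1 t.2) ∘
      fun q : CanonicalBundle X => (chartAt ℂ x₀ q.proj, taut q (frame x₀ q.proj)) := by
    filter_upwards [(contMDiffAt_proj_canonical q).continuousAt.eventually
      ((chartAt ℂ x₀).open_source.mem_nhds hqx)] with r hr
    change spectralSection a r (frame x₀ r.proj) = _
    rw [spectralSection_eq]
    simp only [Function.comp_apply, localPoly]
    congr 1
    refine Finset.sum_congr rfl fun j _ => ?_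
    rw [localCoeff_apply _ hr]
  rw [hEq.mfderiv_eq, mfderiv_comp q hP0.differentiableAt.mdifferentiableAt
    (hc.mdifferentiableAt (by simp)), mfderiv_eq_fderiv, hP0.fderiv]
  rfl

/-- The curve is immersed: its chart is the restriction of a holomorphic G on K, so z = G(x(z),
y(z)), and differentiating would give 1 = 0 if x' = y' = 0. -/
theorem deriv_localX_localY_ne_zero (p₀ : SpectralCurve a ha) :
    ¬ (deriv (localX p₀) (chartAt ℂ p₀ p₀) = 0 ∧ deriv (localY p₀) (chartAt ℂ p₀ p₀) = 0) := by
  rintro ⟨h1, h2⟩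
  set q := SpectralCurve.incl a ha p₀ with hq
  obtain ⟨G, hG, hGe⟩ := (chartAt_mem_spectralAtlas p₀).2 _ (mem_chart_source ℂ p₀)
  set ψ := extChartAt canonicalModel q with hψ
  have hH : DifferentiableAt ℂ (G ∘ ψ.symm) (ψ q) := by
    rw [← mdifferentiableAt_iff_differentiableAt]
    have h3 : ContMDiffAt 𝓘(ℂ, ℂ × (ℂ →L[ℂ] ℂ)) canonicalModel ω ψ.symm (ψ q) :=
      (contMDiffOn_extChartAt_symm q).contMDiffAt (extChartAt_target_mem_nhds q)
    have h4 : ContMDiffAt canonicalModel 𝓘(ℂ) ω G (ψ.symm (ψ q)) := by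
      rwa [extChartAt_to_inv]
    exact (h4.comp (ψ q) h3).mdifferentiableAt (by simp)
  set z₀ := chartAt ℂ p₀ p₀ with hz₀
  set c : ℂ → ℂ × (ℂ →L[ℂ] ℂ) := fun z => (localX p₀ z,
    (ContinuousLinearMap.toSpanSingletonCLE (𝕜 := ℂ) (E := ℂ) (localY p₀ z))) with hc
  have hψc : ∀ z, ψ (SpectralCurve.incl a ha ((chartAt ℂ p₀).symm z)) = c z := fun z =>
    extChartAt_canonical_apply _ _
  have hcd : HasDerivAt c 0 z₀ := by
    have hX := (analyticAt_localX p₀).differentiableAt.hasDerivAt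
    have hY := (analyticAt_localY p₀).differentiableAt.hasDerivAt
    rw [h1] at hX
    rw [h2] at hY
    have := hX.prodMk ((ContinuousLinearMap.toSpanSingletonCLE (𝕜 := ℂ)
      (E := ℂ)).hasFDerivAt.comp_hasDerivAt z₀ hY)
    exact this.congr_deriv (by simp)
  have hc0 : c z₀ = ψ q := by
    rw [← hψc, (chartAt ℂ p₀).left_inv (mem_chart_source ℂ p₀)]
  rw [← hc0] at hH
  have hid : (G ∘ ψ.symm) ∘ c =ᶠ[𝓝 z₀] id := by
    have hsrc : ∀ᶠ p in 𝓝 p₀, SpectralCurve.incl a ha p ∈ ψ.source :=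
      continuous_incl.continuousAt.eventually (extChartAt_source_mem_nhds q)
    filter_upwards [(tendsto_chartAt_symm p₀).eventually (hGe.and hsrc),
      chart_target_mem_nhds ℂ p₀] with z hz hzt
    rw [(chartAt ℂ p₀).right_inv hzt] at hz
    simp only [Function.comp_apply, ← hψc, id_eq]
    rw [ψ.left_inv hz.2, ← hz.1]
  have := (hH.hasFDerivAt.comp_hasDerivAt z₀ hcd).deriv
  rw [hid.deriv_eq] at this
  simp at this

end Curve

/-! ### Separation, compactness and discrete ramification of the spectral curve. -/

section Curve

variable {X : Type*} [TopologicalSpace X] [ChartedSpace ℂ X] [IsManifold 𝓘(ℂ) ω X]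
variable {n : ℕ} {a : HitchinBase X n} {ha : IsNonsingular a}

instance spectralCurve_t2Space [T2Space X] : T2Space (SpectralCurve a ha) := by
  rw [t2Space_iff_disjoint_nhds]
  intro p q hpq
  by_cases h : SpectralCurve.proj p = SpectralCurve.proj q
  · have hp : SpectralCurve.proj p ∈ (chartAt ℂ (SpectralCurve.proj p)).source :=
      mem_chart_source _ _
    have hq : SpectralCurve.proj q ∈ (chartAt ℂ (SpectralCurve.proj p)).source := h ▸ hp
    refine Tendsto.disjoint (mdifferentiableAt_taut_frame hp).continuousAt.tendsto
      (disjoint_nhds_nhds.2 ?_) (mdifferentiableAt_taut_frame hq).continuousAt.tendsto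
    intro h'
    refine hpq (incl_injective (ext_taut h ?_))
    rw [taut_eq, taut_eq (SpectralCurve.incl a ha q), ← h] at h'
    exact mul_left_cancel₀ (frame_ne_zero hp) h'
  · exact Tendsto.disjoint continuous_proj.continuousAt.tendsto (disjoint_nhds_nhds.2 h)
      continuous_proj.continuousAt.tendsto

/-- If |y| > 1, every lower term is at most B|y|^(n-1), so |y|^n ≤ card·B·|y|^(n-1). This bound
makes the projection of the curve proper. -/
theorem norm_le_of_monic_root {b : Finset.Icc 2 n → ℂ} {B : ℝ} (hb : ∀ j, ‖b j‖ ≤ B) (hB : 0 ≤ B)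
    {y : ℂ} (hy : y ^ n + ∑ j : Finset.Icc 2 n, b j * y ^ (n - (j : ℕ)) = 0) :
    ‖y‖ ≤ max 1 ((Fintype.card (Finset.Icc 2 n)) * B) := by
  by_contra! hlt
  obtain ⟨h1, h2⟩ := max_lt_iff.1 hlt
  -- For n = 0 the equation reads 1 = 0.
  rcases Nat.eq_zero_or_pos n with rfl | hn
  · have : IsEmpty (Finset.Icc 2 0) := ⟨fun j => by simpa using j.2⟩
    rw [Finset.univ_eq_empty, Finset.sum_empty] at hy
    simp at hy
  have h3 : y ^ n = - ∑ j : Finset.Icc 2 n, b j * y ^ (n - (j : ℕ)) := eq_neg_of_add_eq_zero_left hy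
  have h4 : ‖y‖ ^ n ≤ Fintype.card (Finset.Icc 2 n) * B * ‖y‖ ^ (n - 1) := by
    rw [← norm_pow, h3, norm_neg]
    refine (norm_sum_le _ _).trans ?_
    have : ∀ j ∈ Finset.univ, ‖b j * y ^ (n - (j : ℕ))‖ ≤ B * ‖y‖ ^ (n - 1) := by
      intro j _
      rw [norm_mul, norm_pow]
      have hj := (Finset.mem_Icc.1 j.2).1
      exact mul_le_mul (hb j) (pow_le_pow_right₀ h1.le (by omega)) (by positivity) hB
    refine (Finset.sum_le_card_nsmul _ _ _ this).trans ?_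
    rw [nsmul_eq_mul, mul_assoc, Finset.card_univ]
  have h5 : ‖y‖ ^ n = ‖y‖ * ‖y‖ ^ (n - 1) := by
    rw [← pow_succ', Nat.sub_add_cancel hn]
  rw [h5] at h4
  have h6 : 0 < ‖y‖ ^ (n - 1) := by positivity
  exact absurd (le_of_mul_le_mul_right h4 h6) (not_le.2 h2)

/-- Over a compact subset N of a chart domain the roots are bounded, so the trivialisation
identifies the preimage with a closed subset of the product of N with a closed ball. -/
theorem isCompact_preimage_proj [T2Space X] {x₀ : X} {N : Set X} (hN : IsCompact N)
    (hNs : N ⊆ (chartAt ℂ x₀).source) :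
    IsCompact (SpectralCurve.proj (a := a) (ha := ha) ⁻¹' N) := by
  have hb : ∀ j : Finset.Icc 2 n, ContinuousOn (fun x => formEval (a j) x (frame x₀ x)) N :=
    fun j x hx => (contMDiffAt_formEval_frame (a j) (hNs hx)).continuousAt.continuousWithinAt
  obtain ⟨B, hB0, hB⟩ : ∃ B : ℝ, 0 ≤ B ∧
      ∀ j, ∀ x ∈ N, ‖formEval (a j) x (frame x₀ x)‖ ≤ B := by
    choose C hC using fun j => hN.exists_bound_of_continuousOn (hb j)
    refine ⟨∑ j, |C j|, Finset.sum_nonneg fun j _ => abs_nonneg _, fun j x hx => ?_⟩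
    exact ((hC j x hx).trans (le_abs_self _)).trans
      (Finset.single_le_sum (f := fun j => |C j|) (fun j _ => abs_nonneg _) (Finset.mem_univ j))
  set R : ℝ := max 1 ((Fintype.card (Finset.Icc 2 n)) * B)
  set T := trivializationAt (ℂ →L[ℂ] ℂ)
      (fun x : X => TangentSpace 𝓘(ℂ) x →L[ℂ] Bundle.Trivial X ℂ x) x₀
  have hTb : N ⊆ T.baseSet := by
    intro x hx
    rw [hom_trivializationAt_baseSet, TangentBundle.trivializationAt_baseSet]
    exact ⟨hNs hx, by simp⟩
  have hproper : ProperSpace (ℂ →L[ℂ] ℂ) := FiniteDimensional.proper ℂ _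
  set P : X × (ℂ →L[ℂ] ℂ) → ℂ := fun t => t.2 1 ^ n + ∑ j : Finset.Icc 2 n,
    formEval (a j) t.1 (frame x₀ t.1) * t.2 1 ^ (n - (j : ℕ))
  set K₀ : Set (X × (ℂ →L[ℂ] ℂ)) := N ×ˢ Metric.closedBall 0 R
  have hK₀ : IsCompact K₀ := hN.prod (isCompact_closedBall _ _)
  have hP : ContinuousOn P K₀ := by
    have h1 : Continuous fun t : X × (ℂ →L[ℂ] ℂ) => t.2 1 := by fun_prop
    refine (h1.pow n).continuousOn.add (continuousOn_finsetSum _ fun j _ => ?_)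
    exact ((hb j).comp continuousOn_fst fun t ht => ht.1).mul (h1.pow _).continuousOn
  have hC : IsCompact (K₀ ∩ P ⁻¹' {0}) :=
    hK₀.of_isClosed_subset (hP.preimage_isClosed_of_isClosed hK₀.isClosed isClosed_singleton)
      inter_subset_left
  have himg : SpectralCurve.incl a ha '' (SpectralCurve.proj ⁻¹' N) =
      T.toOpenPartialHomeomorph.symm '' (K₀ ∩ P ⁻¹' {0}) := by
    apply Subset.antisymm
    · rintro _ ⟨p, hp, rfl⟩
      have hp' : (SpectralCurve.incl a ha p).proj ∈ T.baseSet := hTb hp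
      have hT := trivializationAt_canonical_apply x₀ (SpectralCurve.incl a ha p)
      refine ⟨T (SpectralCurve.incl a ha p), ⟨?_, ?_⟩, ?_⟩
      · rw [hT]
        refine ⟨hp, ?_⟩
        rw [mem_closedBall_zero_iff, ContinuousLinearMap.norm_toSpanSingleton]
        exact norm_le_of_monic_root (fun j => hB j _ hp) hB0 (spectral_equation p _)
      · rw [hT, mem_preimage, mem_singleton_iff]
        simp only [P, ContinuousLinearMap.toSpanSingleton_apply, one_smul]
        exact spectral_equation p (frame x₀ (SpectralCurve.proj p))
      · exact T.toOpenPartialHomeomorph.left_inv (T.mem_source.2 hp')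
    · rintro _ ⟨⟨x, l⟩, ⟨hx, hPx⟩, rfl⟩
      have hxT : (x, l) ∈ T.target := T.mem_target.2 (hTb hx.1)
      set q := T.toOpenPartialHomeomorph.symm (x, l) with hq
      have hTq : T q = (x, l) := T.toOpenPartialHomeomorph.right_inv hxT
      have hT := trivializationAt_canonical_apply x₀ q
      rw [hTq] at hT
      have hqx : q.proj = x := (congrArg Prod.fst hT).symm
      have hql : l 1 = taut q (frame x₀ q.proj) := by
        have := congrArg (fun t : X × (ℂ →L[ℂ] ℂ) => t.2 1) hT
        simpa using this
      have hqS : q ∈ spectralSet a := by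
        rw [mem_spectralSet_iff a x₀ q (by
          rw [TangentBundle.trivializationAt_baseSet, hqx]; exact hNs hx.1)]
        change spectralSection a q (frame x₀ q.proj) = 0
        rw [spectralSection_eq, ← hql, hqx]
        exact hPx
      refine ⟨⟨q, hqS⟩, ?_, rfl⟩
      change q.proj ∈ N
      rw [hqx]
      exact hx.1
  rw [isInducing_incl.isCompact_iff, himg]
  refine hC.image_of_continuousOn (T.toOpenPartialHomeomorph.continuousOn_symm.mono ?_)
  rintro ⟨x, l⟩ hx
  exact T.mem_target.2 (hTb hx.1.1)

instance spectralCurve_compactSpace [T2Space X] [CompactSpace X] :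
    CompactSpace (SpectralCurve a ha) := by
  have h : ∀ x₀ : X, ∃ N ∈ 𝓝 x₀, N ⊆ (chartAt ℂ x₀).source ∧ IsCompact N := fun x₀ =>
    local_compact_nhds (chart_source_mem_nhds ℂ x₀)
  choose N hN hNs hNc using h
  obtain ⟨t, -, ht⟩ := isCompact_univ.elim_nhds_subcover N fun x _ => hN x
  refine ⟨(t.isCompact_biUnion fun x _ =>
    isCompact_preimage_proj (a := a) (ha := ha) (hNc x) (hNs x)).of_isClosed_subset
    isClosed_univ fun p _ => ?_⟩
  obtain ⟨x, hx, hpx⟩ := mem_iUnion₂.1 (ht (mem_univ (SpectralCurve.proj p)))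
  exact mem_iUnion₂.2 ⟨x, hx, hpx⟩

/-! ### Discreteness of the ramification points -/

theorem analyticAt_localPolyY_comp (p₀ : SpectralCurve a ha) : AnalyticAt ℂ
    (fun z => localPolyY a (SpectralCurve.proj p₀) (localX p₀ z) (localY p₀ z))
    (chartAt ℂ p₀ p₀) := by
  have hX := analyticAt_localX p₀
  have hY := analyticAt_localY p₀
  unfold localPolyY
  refine (analyticAt_const.mul (hY.pow _)).add (Finset.analyticAt_fun_sum _ fun j _ => ?_)
  exact ((analyticAt_localCoeff (a j) (localX_mem_target p₀).self_of_nhds).comp hX).mul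
    (analyticAt_const.mul (hY.pow _))

theorem analyticAt_localPolyX_comp (p₀ : SpectralCurve a ha) : AnalyticAt ℂ
    (fun z => localPolyX a (SpectralCurve.proj p₀) (localX p₀ z) (localY p₀ z))
    (chartAt ℂ p₀ p₀) := by
  have hX := analyticAt_localX p₀
  have hY := analyticAt_localY p₀
  unfold localPolyX
  refine Finset.analyticAt_fun_sum _ fun j _ => ?_
  exact ((analyticAt_localCoeff (a j) (localX_mem_target p₀).self_of_nhds).deriv.comp hX).mul
    (hY.pow _)

/-- In y this is a monic polynomial of degree n, so its zeros are finite in number. -/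
theorem not_eventually_localPoly_eq_zero (a : HitchinBase X n) (x₀ : X) (x y₀ : ℂ) :
    ¬ ∀ᶠ y in 𝓝 y₀, localPoly a x₀ x y = 0 := by
  intro h
  set p : Polynomial ℂ := Polynomial.X ^ n + ∑ j : Finset.Icc 2 n,
    Polynomial.C (localCoeff (a j) x₀ x) * Polynomial.X ^ (n - (j : ℕ)) with hp
  have heval : ∀ y, p.eval y = localPoly a x₀ x y := by
    intro y
    simp [hp, localPoly, Polynomial.eval_finsetSum]
  have h0 : p = 0 := by
    refine Polynomial.eq_zero_of_infinite_isRoot p ?_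
    refine (infinite_of_mem_nhds y₀ h).mono fun y hy => ?_
    have hy : localPoly a x₀ x y = 0 := hy
    rw [mem_ofPred_eq, Polynomial.IsRoot, heval, hy]
  have h1 : p.coeff n = 1 := by
    rw [hp, Polynomial.coeff_add, Polynomial.coeff_X_pow, if_pos rfl, Polynomial.finsetSum_coeff,
      Finset.sum_eq_zero, add_zero]
    intro j _
    have hj := Finset.mem_Icc.1 j.2
    rw [Polynomial.coeff_C_mul, Polynomial.coeff_X_pow, if_neg (by omega), mul_zero]
  rw [h0] at h1
  simp at h1

/-- If P_y vanished identically near p₀ on the curve, then P_x ≠ 0 would force x' = 0, hence y' ≠ 0.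
The curve would contain an open piece of a fibre of K, contradicting that P is monic in y. -/
theorem eventually_localPolyY_ne_zero (p₀ : SpectralCurve a ha) :
    ∀ᶠ z in 𝓝[≠] (chartAt ℂ p₀ p₀),
      localPolyY a (SpectralCurve.proj p₀) (localX p₀ z) (localY p₀ z) ≠ 0 := by
  refine ((analyticAt_localPolyY_comp p₀).eventually_eq_zero_or_eventually_ne_zero).resolve_left
    fun h => ?_
  have hPX : localPolyX a (SpectralCurve.proj p₀) (localX p₀ (chartAt ℂ p₀ p₀))
      (localY p₀ (chartAt ℂ p₀ p₀)) ≠ 0 := fun h0 =>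
    localPoly_partial_ne_zero p₀ ⟨h0, h.self_of_nhds⟩
  have hX' : ∀ᶠ z in 𝓝 (chartAt ℂ p₀ p₀), deriv (localX p₀) z = 0 := by
    filter_upwards [h, eventually_localPoly_deriv p₀,
      (analyticAt_localPolyX_comp p₀).continuousAt.eventually_ne hPX] with z h1 h2 h3
    rw [h1, zero_mul, add_zero] at h2
    exact (mul_eq_zero.1 h2).resolve_left h3
  have hY' : deriv (localY p₀) (chartAt ℂ p₀ p₀) ≠ 0 := fun h0 =>
    deriv_localX_localY_ne_zero p₀ ⟨hX'.self_of_nhds, h0⟩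
  have hmap := (analyticAt_localY p₀).hasStrictDerivAt.map_nhds_eq hY'
  refine not_eventually_localPoly_eq_zero a (SpectralCurve.proj p₀)
    (localX p₀ (chartAt ℂ p₀ p₀)) (localY p₀ (chartAt ℂ p₀ p₀)) ?_
  rw [← hmap, eventually_map]
  filter_upwards [eventually_localPoly_eq_zero p₀,
    (analyticAt_localX p₀).eventually_eq_of_deriv hX'] with z h1 h2
  rwa [h2] at h1

/-- If x' vanished identically, then y' would be nonzero, and P_x x' + P_y y' = 0 would force P_y =
0 near p₀. -/
theorem eventually_deriv_localX_ne_zero (p₀ : SpectralCurve a ha) :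
    ∀ᶠ z in 𝓝[≠] (chartAt ℂ p₀ p₀), deriv (localX p₀) z ≠ 0 := by
  refine ((analyticAt_localX p₀).deriv.eventually_eq_zero_or_eventually_ne_zero).resolve_left
    fun h => ?_
  have hY' : deriv (localY p₀) (chartAt ℂ p₀ p₀) ≠ 0 := fun h0 =>
    deriv_localX_localY_ne_zero p₀ ⟨h.self_of_nhds, h0⟩
  have h1 : ∀ᶠ z in 𝓝[≠] (chartAt ℂ p₀ p₀), False := by
    filter_upwards [eventually_localPolyY_ne_zero p₀, nhdsWithin_le_nhds h,
      nhdsWithin_le_nhds (eventually_localPoly_deriv p₀),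
      nhdsWithin_le_nhds ((analyticAt_localY p₀).deriv.continuousAt.eventually_ne hY')]
      with z h1 h2 h3 h4
    rw [h2, mul_zero, zero_add] at h3
    exact (mul_ne_zero h1 h4) h3
  exact (eventually_false_iff_eq_bot.1 h1 ▸ (inferInstance : NeBot (𝓝[≠] (chartAt ℂ p₀ p₀)))).ne rfl

/-- The fibres of the projection are discrete, so properties that hold off a discrete subset of the
base pull back to the curve. -/
theorem tendsto_proj_punctured (p₀ : SpectralCurve a ha) :
    Tendsto SpectralCurve.proj (𝓝[≠] p₀) (𝓝[≠] (SpectralCurve.proj p₀)) := by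
  refine tendsto_nhdsWithin_iff.2 ⟨continuous_proj.continuousAt.tendsto.mono_left
    nhdsWithin_le_nhds, ?_⟩
  have h : ∀ᶠ z in 𝓝[≠] (chartAt ℂ p₀ p₀), localX p₀ z ≠ localX p₀ (chartAt ℂ p₀ p₀) := by
    refine ((analyticAt_localX p₀).eventually_eq_or_eventually_ne
      analyticAt_const).resolve_left fun h => ?_
    have h1 : ∀ᶠ z in 𝓝 (chartAt ℂ p₀ p₀), deriv (localX p₀) z = 0 := by
      filter_upwards [h.eventually_nhds] with z hz
      rw [EventuallyEq.deriv_eq hz, deriv_const]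
    obtain ⟨z, hz1, hz2⟩ := ((eventually_deriv_localX_ne_zero p₀).and
      (nhdsWithin_le_nhds h1)).exists
    exact hz1 hz2
  filter_upwards [(tendsto_chartAt_punctured p₀).eventually h,
    nhdsWithin_le_nhds (eventually_mem_chart_source p₀)] with p h1 h2 h3
  have h3 : SpectralCurve.proj p = SpectralCurve.proj p₀ := h3
  rw [localX_apply h2, localX_apply (mem_chart_source ℂ p₀), h3] at h1
  exact h1 rfl

end Curve

/-! ### Holomorphic one-forms on the spectral curve. -/

section CurveForms

variable {X : Type*} [TopologicalSpace X] [ChartedSpace ℂ X] [IsManifold 𝓘(ℂ) ω X]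
variable {n : ℕ} {a : HitchinBase X n} {ha : IsNonsingular a}

theorem speed_proj_eq {p₀ p : SpectralCurve a ha} (hp : p ∈ (chartAt ℂ p₀).source)
    (hp' : SpectralCurve.proj p ∈ (chartAt ℂ (SpectralCurve.proj p₀)).source) :
    speed SpectralCurve.proj p = speed (chartAt ℂ p₀) p * deriv (localX p₀) (chartAt ℂ p₀ p) *
      frame (SpectralCurve.proj p₀) (SpectralCurve.proj p) := by
  have h1 : (SpectralCurve.proj ∘ (chartAt ℂ p₀).symm) (chartAt ℂ p₀ p) = SpectralCurve.proj p := by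
    simp [(chartAt ℂ p₀).left_inv hp]
  rw [speed_eq_chartAt hp (mdifferentiableAt_proj p), speed_eq_deriv_mul_frame (by rwa [h1])
    ((mdifferentiableAt_comp_chartAt_symm_iff hp).2 (mdifferentiableAt_proj p)), h1, mul_assoc]
  rfl

/-- Evaluating η on `speed SpectralCurve.proj p` means evaluating its pull-back on the unit tangent
vector at p. -/
theorem formEval_speed_proj {j : ℕ} (η : differentials X j) {p₀ p : SpectralCurve a ha}
    (hp : p ∈ (chartAt ℂ p₀).source)
    (hp' : SpectralCurve.proj p ∈ (chartAt ℂ (SpectralCurve.proj p₀)).source) :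
    formEval η (SpectralCurve.proj p) (speed SpectralCurve.proj p) =
      (speed (chartAt ℂ p₀) p * deriv (localX p₀) (chartAt ℂ p₀ p)) ^ j *
        localCoeff η (SpectralCurve.proj p₀) (localX p₀ (chartAt ℂ p₀ p)) := by
  rw [speed_proj_eq hp hp', formEval_mul, localX_apply hp, localCoeff_apply η hp']

theorem fibreDeriv_speed_proj {p₀ p : SpectralCurve a ha} (hp : p ∈ (chartAt ℂ p₀).source)
    (hp' : SpectralCurve.proj p ∈ (chartAt ℂ (SpectralCurve.proj p₀)).source) :
    fibreDeriv a (SpectralCurve.incl a ha p) (speed SpectralCurve.proj p) =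
      (speed (chartAt ℂ p₀) p * deriv (localX p₀) (chartAt ℂ p₀ p)) ^ (n - 1) *
        localPolyY a (SpectralCurve.proj p₀) (localX p₀ (chartAt ℂ p₀ p))
          (localY p₀ (chartAt ℂ p₀ p)) := by
  rw [speed_proj_eq hp hp', fibreDeriv_mul, localX_apply hp, localY_apply hp]
  unfold fibreDeriv localPolyY
  congr 2
  refine Finset.sum_congr rfl fun j _ => ?_
  rw [localCoeff_apply _ hp']
  rfl

theorem eventually_mem_sources (p₀ : SpectralCurve a ha) : ∀ᶠ p in 𝓝 p₀,
    p ∈ (chartAt ℂ p₀).source ∧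
      SpectralCurve.proj p ∈ (chartAt ℂ (SpectralCurve.proj p₀)).source :=
  (eventually_mem_chart_source p₀).and (eventually_proj_mem_source p₀)

theorem eventually_speed_proj_ne_zero (p₀ : SpectralCurve a ha) :
    ∀ᶠ p in 𝓝[≠] p₀, speed SpectralCurve.proj p ≠ 0 := by
  filter_upwards [nhdsWithin_le_nhds (eventually_mem_sources p₀),
    (tendsto_chartAt_punctured p₀).eventually (eventually_deriv_localX_ne_zero p₀)] with p h1 h2
  rw [speed_proj_eq h1.1 h1.2]
  exact mul_ne_zero (mul_ne_zero (speed_chartAt_ne_zero h1.1) h2) (frame_ne_zero h1.2)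

theorem eventually_fibreDeriv_ne_zero (p₀ : SpectralCurve a ha) : ∀ᶠ p in 𝓝[≠] p₀,
    fibreDeriv a (SpectralCurve.incl a ha p) (speed SpectralCurve.proj p) ≠ 0 := by
  filter_upwards [nhdsWithin_le_nhds (eventually_mem_sources p₀),
    (tendsto_chartAt_punctured p₀).eventually (eventually_deriv_localX_ne_zero p₀),
    (tendsto_chartAt_punctured p₀).eventually (eventually_localPolyY_ne_zero p₀)] with p h1 h2 h3
  rw [fibreDeriv_speed_proj h1.1 h1.2]
  exact mul_ne_zero (pow_ne_zero _ (mul_ne_zero (speed_chartAt_ne_zero h1.1) h2)) h3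

theorem eventually_formEval_proj_ne_zero [ConnectedSpace X] {j : ℕ} {η : differentials X j}
    (hη : η ≠ 0) (p₀ : SpectralCurve a ha) :
    ∀ᶠ p in 𝓝[≠] p₀, formEval η (SpectralCurve.proj p) 1 ≠ 0 :=
  (tendsto_proj_punctured p₀).eventually (eventually_formEval_ne_zero hη _)

variable {f : SpectralCurve a ha → OnePoint ℂ}

/-- The locally constant case includes f ≡ ∞ locally: the coordinate then has a constant default
value and is still differentiable. -/
theorem IsHolomorphicToSphere.eventually_speed_eq {Y : Type*} [TopologicalSpace Y]
    [ChartedSpace ℂ Y] [IsManifold 𝓘(ℂ) ω Y] {f : Y → OnePoint ℂ} (hf : IsHolomorphicToSphere f)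
    (p₀ : Y) : ∀ᶠ p in 𝓝[≠] p₀, speed (fun t => sphereCoord (f t)) p =
      speed (chartAt ℂ p₀) p * deriv (localCoord f p₀) (chartAt ℂ p₀ p) := by
  rcases hf.eventually_const_or_regular p₀ with h | h
  · filter_upwards [nhdsWithin_le_nhds h.eventually_nhds,
      nhdsWithin_le_nhds (eventually_mem_chart_source p₀)] with p h1 h2
    refine speed_eq_chartAt_deriv h2 ?_
    refine MDifferentiableAt.congr_of_eventuallyEq
      (mdifferentiableAt_const (c := sphereCoord (f p₀))) ?_
    filter_upwards [h1] with t ht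
    rw [ht]
  · filter_upwards [h, nhdsWithin_le_nhds (eventually_mem_chart_source p₀)] with p h1 h2
    exact hf.speed_eq h2 h1.1

theorem isQuotientByDifferential_pullback (hf : IsHolomorphicToSphere f) (η : differentials X 1) :
    IsQuotientByDifferential f (fun p =>
      formEval η (SpectralCurve.proj p) (speed SpectralCurve.proj p) /
        speed (fun t => sphereCoord (f t)) p) := by
  intro p₀
  refine ⟨fun z => deriv (localX p₀) z * localCoeff η (SpectralCurve.proj p₀) (localX p₀ z),
    (analyticAt_localX p₀).deriv.mul ((analyticAt_localCoeff η
      (localX_mem_target p₀).self_of_nhds).comp (analyticAt_localX p₀)), ?_⟩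
  filter_upwards [nhdsWithin_le_nhds (eventually_mem_sources p₀), hf.eventually_speed_eq p₀]
    with p h1 h2
  rw [formEval_speed_proj η h1.1 h1.2, h2, pow_one, mul_assoc,
    mul_div_mul_left _ _ (speed_chartAt_ne_zero h1.1)]

/-- On the curve dx/P_y = -dy/P_x, and at each point at least one of the two denominators is
nonzero. -/
theorem exists_analyticAt_residue (p₀ : SpectralCurve a ha) :
    ∃ κ : ℂ → ℂ, AnalyticAt ℂ κ (chartAt ℂ p₀ p₀) ∧ ∀ᶠ z in 𝓝[≠] (chartAt ℂ p₀ p₀),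
      deriv (localX p₀) z /
        localPolyY a (SpectralCurve.proj p₀) (localX p₀ z) (localY p₀ z) = κ z := by
  by_cases h : localPolyY a (SpectralCurve.proj p₀) (localX p₀ (chartAt ℂ p₀ p₀))
      (localY p₀ (chartAt ℂ p₀ p₀)) = 0
  · have hPX : localPolyX a (SpectralCurve.proj p₀) (localX p₀ (chartAt ℂ p₀ p₀))
        (localY p₀ (chartAt ℂ p₀ p₀)) ≠ 0 := fun h0 => localPoly_partial_ne_zero p₀ ⟨h0, h⟩
    refine ⟨fun z => - deriv (localY p₀) z /
      localPolyX a (SpectralCurve.proj p₀) (localX p₀ z) (localY p₀ z),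
      (analyticAt_localY p₀).deriv.neg.div (analyticAt_localPolyX_comp p₀) hPX, ?_⟩
    filter_upwards [eventually_localPolyY_ne_zero p₀,
      nhdsWithin_le_nhds ((analyticAt_localPolyX_comp p₀).continuousAt.eventually_ne hPX),
      nhdsWithin_le_nhds (eventually_localPoly_deriv p₀)] with z h1 h2 h3
    rw [div_eq_div_iff h1 h2]
    linear_combination h3
  · exact ⟨_, (analyticAt_localX p₀).deriv.div (analyticAt_localPolyY_comp p₀) h,
      Eventually.of_forall fun z => rfl⟩

/-- The Poincaré residue of a section of `π^* K^n` along the spectral curve is a holomorphic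
one-form. -/
theorem isQuotientByDifferential_residue (hf : IsHolomorphicToSphere f)
    {β : SpectralCurve a ha → ℂ}
    (hβ : ∀ p₀ : SpectralCurve a ha, ∃ B : ℂ → ℂ, AnalyticAt ℂ B (chartAt ℂ p₀ p₀) ∧
      ∀ᶠ p in 𝓝[≠] p₀, β p =
        (speed (chartAt ℂ p₀) p * deriv (localX p₀) (chartAt ℂ p₀ p)) ^ n * B (chartAt ℂ p₀ p))
    (hn : n ≠ 0) :
    IsQuotientByDifferential f (fun p =>
      β p / (fibreDeriv a (SpectralCurve.incl a ha p) (speed SpectralCurve.proj p) *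
        speed (fun t => sphereCoord (f t)) p)) := by
  intro p₀
  obtain ⟨κ, hκ, hκe⟩ := exists_analyticAt_residue p₀
  obtain ⟨B, hB, hBe⟩ := hβ p₀
  refine ⟨fun z => κ z * B z, hκ.mul hB, ?_⟩
  filter_upwards [nhdsWithin_le_nhds (eventually_mem_sources p₀), hf.eventually_speed_eq p₀, hBe,
    (tendsto_chartAt_punctured p₀).eventually (hκe.and (eventually_deriv_localX_ne_zero p₀))]
    with p h1 h2 h3 h4
  have hc := speed_chartAt_ne_zero h1.1
  rw [fibreDeriv_speed_proj h1.1 h1.2, h2, h3, ← h4.1]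
  obtain ⟨m, rfl⟩ : ∃ m, n = m + 1 := ⟨n - 1, by omega⟩
  set c := speed (chartAt ℂ p₀) p
  set D := deriv (localX p₀) (chartAt ℂ p₀ p)
  -- The numerator carries (cD)^(m+1), ∂s/∂λ carries (cD)^m and df carries c. Cancelling (cD)^m·c
  -- leaves (D/P_y)·B divided by the local derivative of f, free of the normalisation c.
  have hcD : (c * D) ^ m * c ≠ 0 := mul_ne_zero (pow_ne_zero _ (mul_ne_zero hc h4.2)) hc
  rw [Nat.add_sub_cancel, div_mul_eq_mul_div, div_div, pow_succ]
  rw [← mul_div_mul_left (D * B _) _ hcD]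
  congr 1 <;> ring

theorem isQuotientByDifferential_residue_pow (hf : IsHolomorphicToSphere f)
    (η : differentials X 1) (hn : n ≠ 0) :
    IsQuotientByDifferential f (fun p =>
      formEval η (SpectralCurve.proj p) (speed SpectralCurve.proj p) ^ n /
        (fibreDeriv a (SpectralCurve.incl a ha p) (speed SpectralCurve.proj p) *
          speed (fun t => sphereCoord (f t)) p)) := by
  refine isQuotientByDifferential_residue hf (fun p₀ => ?_) hn
  refine ⟨fun z => localCoeff η (SpectralCurve.proj p₀) (localX p₀ z) ^ n,
    ((analyticAt_localCoeff η (localX_mem_target p₀).self_of_nhds).comp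
      (analyticAt_localX p₀)).pow n, ?_⟩
  filter_upwards [nhdsWithin_le_nhds (eventually_mem_sources p₀)] with p h1
  rw [formEval_speed_proj η h1.1 h1.2, pow_one, mul_pow]

/-! ### Quotients of one-forms -/

/-- The pull-back to the spectral curve of the quotient of two one-forms on the base. -/
noncomputable def formQuotient (η₁ η₂ : differentials X 1) (p : SpectralCurve a ha) : ℂ :=
  formEval η₂ (SpectralCurve.proj p) 1 / formEval η₁ (SpectralCurve.proj p) 1

/-- The local expression of `formQuotient`. -/
noncomputable def localQuotient (η₁ η₂ : differentials X 1) (p₀ : SpectralCurve a ha) (z : ℂ) : ℂ :=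
  localCoeff η₂ (SpectralCurve.proj p₀) (localX p₀ z) /
    localCoeff η₁ (SpectralCurve.proj p₀) (localX p₀ z)

theorem formQuotient_eq (η₁ η₂ : differentials X 1) {p₀ p : SpectralCurve a ha}
    (hp : p ∈ (chartAt ℂ p₀).source)
    (hp' : SpectralCurve.proj p ∈ (chartAt ℂ (SpectralCurve.proj p₀)).source) :
    formQuotient η₁ η₂ p = localQuotient η₁ η₂ p₀ (chartAt ℂ p₀ p) := by
  rw [localQuotient, localX_apply hp, localCoeff_apply _ hp', localCoeff_apply _ hp',
    formEval_eq, formEval_eq η₁, pow_one, mul_div_mul_left _ _ (frame_ne_zero hp'), formQuotient]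

/-- The quotient rule d(η₂/η₁) = W/η₁², with W the Wronskian of η₁ and η₂, multiplied out. -/
theorem eventually_speed_formQuotient [T1Space (SpectralCurve a ha)] [ConnectedSpace X]
    {η₁ : differentials X 1} (hη : η₁ ≠ 0)
    (η₂ : differentials X 1) (p₀ : SpectralCurve a ha) : ∀ᶠ p in 𝓝[≠] p₀,
    MDifferentiableAt 𝓘(ℂ) 𝓘(ℂ) (formQuotient (a := a) (ha := ha) η₁ η₂) p ∧
    speed (formQuotient η₁ η₂) p * localCoeff η₁ (SpectralCurve.proj p₀)
      (localX p₀ (chartAt ℂ p₀ p)) ^ 2 =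
      speed (chartAt ℂ p₀) p * deriv (localX p₀) (chartAt ℂ p₀ p) *
      (deriv (localCoeff η₂ (SpectralCurve.proj p₀)) (localX p₀ (chartAt ℂ p₀ p)) *
        localCoeff η₁ (SpectralCurve.proj p₀) (localX p₀ (chartAt ℂ p₀ p)) -
      deriv (localCoeff η₁ (SpectralCurve.proj p₀)) (localX p₀ (chartAt ℂ p₀ p)) *
        localCoeff η₂ (SpectralCurve.proj p₀) (localX p₀ (chartAt ℂ p₀ p))) := by
  filter_upwards [nhdsWithin_le_nhds (eventually_mem_sources p₀).eventually_nhds,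
    nhdsWithin_le_nhds ((tendsto_chartAt p₀).eventually ((localX_mem_target p₀).and
      (analyticAt_localX p₀).eventually_analyticAt)),
    eventually_formEval_proj_ne_zero hη p₀] with p h1 h2 h3
  obtain ⟨hp, hp'⟩ := h1.self_of_nhds
  have hk1 : localCoeff η₁ (SpectralCurve.proj p₀) (localX p₀ (chartAt ℂ p₀ p)) ≠ 0 := by
    rwa [localX_apply hp, Ne, localCoeff_apply_eq_zero_iff _ hp']
  have hd := ((analyticAt_localCoeff η₂ h2.1).differentiableAt.hasDerivAt.comp _
    h2.2.differentiableAt.hasDerivAt).div ((analyticAt_localCoeff η₁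
    h2.1).differentiableAt.hasDerivAt.comp _ h2.2.differentiableAt.hasDerivAt) hk1
  have hloc : formQuotient η₁ η₂ =ᶠ[𝓝 p] localQuotient η₁ η₂ p₀ ∘ chartAt ℂ p₀ := by
    filter_upwards [h1] with t ht
    exact formQuotient_eq η₁ η₂ ht.1 ht.2
  have hd' : HasDerivAt (localQuotient η₁ η₂ p₀) _ (chartAt ℂ p₀ p) := hd
  have hm : MDifferentiableAt 𝓘(ℂ) 𝓘(ℂ) (localQuotient η₁ η₂ p₀) (chartAt ℂ p₀ p) :=
    hd'.differentiableAt.mdifferentiableAt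
  refine ⟨(hm.comp p (mdifferentiableAt_chartAt hp)).congr_of_eventuallyEq hloc, ?_⟩
  rw [speed_congr hloc, speed_comp hm (mdifferentiableAt_chartAt hp), speed_eq_deriv, hd'.deriv]
  simp only [Function.comp_apply]
  field_simp

/-- The numerator η₁^(n-1) d(η₂/η₁) equals η₁^(n-3) W, the pull-back of a section of K^n. It is
holomorphic because n ≥ 3. -/
theorem isQuotientByDifferential_residue_wronskian [T1Space (SpectralCurve a ha)] [ConnectedSpace X]
    (hf : IsHolomorphicToSphere f) {η₁ : differentials X 1} (hη : η₁ ≠ 0)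
    (η₂ : differentials X 1) (hn : 3 ≤ n) :
    IsQuotientByDifferential f (fun p =>
      (formEval η₁ (SpectralCurve.proj p) (speed SpectralCurve.proj p) ^ (n - 1) *
        speed (formQuotient η₁ η₂) p) /
        (fibreDeriv a (SpectralCurve.incl a ha p) (speed SpectralCurve.proj p) *
          speed (fun t => sphereCoord (f t)) p)) := by
  refine isQuotientByDifferential_residue hf (fun p₀ => ?_) (by omega)
  have h1 := (analyticAt_localCoeff η₁ (localX_mem_target p₀).self_of_nhds)
  have h2 := (analyticAt_localCoeff η₂ (localX_mem_target p₀).self_of_nhds)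
  have hX := analyticAt_localX p₀
  refine ⟨fun z => localCoeff η₁ (SpectralCurve.proj p₀) (localX p₀ z) ^ (n - 3) *
    (deriv (localCoeff η₂ (SpectralCurve.proj p₀)) (localX p₀ z) *
        localCoeff η₁ (SpectralCurve.proj p₀) (localX p₀ z) -
      deriv (localCoeff η₁ (SpectralCurve.proj p₀)) (localX p₀ z) *
        localCoeff η₂ (SpectralCurve.proj p₀) (localX p₀ z)),
    ((h1.comp hX).pow _).mul (((h2.deriv.comp hX).mul (h1.comp hX)).sub
      ((h1.deriv.comp hX).mul (h2.comp hX))), ?_⟩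
  filter_upwards [nhdsWithin_le_nhds (eventually_mem_sources p₀),
    eventually_speed_formQuotient hη η₂ p₀] with p h3 h4
  rw [formEval_speed_proj η₁ h3.1 h3.2, pow_one]
  obtain ⟨m, rfl⟩ : ∃ m, n = m + 3 := ⟨n - 3, by omega⟩
  rw [show m + 3 - 1 = m + 2 by omega, show m + 3 - 3 = m by omega]
  have h5 := h4.2
  linear_combination ((speed (chartAt ℂ p₀) p * deriv (localX p₀) (chartAt ℂ p₀ p)) ^ (m + 2) *
    localCoeff η₁ (SpectralCurve.proj p₀) (localX p₀ (chartAt ℂ p₀ p)) ^ m) * h5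

end CurveForms

/-! ### General fibres of a map of degree two. -/

section Fibres

variable {Y : Type*} [TopologicalSpace Y] [ChartedSpace ℂ Y] [IsManifold 𝓘(ℂ) ω Y]
variable {f : Y → OnePoint ℂ}

/-- A function that takes equal values at the two points of the general fibres of `f` has equal
derivatives with respect to `f` at these points. -/
theorem IsHolomorphicToSphere.speed_div_eq [T2Space Y] (hf : IsHolomorphicToSphere f) {g : Y → ℂ}
    {E : Finset (OnePoint ℂ)}
    (hg : ∀ p₁ p₂, p₁ ≠ p₂ → f p₁ = f p₂ → f p₁ ∉ E → g p₁ = g p₂) {p₁ p₂ : Y} (hne : p₁ ≠ p₂)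
    (h12 : f p₁ = f p₂) (hE : f p₁ ∉ E) (h1 : IsRegularPoint f p₁) (h2 : IsRegularPoint f p₂)
    (hg1 : MDifferentiableAt 𝓘(ℂ) 𝓘(ℂ) g p₁) (hg2 : MDifferentiableAt 𝓘(ℂ) 𝓘(ℂ) g p₂) :
    speed g p₁ / speed (fun t => sphereCoord (f t)) p₁ =
      speed g p₂ / speed (fun t => sphereCoord (f t)) p₂ := by
  set w := sphereCoord (f p₁) with hw
  have hfw : f p₁ = w := (coe_sphereCoord h1.1).symm
  have hsec : ∀ p, IsRegularPoint f p → sphereCoord (f p) = w →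
      MDifferentiableAt 𝓘(ℂ) 𝓘(ℂ) g p → ∃ s : ℂ → Y, s w = p ∧ ContinuousAt s w ∧
      (∀ᶠ w' in 𝓝 w, f (s w') = (w' : OnePoint ℂ)) ∧
      deriv (g ∘ s) w = speed g p / speed (fun t => sphereCoord (f t)) p := by
    intro p hp hpw hgp
    obtain ⟨s, hs1, hs2, hs3⟩ := hf.exists_local_section hp.1 hp.2
    rw [hpw] at hs1 hs2 hs3
    have hs2 := hs2.self_of_nhds
    refine ⟨s, hs1, hs2.continuousAt, hs3, ?_⟩
    -- The chain rule applied to f ∘ s = id: differentiating g along a local section of f gives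
    -- dg/df.
    have e1 : speed ((fun t => sphereCoord (f t)) ∘ s) w = 1 := by
      have : (fun t => sphereCoord (f t)) ∘ s =ᶠ[𝓝 w] id := by
        filter_upwards [hs3] with w' hw'
        simp only [Function.comp_apply, hw']
        rfl
      rw [speed_congr this, speed_eq_deriv, deriv_id]
    rw [speed_comp (by rw [hs1]; exact hf.holomorphic_coord p hp.1) hs2, hs1] at e1
    rw [← speed_eq_deriv, speed_comp (by rwa [hs1]) hs2, hs1, eq_div_iff hp.2]
    linear_combination speed g p * e1
  obtain ⟨s₁, ha1, ha2, ha3, ha4⟩ := hsec p₁ h1 rfl hg1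
  obtain ⟨s₂, hb1, hb2, hb3, hb4⟩ := hsec p₂ h2 (by rw [← h12]) hg2
  have hsne : ∀ᶠ w' in 𝓝 w, s₁ w' ≠ s₂ w' :=
    (ha2.prodMk hb2).eventually (isClosed_diagonal.isOpen_compl.mem_nhds (by
      simpa [ha1, hb1] using hne))
  have hEev : ∀ᶠ w' in 𝓝 w, ((w' : ℂ) : OnePoint ℂ) ∉ E :=
    OnePoint.continuous_coe.continuousAt.eventually
      (E.finite_toSet.isClosed.isOpen_compl.mem_nhds (hfw ▸ hE))
  have heq : g ∘ s₁ =ᶠ[𝓝 w] g ∘ s₂ := by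
    filter_upwards [hsne, hEev, ha3, hb3] with w' e1 e2 e3 e4
    exact hg _ _ e1 (e3.trans e4.symm) (e3 ▸ e2)
  rw [← ha4, ← hb4, heq.deriv_eq]

theorem exists_fibre_pair {f : Y → OnePoint ℂ}
    (hfib : {q : OnePoint ℂ | (f ⁻¹' {q}).encard ≠ 2}.Finite) (E : Finset (OnePoint ℂ)) :
    ∃ p₁ p₂, p₁ ≠ p₂ ∧ f p₁ = f p₂ ∧ f p₁ ∉ E ∧ f ⁻¹' {f p₁} = {p₁, p₂} := by
  have : Infinite (OnePoint ℂ) := Infinite.of_injective _ (OnePoint.coe_injective (X := ℂ))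
  classical
  obtain ⟨q, hq⟩ := Infinite.exists_notMem_finset (E ∪ hfib.toFinset)
  rw [Finset.mem_union, not_or] at hq
  have h2 : (f ⁻¹' {q}).encard = 2 := by
    by_contra h
    exact hq.2 (hfib.mem_toFinset.2 h)
  obtain ⟨x, y, hxy, h⟩ := Set.encard_eq_two.1 h2
  have hx : f x = q := by
    have : x ∈ f ⁻¹' {q} := by rw [h]; simp
    exact this
  have hy : f y = q := by
    have : y ∈ f ⁻¹' {q} := by rw [h]; simp
    exact this
  exact ⟨x, y, hxy, hx.trans hy.symm, hx ▸ hq.1, hx ▸ h⟩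

end Fibres

/-! ### The Wronskian, and spectral curves of degree at least three. -/

section Wronskian

variable {X : Type*} [TopologicalSpace X] [ChartedSpace ℂ X] [IsManifold 𝓘(ℂ) ω X]
  [ConnectedSpace X]

/-- If the Wronskian vanishes identically near x₀, then η₂/η₁ is constant near some point where η₁ ≠
0, and the identity theorem makes η₂ a multiple of η₁. -/
theorem eventually_wronskian_ne_zero {η₁ η₂ : differentials X 1} (h1 : η₁ ≠ 0)
    (h2 : ∀ c : ℂ, η₂ ≠ c • η₁) (x₀ : X) : ∀ᶠ z in 𝓝[≠] (chartAt ℂ x₀ x₀),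
      deriv (localCoeff η₂ x₀) z * localCoeff η₁ x₀ z -
        deriv (localCoeff η₁ x₀) z * localCoeff η₂ x₀ z ≠ 0 := by
  have hA1 := analyticAt_localCoeff η₁ (mem_chart_target ℂ x₀)
  have hA2 := analyticAt_localCoeff η₂ (mem_chart_target ℂ x₀)
  refine (((hA2.deriv.mul hA1).sub
    (hA1.deriv.mul hA2)).eventually_eq_zero_or_eventually_ne_zero).resolve_left fun h => ?_
  have hk : ∀ᶠ x in 𝓝[≠] x₀, localCoeff η₁ x₀ (chartAt ℂ x₀ x) ≠ 0 := by
    filter_upwards [eventually_formEval_ne_zero h1 x₀,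
      nhdsWithin_le_nhds (eventually_mem_chart_source x₀)] with x hx hxs
    rwa [Ne, localCoeff_apply_eq_zero_iff _ hxs]
  obtain ⟨x₁, hx1, hx2, hx3⟩ := (hk.and
    ((((tendsto_chartAt x₀).eventually h.eventually_nhds).and
    (eventually_mem_chart_source x₀)).filter_mono nhdsWithin_le_nhds)).exists
  set z₁ := chartAt ℂ x₀ x₁
  have hz₁ : z₁ ∈ (chartAt ℂ x₀).target := (chartAt ℂ x₀).map_source hx3
  have hB1 := analyticAt_localCoeff η₁ hz₁
  have hB2 := analyticAt_localCoeff η₂ hz₁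
  have hne : ∀ᶠ z in 𝓝 z₁, localCoeff η₁ x₀ z ≠ 0 := hB1.continuousAt.eventually_ne hx1
  have hq : ∀ᶠ z in 𝓝 z₁, deriv (fun z => localCoeff η₂ x₀ z / localCoeff η₁ x₀ z) z = 0 := by
    filter_upwards [hx2, hne, hB1.eventually_analyticAt, hB2.eventually_analyticAt]
      with z e1 e2 e3 e4
    have e1 : deriv (localCoeff η₂ x₀) z * localCoeff η₁ x₀ z -
        deriv (localCoeff η₁ x₀) z * localCoeff η₂ x₀ z = 0 := e1
    rw [deriv_fun_div e4.differentiableAt e3.differentiableAt e2, mul_comm (localCoeff η₂ x₀ z), e1,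
      zero_div]
  have hconst := (hB2.div hB1 hx1).eventually_eq_of_deriv hq
  set c : ℂ := localCoeff η₂ x₀ z₁ / localCoeff η₁ x₀ z₁
  refine h2 c (sub_eq_zero.1 (eq_zero_of_eventually_formEval_eq_zero _ (x₀ := x₁) ?_))
  have hch : Tendsto (chartAt ℂ x₀) (𝓝 x₁) (𝓝 z₁) := (chartAt ℂ x₀).continuousAt hx3
  filter_upwards [hch.eventually (hconst.and hne), (chartAt ℂ x₀).open_source.mem_nhds hx3]
    with x e1 e2
  have e3 : localCoeff η₂ x₀ (chartAt ℂ x₀ x) / localCoeff η₁ x₀ (chartAt ℂ x₀ x) = c := e1.1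
  rw [div_eq_iff e1.2] at e3
  rw [← localCoeff_apply_eq_zero_iff (x₀ := x₀) _ e2]
  have e4 : localCoeff (η₂ - c • η₁) x₀ (chartAt ℂ x₀ x) =
    localCoeff η₂ x₀ (chartAt ℂ x₀ x) - c * localCoeff η₁ x₀ (chartAt ℂ x₀ x) := rfl
  rw [e4, e3, sub_self]

variable {n : ℕ} {a : HitchinBase X n} {ha : IsNonsingular a}

theorem eventually_speed_formQuotient_ne_zero [T1Space (SpectralCurve a ha)]
    {η₁ η₂ : differentials X 1} (h1 : η₁ ≠ 0)
    (h2 : ∀ c : ℂ, η₂ ≠ c • η₁) (p₀ : SpectralCurve a ha) :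
    ∀ᶠ p in 𝓝[≠] p₀, speed (formQuotient (a := a) (ha := ha) η₁ η₂) p ≠ 0 := by
  have hX : ∀ᶠ p in 𝓝[≠] p₀, _ := (tendsto_proj_punctured p₀).eventually
    ((tendsto_chartAt_punctured _).eventually
      (eventually_wronskian_ne_zero h1 h2 (SpectralCurve.proj p₀)))
  filter_upwards [hX, eventually_speed_formQuotient h1 η₂ p₀,
    nhdsWithin_le_nhds (eventually_mem_sources p₀),
    (tendsto_chartAt_punctured p₀).eventually (eventually_deriv_localX_ne_zero p₀)]
    with p e1 e2 e3 e4 h0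
  have e5 := e2.2
  rw [h0, zero_mul, localX_apply e3.1] at e5
  exact mul_ne_zero (mul_ne_zero (speed_chartAt_ne_zero e3.1) e4) e1 e5.symm

theorem not_isHyperelliptic_of_three_le [T2Space X] [CompactSpace X]
    (hg : 1 < genus X) (hn : 3 ≤ n) : ¬ IsHyperelliptic (SpectralCurve a ha) := by
  classical
  rintro ⟨-, f, hf, hfib⟩
  have hfr : 1 < Module.finrank ℂ (differentials X 1) := hg
  have : Nontrivial (differentials X 1) := Module.nontrivial_of_finrank_pos (R := ℂ) (by omega)
  obtain ⟨η₁, h1⟩ := exists_ne (0 : differentials X 1)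
  obtain ⟨η₂, h2⟩ := exists_linearIndependent_pair_of_one_lt_finrank hfr h1
  have h2 : ∀ c : ℂ, η₂ ≠ c • η₁ := fun c hc =>
    (LinearIndependent.pair_iff' h1).1 h2 c hc.symm
  obtain ⟨E₁, hE₁⟩ :=
    (isQuotientByDifferential_pullback hf η₁).exists_forall_add_eq_zero hf hfib
  obtain ⟨E₂, hE₂⟩ :=
    (isQuotientByDifferential_pullback hf η₂).exists_forall_add_eq_zero hf hfib
  obtain ⟨E₃, hE₃⟩ :=
    (isQuotientByDifferential_residue_pow hf η₁ (by omega)).exists_forall_add_eq_zero hf hfib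
  obtain ⟨E₄, hE₄⟩ :=
    (isQuotientByDifferential_residue_wronskian hf h1 η₂ hn).exists_forall_add_eq_zero hf hfib
  obtain ⟨E₅, hE₅⟩ := exists_finset_forall_of_eventually (f := f) (Q := fun p =>
    IsRegularPoint f p ∧ speed SpectralCurve.proj p ≠ 0 ∧
    fibreDeriv a (SpectralCurve.incl a ha p) (speed SpectralCurve.proj p) ≠ 0 ∧
    formEval η₁ (SpectralCurve.proj p) 1 ≠ 0 ∧
    speed (formQuotient (a := a) (ha := ha) η₁ η₂) p ≠ 0 ∧
    MDifferentiableAt 𝓘(ℂ) 𝓘(ℂ) (formQuotient (a := a) (ha := ha) η₁ η₂) p) (fun p₀ => by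
      refine (hf.eventually_const_or_isRegularPoint p₀).imp_right fun h => ?_
      filter_upwards [h, eventually_speed_proj_ne_zero p₀, eventually_fibreDeriv_ne_zero p₀,
        eventually_formEval_proj_ne_zero h1 p₀, eventually_speed_formQuotient_ne_zero h1 h2 p₀,
        eventually_speed_formQuotient h1 η₂ p₀] with p e1 e2 e3 e4 e5 e6
      exact ⟨e1, e2, e3, e4, e5, e6.1⟩)
  have ho : ∀ p : SpectralCurve a ha, formEval η₁ (SpectralCurve.proj p) 1 ≠ 0 →
      formEval η₂ (SpectralCurve.proj p) (speed SpectralCurve.proj p) = formQuotient η₁ η₂ p *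
        formEval η₁ (SpectralCurve.proj p) (speed SpectralCurve.proj p) := by
    intro p hp
    rw [formEval_eq, formEval_eq η₁, formQuotient]
    field_simp
  -- Both η₁/df and η₂/df = φ·η₁/df are anti-invariant, and η₁/df ≠ 0, so φ is invariant.
  have hΦ : ∀ p₁ p₂, p₁ ≠ p₂ → f p₁ = f p₂ → f p₁ ∉ E₁ ∪ E₂ ∪ E₅ →
      formQuotient (a := a) (ha := ha) η₁ η₂ p₁ = formQuotient η₁ η₂ p₂ := by
    intro p₁ p₂ hne h12 hE
    simp only [Finset.mem_union, not_or] at hE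
    obtain ⟨r, u, -, e, -, -⟩ := hE₅ p₁ hE.2
    obtain ⟨-, -, -, e', -, -⟩ := hE₅ p₂ (h12 ▸ hE.2)
    have t1 := hE₁ p₁ p₂ hne h12 hE.1.1
    have t2 := hE₂ p₁ p₂ hne h12 hE.1.2
    rw [ho p₁ e, ho p₂ e'] at t2
    have h0 : formEval η₁ (SpectralCurve.proj p₁) (speed SpectralCurve.proj p₁) /
        speed (fun t => sphereCoord (f t)) p₁ ≠ 0 := by
      rw [formEval_eq]
      exact div_ne_zero (mul_ne_zero (pow_ne_zero _ u) e) r.2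
    refine mul_right_cancel₀ h0 ?_
    linear_combination t2 - formQuotient η₁ η₂ p₂ * t1
  obtain ⟨p₁, p₂, hne, h12, hE, -⟩ := exists_fibre_pair hfib (E₁ ∪ E₂ ∪ E₅ ∪ E₃ ∪ E₄)
  have hE' : f p₁ ∉ E₁ ∪ E₂ ∪ E₅ := fun h => hE (by simp only [Finset.mem_union] at h ⊢; tauto)
  simp only [Finset.mem_union, not_or] at hE
  obtain ⟨r, u, v, e, s, m⟩ := hE₅ p₁ hE.1.1.2
  obtain ⟨r', u', v', e', s', m'⟩ := hE₅ p₂ (h12 ▸ hE.1.1.2)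
  have t1 := hE₁ p₁ p₂ hne h12 hE.1.1.1.1
  have t3 := hE₃ p₁ p₂ hne h12 hE.1.2
  have t4 := hE₄ p₁ p₂ hne h12 hE.2
  have t5 := hf.speed_div_eq hΦ hne h12 hE' r r' m m'
  have ho1 : formEval η₁ (SpectralCurve.proj p₁) (speed SpectralCurve.proj p₁) ≠ 0 := by
    rw [formEval_eq]
    exact mul_ne_zero (pow_ne_zero _ u) e
  have r2 := r.2
  have r2' := r'.2
  -- From here only algebra is left: o stands for π*η₁, d for df, q for ∂s/∂λ and S for dφ; primes
  -- mark the values at p₂.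
  generalize formEval η₁ (SpectralCurve.proj p₁) (speed SpectralCurve.proj p₁) = o at *
  generalize formEval η₁ (SpectralCurve.proj p₂) (speed SpectralCurve.proj p₂) = o' at *
  generalize speed (fun t => sphereCoord (f t)) p₁ = d at *
  generalize speed (fun t => sphereCoord (f t)) p₂ = d' at *
  generalize fibreDeriv a (SpectralCurve.incl a ha p₁) (speed SpectralCurve.proj p₁) = q at *
  generalize fibreDeriv a (SpectralCurve.incl a ha p₂) (speed SpectralCurve.proj p₂) = q' at *
  generalize speed (formQuotient (a := a) (ha := ha) η₁ η₂) p₁ = S at *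
  generalize speed (formQuotient (a := a) (ha := ha) η₁ η₂) p₂ = S' at *
  obtain ⟨k, rfl⟩ : ∃ k, n = k + 1 := ⟨n - 1, by omega⟩
  rw [Nat.add_sub_cancel] at t4
  have h3 : (o ^ k / q) * (o / d) + (o' ^ k / q') * (o' / d') = 0 := by
    rw [← t3, pow_succ, pow_succ, mul_div_mul_comm, mul_div_mul_comm]
  have h4 : (o ^ k / q) * (S / d) + (o' ^ k / q') * (S' / d') = 0 := by
    rw [← t4, mul_div_mul_comm, mul_div_mul_comm]
  have h5 : o / d ≠ 0 := div_ne_zero ho1 r2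
  have h6 : S / d ≠ 0 := div_ne_zero s r2
  have h7 : o' / d' = - (o / d) := by linear_combination t1
  rw [h7] at h3
  rw [← t5] at h4
  -- The factor o^k/q is invariant, being the quotient of the anti-invariant o^(k+1)/(qd) by o/d.
  -- Since S/d is also invariant, the anti-invariant product of the two vanishes.
  have h8 : o ^ k / q = o' ^ k / q' := mul_right_cancel₀ h5 (by linear_combination h3)
  rw [← h8] at h4
  have h9 : o ^ k / q * (S / d) = 0 := by linear_combination h4 / 2
  exact mul_ne_zero (div_ne_zero (pow_ne_zero _ ho1) v) h6 h9

end Wronskian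

/-! ### Removable singularities and the reciprocal coordinate 1/(z - c). -/

section Removable

/-- A simple zero in the denominator is cancelled by a zero of the numerator: A/D is a quotient of
difference quotients and tends to A'/D'. -/
theorem exists_bound_div {A D : ℂ → ℂ} {z₀ : ℂ} (hA : DifferentiableAt ℂ A z₀) (hA0 : A z₀ = 0)
    (hD : DifferentiableAt ℂ D z₀) (hD0 : D z₀ = 0) (hD' : deriv D z₀ ≠ 0) :
    ∃ C : ℝ, ∀ᶠ z in 𝓝[≠] z₀, ‖A z / D z‖ ≤ C := by
  have h := (hasDerivAt_iff_tendsto_slope.1 hA.hasDerivAt).div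
    (hasDerivAt_iff_tendsto_slope.1 hD.hasDerivAt) hD'
  refine ⟨‖deriv A z₀ / deriv D z₀‖ + 1, ?_⟩
  filter_upwards [h.norm.eventually_le_const (lt_add_one _), self_mem_nhdsWithin] with z hz hne
  refine le_of_eq_of_le (congrArg _ ?_) hz
  have hne : z - z₀ ≠ 0 := sub_ne_zero.2 hne
  rw [Pi.div_apply, slope_def_field, slope_def_field, hA0, hD0, sub_zero, sub_zero,
    div_div_div_cancel_right₀ hne]

variable {Y : Type*} [TopologicalSpace Y] [ChartedSpace ℂ Y] [IsManifold 𝓘(ℂ) ω Y]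

/-- Riemann's removable singularity theorem and the maximum principle on a compact Riemann
surface. -/
theorem exists_isLocallyConstant_of_bounded [CompactSpace Y] {G : Y → ℂ}
    (hd : ∀ p₀, ∀ᶠ p in 𝓝[≠] p₀, MDifferentiableAt 𝓘(ℂ) 𝓘(ℂ) G p)
    (hb : ∀ p₀, ∃ C : ℝ, ∀ᶠ p in 𝓝[≠] p₀, ‖G p‖ ≤ C) :
    ∃ G' : Y → ℂ, IsLocallyConstant G' ∧ ∀ p₀, ∀ᶠ p in 𝓝[≠] p₀, G p = G' p := by
  -- Taking the punctured limit at every point removes all singularities at once and leaves the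
  -- values of G unchanged where it is already holomorphic.
  set G' : Y → ℂ := fun p => limUnder (𝓝[≠] p) G with hG'
  have heq : ∀ p, MDifferentiableAt 𝓘(ℂ) 𝓘(ℂ) G p → G' p = G p := fun p hp =>
    (hp.continuousAt.tendsto.mono_left nhdsWithin_le_nhds).limUnder_eq
  have hmd : MDifferentiable 𝓘(ℂ) 𝓘(ℂ) G' := by
    intro p₀
    set z₀ := chartAt ℂ p₀ p₀
    set F : ℂ → ℂ := G ∘ (chartAt ℂ p₀).symm with hF
    have hsymm : Tendsto (chartAt ℂ p₀).symm (𝓝[≠] z₀) (𝓝[≠] p₀) := by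
      refine tendsto_nhdsWithin_iff.2 ⟨(tendsto_chartAt_symm p₀).mono_left nhdsWithin_le_nhds, ?_⟩
      filter_upwards [self_mem_nhdsWithin, nhdsWithin_le_nhds (chart_target_mem_nhds ℂ p₀)]
        with z hz hzt hx
      have hx : (chartAt ℂ p₀).symm z = p₀ := hx
      exact hz (((chartAt ℂ p₀).right_inv hzt).symm.trans (congrArg _ hx))
    have hFd : ∀ᶠ z in 𝓝[≠] z₀, DifferentiableAt ℂ F z := by
      filter_upwards [hsymm.eventually (hd p₀), nhdsWithin_le_nhds (chart_target_mem_nhds ℂ p₀)]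
        with z hz hzt
      have := (differentiableAt_comp_chartAt_symm_iff ((chartAt ℂ p₀).map_target hzt)).2 hz
      rwa [(chartAt ℂ p₀).right_inv hzt] at this
    obtain ⟨C, hC⟩ := hb p₀
    have hbd : IsBoundedUnder (· ≤ ·) (𝓝[≠] z₀) fun z => ‖F z - F z₀‖ := by
      refine ⟨C + ‖F z₀‖, eventually_map.2 ?_⟩
      filter_upwards [hsymm.eventually hC] with z hz
      exact norm_sub_le_of_le hz le_rfl
    have hlim :=
      Complex.tendsto_limUnder_of_differentiable_on_punctured_nhds_of_bounded_under hFd hbd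
    have hins : {z | DifferentiableAt ℂ F z} ∈ 𝓝[≠] z₀ := hFd
    have hup := (Complex.differentiableOn_update_limUnder_insert_of_isLittleO hins
      (fun z hz => DifferentiableAt.differentiableWithinAt hz)
      hbd.isLittleO_sub_self_inv).differentiableAt (insert_mem_nhds_iff.2 hins)
    have hG0 : G' p₀ = limUnder (𝓝[≠] z₀) F := by
      refine Tendsto.limUnder_eq ((hlim.comp (tendsto_chartAt_punctured p₀)).congr' ?_)
      filter_upwards [nhdsWithin_le_nhds (eventually_mem_chart_source p₀)] with p hp
      simp [hF, (chartAt ℂ p₀).left_inv hp]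
    refine MDifferentiableAt.congr_of_eventuallyEq (hup.mdifferentiableAt.comp p₀
      (mdifferentiableAt_chartAt (mem_chart_source ℂ p₀))) ?_
    refine nhds_le_of_punctured ?_ (by simp [z₀, hG0])
    filter_upwards [hd p₀, tendsto_chartAt_punctured p₀ self_mem_nhdsWithin,
      nhdsWithin_le_nhds (eventually_mem_chart_source p₀)] with p h1 h2 h3
    have h4 : F (chartAt ℂ p₀ p) = G p := by simp [hF, (chartAt ℂ p₀).left_inv h3]
    exact (heq p h1).trans (h4.symm.trans (Function.update_of_ne h2 _ _).symm)
  -- The maximum principle; without connectedness of Y it gives local constancy only.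
  exact ⟨G', hmd.isLocallyConstant, fun p₀ => (hd p₀).mono fun p hp => (heq p hp).symm⟩

/-- The function `1 / (z - c)` on the Riemann sphere, with value `0` at its pole. -/
noncomputable def sphereRecip (c : ℂ) (q : OnePoint ℂ) : ℂ := q.elim 0 (fun z => (z - c)⁻¹)

theorem sphereRecip_eq_coord (c : ℂ) {q : OnePoint ℂ} (hq : q ≠ OnePoint.infty) :
    sphereRecip c q = (sphereCoord q - c)⁻¹ := by
  induction q using OnePoint.rec with
  | infty => exact absurd rfl hq
  | coe x => rfl

theorem sphereRecip_eq_coordInv (c : ℂ) {q : OnePoint ℂ} (hq : q ≠ ((0 : ℂ) : OnePoint ℂ)) :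
    sphereRecip c q = sphereCoordInv q / (1 - c * sphereCoordInv q) := by
  induction q using OnePoint.rec with
  | infty => simp [sphereRecip, sphereCoordInv]
  | coe x =>
    have hx : x ≠ 0 := fun h => hq (h ▸ rfl)
    change (x - c)⁻¹ = x⁻¹ / (1 - c * x⁻¹)
    rw [← mul_div_mul_left _ _ hx, mul_inv_cancel₀ hx, mul_sub, mul_one, mul_left_comm,
      mul_inv_cancel₀ hx, mul_one, one_div]

/-- The point c has to be excluded: its default value 0 is also the value at infinity. -/
theorem sphereRecip_injOn (c : ℂ) : InjOn (sphereRecip c) {(c : OnePoint ℂ)}ᶜ := by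
  intro q hq r hr h
  induction q using OnePoint.rec with
  | infty =>
    induction r using OnePoint.rec with
    | infty => rfl
    | coe y =>
      have h : 0 = (y - c)⁻¹ := h
      have hy : y - c = 0 := inv_eq_zero.1 h.symm
      exact absurd (congrArg _ (sub_eq_zero.1 hy)) hr
  | coe x =>
    have hx : x - c ≠ 0 := fun h => hq (congrArg _ (sub_eq_zero.1 h))
    induction r using OnePoint.rec with
    | infty =>
      have h : (x - c)⁻¹ = 0 := h
      exact absurd (inv_eq_zero.1 h) hx
    | coe y =>
      have h : (x - c)⁻¹ = (y - c)⁻¹ := h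
      rw [inv_inj] at h
      exact congrArg _ (sub_left_injective h)

theorem IsHolomorphicToSphere.mdifferentiableAt_sphereRecip {f : Y → OnePoint ℂ}
    (hf : IsHolomorphicToSphere f) {c : ℂ} {p : Y} (hp : f p ≠ c) :
    MDifferentiableAt 𝓘(ℂ) 𝓘(ℂ) (fun t => sphereRecip c (f t)) p := by
  by_cases h : f p = OnePoint.infty
  · have h0 : f p ≠ ((0 : ℂ) : OnePoint ℂ) := h ▸ infty_ne_zero
    have hd : DifferentiableAt ℂ (fun z : ℂ => z / (1 - c * z)) (sphereCoordInv (f p)) := by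
      have : sphereCoordInv (f p) = 0 := (sphereCoordInv_eq_zero h0).2 h
      rw [this]
      refine DifferentiableAt.div (by fun_prop) (by fun_prop) (by simp)
    refine (hd.mdifferentiableAt.comp p (hf.holomorphic_coordInv p h0)).congr_of_eventuallyEq ?_
    filter_upwards [hf.eventually_coordInv h0] with t ht
    exact sphereRecip_eq_coordInv c ht.1
  · have hd : DifferentiableAt ℂ (fun z : ℂ => (z - c)⁻¹) (sphereCoord (f p)) := by
      refine DifferentiableAt.inv (by fun_prop) fun h0 => hp ?_
      rw [← coe_sphereCoord h, sub_eq_zero.1 h0]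
    refine (hd.mdifferentiableAt.comp p (hf.holomorphic_coord p h)).congr_of_eventuallyEq ?_
    filter_upwards [hf.eventually_coord h] with t ht
    exact sphereRecip_eq_coord c ht.1

end Removable

/-! ### The involution of a spectral curve of degree two. -/

section Neg

variable {X : Type*} [TopologicalSpace X] [ChartedSpace ℂ X] [IsManifold 𝓘(ℂ) ω X]

/-- Multiplication by `-1` on the total space of the canonical bundle. -/
noncomputable def negCanonical (q : CanonicalBundle X) : CanonicalBundle X := ⟨q.proj, -q.snd⟩

theorem taut_negCanonical (q : CanonicalBundle X) (v : ℂ) :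
    taut (negCanonical q) v = - taut q v := rfl

theorem contMDiff_negCanonical :
    ContMDiff canonicalModel canonicalModel ω (negCanonical (X := X)) := by
  intro q
  have hid := (Bundle.contMDiffAt_totalSpace (f := (id : CanonicalBundle X → CanonicalBundle X))
    (x₀ := q) (IM := canonicalModel) (IB := 𝓘(ℂ)) (n := ω)).1 contMDiffAt_id
  refine (Bundle.contMDiffAt_totalSpace (f := negCanonical (X := X))
    (x₀ := q) (IM := canonicalModel) (IB := 𝓘(ℂ)) (n := ω)).2 ⟨hid.1, ?_⟩
  refine hid.2.neg.congr_of_eventuallyEq (Eventually.of_forall fun r => ?_)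
  change (trivializationAt (ℂ →L[ℂ] ℂ) _ q.proj (negCanonical r)).2 =
    - (trivializationAt (ℂ →L[ℂ] ℂ) _ q.proj r).2
  rw [trivializationAt_canonical_apply, trivializationAt_canonical_apply, taut_negCanonical]
  refine ContinuousLinearMap.ext_ring ?_
  simp
  rfl

variable {a : HitchinBase X 2} {ha : IsNonsingular a}

/-- Only λ² and a term free of λ occur, so s is even in λ and the involution preserves the curve. -/
theorem spectralSection_two (q : CanonicalBundle X) (v : ℂ) : spectralSection a q v =
    taut q v ^ 2 + ∑ j : Finset.Icc 2 2, formEval (a j) q.proj v := by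
  rw [spectralSection_eq]
  congr 1
  refine Finset.sum_congr rfl fun j _ => ?_
  have := Finset.mem_Icc.1 j.2
  rw [show 2 - (j : ℕ) = 0 by omega, pow_zero, mul_one]

theorem fibreDeriv_two (q : CanonicalBundle X) (v : ℂ) : fibreDeriv a q v = 2 * taut q v := by
  unfold fibreDeriv
  rw [Finset.sum_eq_zero, add_zero]
  · simp
  intro j _
  have := Finset.mem_Icc.1 j.2
  rw [show 2 - (j : ℕ) = 0 by omega]
  simp

theorem spectralSection_negCanonical (q : CanonicalBundle X) (v : ℂ) :
    spectralSection a (negCanonical q) v = spectralSection a q v := by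
  rw [spectralSection_two, spectralSection_two, taut_negCanonical, neg_sq]
  rfl

theorem negCanonical_mem {q : CanonicalBundle X} (hq : q ∈ spectralSet a) :
    negCanonical q ∈ spectralSet a := fun v =>
  (spectralSection_negCanonical q v).trans (hq v)

/-- The involution `λ ↦ -λ` of a spectral curve of degree two. -/
noncomputable def SpectralCurve.swap (p : SpectralCurve a ha) : SpectralCurve a ha :=
  ⟨negCanonical (SpectralCurve.incl a ha p), negCanonical_mem (incl_mem p)⟩

theorem proj_swap (p : SpectralCurve a ha) :
    SpectralCurve.proj (SpectralCurve.swap p) = SpectralCurve.proj p := rfl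

theorem taut_incl_swap (p : SpectralCurve a ha) (v : ℂ) :
    taut (SpectralCurve.incl a ha (SpectralCurve.swap p)) v =
      - taut (SpectralCurve.incl a ha p) v := rfl

theorem swap_swap (p : SpectralCurve a ha) : SpectralCurve.swap (SpectralCurve.swap p) = p :=
  incl_injective (ext_taut rfl (by rw [taut_incl_swap, taut_incl_swap, neg_neg]))

theorem swap_eq_self_iff (p : SpectralCurve a ha) :
    SpectralCurve.swap p = p ↔ taut (SpectralCurve.incl a ha p) 1 = 0 := by
  constructor
  · intro h
    have := taut_incl_swap p 1
    rw [h] at this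
    exact self_eq_neg.1 this
  · intro h
    exact incl_injective (ext_taut rfl (by rw [taut_incl_swap, h, neg_zero]))

theorem mdifferentiable_swap (p : SpectralCurve a ha) :
    MDifferentiableAt 𝓘(ℂ) 𝓘(ℂ) (SpectralCurve.swap (a := a) (ha := ha)) p :=
  (contMDiffAt_of_incl_comp ((contMDiff_negCanonical _).comp p
    (contMDiff_incl p))).mdifferentiableAt (by simp)

theorem continuous_swap : Continuous (SpectralCurve.swap (a := a) (ha := ha)) :=
  continuous_iff_continuousAt.2 fun p => (mdifferentiable_swap p).continuousAt

end Neg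

/-! ### Arithmetic of holomorphic functions at a point. -/

section Pointwise

variable {Y : Type*} [TopologicalSpace Y] [ChartedSpace ℂ Y] [IsManifold 𝓘(ℂ) ω Y]
  {g h : Y → ℂ} {p : Y}

theorem mdifferentiableAt_mul (hg : MDifferentiableAt 𝓘(ℂ) 𝓘(ℂ) g p)
    (hh : MDifferentiableAt 𝓘(ℂ) 𝓘(ℂ) h p) :
    MDifferentiableAt 𝓘(ℂ) 𝓘(ℂ) (fun t => g t * h t) p := by
  rw [← differentiableAt_comp_chartAt_symm_iff (mem_chart_source ℂ p)] at *
  exact hg.mul hh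

theorem mdifferentiableAt_div (hg : MDifferentiableAt 𝓘(ℂ) 𝓘(ℂ) g p)
    (hh : MDifferentiableAt 𝓘(ℂ) 𝓘(ℂ) h p) (h0 : h p ≠ 0) :
    MDifferentiableAt 𝓘(ℂ) 𝓘(ℂ) (fun t => g t / h t) p := by
  rw [← differentiableAt_comp_chartAt_symm_iff (mem_chart_source ℂ p)] at *
  exact hg.div hh (by simpa using h0)

theorem mdifferentiableAt_sub (hg : MDifferentiableAt 𝓘(ℂ) 𝓘(ℂ) g p)
    (hh : MDifferentiableAt 𝓘(ℂ) 𝓘(ℂ) h p) :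
    MDifferentiableAt 𝓘(ℂ) 𝓘(ℂ) (fun t => g t - h t) p := by
  rw [← differentiableAt_comp_chartAt_symm_iff (mem_chart_source ℂ p)] at *
  exact hg.sub hh

theorem exists_bound_of_mdifferentiableAt (hg : MDifferentiableAt 𝓘(ℂ) 𝓘(ℂ) g p) :
    ∃ C : ℝ, ∀ᶠ t in 𝓝 p, ‖g t‖ ≤ C :=
  ⟨‖g p‖ + 1, hg.continuousAt.norm.tendsto.eventually_le_const (lt_add_one _)⟩

end Pointwise

/-! ### Spectral curves of degree two over a base of genus at least three. -/

section DegreeTwo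

variable {X : Type*} [TopologicalSpace X] [ChartedSpace ℂ X] [IsManifold 𝓘(ℂ) ω X]
variable {a : HitchinBase X 2} {ha : IsNonsingular a} {f : SpectralCurve a ha → OnePoint ℂ}

/-- The quotient of the pull-back of a one-form by the tautological section. -/
noncomputable def formRatio (η : differentials X 1) (p : SpectralCurve a ha) : ℂ :=
  formEval η (SpectralCurve.proj p) 1 / taut (SpectralCurve.incl a ha p) 1

/-- Numerator and denominator are both linear in the tangent vector, so the ratio may be computed in
the holomorphic frame of a fixed chart. -/
theorem formRatio_eq (η : differentials X 1) {x₀ : X} {p : SpectralCurve a ha}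
    (hp : SpectralCurve.proj p ∈ (chartAt ℂ x₀).source) :
    formRatio η p = formEval η (SpectralCurve.proj p) (frame x₀ (SpectralCurve.proj p)) /
      taut (SpectralCurve.incl a ha p) (frame x₀ (SpectralCurve.proj p)) := by
  rw [formEval_eq, pow_one, taut_eq, mul_div_mul_left _ _ (frame_ne_zero hp), formRatio]

theorem formRatio_swap (η : differentials X 1) (p : SpectralCurve a ha) :
    formRatio η (SpectralCurve.swap p) = - formRatio η p := by
  rw [formRatio, taut_incl_swap, proj_swap, div_neg, formRatio]

theorem mdifferentiableAt_formRatio (η : differentials X 1) {p : SpectralCurve a ha}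
    (hp : taut (SpectralCurve.incl a ha p) 1 ≠ 0) :
    MDifferentiableAt 𝓘(ℂ) 𝓘(ℂ) (formRatio (a := a) (ha := ha) η) p := by
  have hs : SpectralCurve.proj p ∈ (chartAt ℂ (SpectralCurve.proj p)).source := mem_chart_source _ _
  have h1 : MDifferentiableAt 𝓘(ℂ) 𝓘(ℂ) (fun t : SpectralCurve a ha => formEval η
      (SpectralCurve.proj t) (frame (SpectralCurve.proj p) (SpectralCurve.proj t))) p :=
    ((contMDiffAt_formEval_frame η hs).comp p (contMDiff_proj p)).mdifferentiableAt (by simp)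
  refine (mdifferentiableAt_div h1 (mdifferentiableAt_taut_frame hs) ?_).congr_of_eventuallyEq ?_
  · rw [taut_eq]
    exact mul_ne_zero (frame_ne_zero hs) hp
  · filter_upwards [eventually_proj_mem_source p] with t ht
    exact formRatio_eq η ht

/-- Where λ ≠ 0 the only possible pole is that of 1/(f - c). It is simple at a regular point of f
and is cancelled by the zero of η. -/
theorem exists_bound_formRatio_mul_sphereRecip (hf : IsHolomorphicToSphere f)
    (η : differentials X 1) {c : ℂ} {p₀ : SpectralCurve a ha}
    (hp : taut (SpectralCurve.incl a ha p₀) 1 ≠ 0)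
    (hc : f p₀ = c → IsRegularPoint f p₀ ∧ formEval η (SpectralCurve.proj p₀) 1 = 0) :
    ∃ C : ℝ, ∀ᶠ p in 𝓝[≠] p₀, ‖formRatio η p * sphereRecip c (f p)‖ ≤ C := by
  have hr := mdifferentiableAt_formRatio η hp
  by_cases h : f p₀ = c
  · obtain ⟨hreg, h0⟩ := hc h
    have hA := (differentiableAt_comp_chartAt_symm_iff (mem_chart_source ℂ p₀)).2 hr
    have hF := hf.analyticAt_localCoord (mem_chart_source ℂ p₀) hreg.1
    have hF0 : localCoord f p₀ (chartAt ℂ p₀ p₀) = c := by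
      rw [localCoord_apply_chartAt (mem_chart_source ℂ p₀), h]
      rfl
    have hd : deriv (fun z => localCoord f p₀ z - c) (chartAt ℂ p₀ p₀) ≠ 0 := by
      rw [deriv_sub_const]
      intro hd
      apply hreg.2
      rw [hf.speed_eq (mem_chart_source ℂ p₀) hreg.1, hd, mul_zero]
    obtain ⟨C, hC⟩ := exists_bound_div hA (by simp [formRatio, h0])
      (hF.differentiableAt.sub_const c) (by rw [hF0, sub_self]) hd
    refine ⟨C, ?_⟩
    filter_upwards [(tendsto_chartAt_punctured p₀).eventually hC,
      nhdsWithin_le_nhds (eventually_mem_chart_source p₀),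
      nhdsWithin_le_nhds (hf.eventually_coord hreg.1)] with p h1 h2 h3
    rw [localCoord_apply_chartAt h2, Function.comp_apply, (chartAt ℂ p₀).left_inv h2] at h1
    rwa [sphereRecip_eq_coord c h3.1, ← div_eq_mul_inv]
  · obtain ⟨C, hC⟩ := exists_bound_of_mdifferentiableAt
      (mdifferentiableAt_mul hr (hf.mdifferentiableAt_sphereRecip h))
    exact ⟨C, nhdsWithin_le_nhds hC⟩

theorem localPolyY_two (x₀ : X) (x y : ℂ) : localPolyY a x₀ x y = 2 * y := by
  unfold localPolyY
  rw [Finset.sum_eq_zero, add_zero]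
  · simp
  intro j _
  have := Finset.mem_Icc.1 j.2
  rw [show 2 - (j : ℕ) = 0 by omega]
  simp

/-- At a zero of λ one has P_y = 2y = 0, so P_x ≠ 0, x' = 0 and y' ≠ 0. Thus λ has a simple zero,
which the zero of N cancels. -/
theorem exists_bound_formRatio_mul (η : differentials X 1) {N : SpectralCurve a ha → ℂ}
    {p₀ : SpectralCurve a ha} (hp : taut (SpectralCurve.incl a ha p₀) 1 = 0)
    (hN : MDifferentiableAt 𝓘(ℂ) 𝓘(ℂ) N p₀) (hN0 : N p₀ = 0) :
    ∃ C : ℝ, ∀ᶠ p in 𝓝[≠] p₀, ‖formRatio η p * N p‖ ≤ C := by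
  have hY0 : localY p₀ (chartAt ℂ p₀ p₀) = 0 := by
    rw [localY_apply (mem_chart_source ℂ p₀), taut_eq, hp, mul_zero]
  have hPY : localPolyY a (SpectralCurve.proj p₀) (localX p₀ (chartAt ℂ p₀ p₀))
      (localY p₀ (chartAt ℂ p₀ p₀)) = 0 := by
    rw [localPolyY_two, hY0, mul_zero]
  have hX' : deriv (localX p₀) (chartAt ℂ p₀ p₀) = 0 := by
    have h := (eventually_localPoly_deriv p₀).self_of_nhds
    rw [hPY, zero_mul, add_zero] at h
    exact (mul_eq_zero.1 h).resolve_left fun h0 => localPoly_partial_ne_zero p₀ ⟨h0, hPY⟩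
  have hY' : deriv (localY p₀) (chartAt ℂ p₀ p₀) ≠ 0 := fun h0 =>
    deriv_localX_localY_ne_zero p₀ ⟨hX', h0⟩
  have hA := (differentiableAt_comp_chartAt_symm_iff (mem_chart_source ℂ p₀)).2 hN
  obtain ⟨C, hC⟩ := exists_bound_div hA (by simp [hN0])
    (analyticAt_localY p₀).differentiableAt hY0 hY'
  have hk : ContinuousAt (fun z => localCoeff η (SpectralCurve.proj p₀) (localX p₀ z))
      (chartAt ℂ p₀ p₀) := ((analyticAt_localCoeff η
        (localX_mem_target p₀).self_of_nhds).comp (analyticAt_localX p₀)).continuousAt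
  have hk' := hk.norm.tendsto.eventually_le_const (lt_add_one _)
  refine ⟨(‖localCoeff η (SpectralCurve.proj p₀) (localX p₀ (chartAt ℂ p₀ p₀))‖ + 1) * C, ?_⟩
  filter_upwards [(tendsto_chartAt_punctured p₀).eventually hC,
    nhdsWithin_le_nhds ((tendsto_chartAt p₀).eventually hk'),
    nhdsWithin_le_nhds (eventually_mem_sources p₀)] with p h1 h2 h3
  rw [Function.comp_apply, (chartAt ℂ p₀).left_inv h3.1] at h1
  rw [formRatio_eq η h3.2, ← localCoeff_apply η h3.2, ← localX_apply h3.1, ← localY_apply h3.1,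
    div_mul_eq_mul_div, mul_div_assoc, norm_mul]
  exact mul_le_mul h2 h1 (norm_nonneg _) ((norm_nonneg _).trans h2)

theorem eventually_taut_ne_zero (p₀ : SpectralCurve a ha) :
    ∀ᶠ p in 𝓝[≠] p₀, taut (SpectralCurve.incl a ha p) 1 ≠ 0 := by
  filter_upwards [eventually_fibreDeriv_ne_zero p₀] with p hp h0
  rw [fibreDeriv_two, taut_eq, h0, mul_zero, mul_zero] at hp
  exact hp rfl

/-- One exceptional set serves all η: it is built from a finite basis, and the trace is linear in η.
This allows η to be chosen after the fibre. -/
theorem exists_finset_trace_pullback [T2Space X] [CompactSpace X]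
    [Module.Finite ℂ (differentials X 1)] {n : ℕ} {a : HitchinBase X n} {ha : IsNonsingular a}
    {f : SpectralCurve a ha → OnePoint ℂ} (hf : IsHolomorphicToSphere f)
    (hfib : {q : OnePoint ℂ | (f ⁻¹' {q}).encard ≠ 2}.Finite) :
    ∃ E : Finset (OnePoint ℂ), ∀ p₁ p₂, p₁ ≠ p₂ → f p₁ = f p₂ → f p₁ ∉ E →
      ∀ η : differentials X 1,
        formEval η (SpectralCurve.proj p₁) (speed SpectralCurve.proj p₁) /
          speed (fun t => sphereCoord (f t)) p₁ +
        formEval η (SpectralCurve.proj p₂) (speed SpectralCurve.proj p₂) /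
          speed (fun t => sphereCoord (f t)) p₂ = 0 := by
  classical
  have b := Module.finBasis ℂ (differentials X 1)
  choose E hE using fun i =>
    (isQuotientByDifferential_pullback hf (b i)).exists_forall_add_eq_zero hf hfib
  refine ⟨Finset.univ.biUnion E, fun p₁ p₂ hne h12 hp η => ?_⟩
  let L : differentials X 1 →ₗ[ℂ] ℂ :=
    { toFun := fun η => formEval η (SpectralCurve.proj p₁) (speed SpectralCurve.proj p₁) /
          speed (fun t => sphereCoord (f t)) p₁ +
        formEval η (SpectralCurve.proj p₂) (speed SpectralCurve.proj p₂) /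
          speed (fun t => sphereCoord (f t)) p₂
      map_add' := fun η η' => by
        rw [formEval_add, formEval_add]
        ring
      map_smul' := fun c η => by
        rw [formEval_smul, formEval_smul, RingHom.id_apply, smul_eq_mul]
        ring }
  have hL : L = 0 := b.ext fun i => hE i p₁ p₂ hne h12 fun h =>
    hp (Finset.mem_biUnion.2 ⟨i, Finset.mem_univ i, h⟩)
  exact LinearMap.congr_fun hL η

theorem exists_pair_mem_ker {k V : Type*} [Field k] [AddCommGroup V] [Module k V]
    [Module.Finite k V] (hV : 3 ≤ Module.finrank k V) (L : V →ₗ[k] k) :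
    ∃ v w : V, v ≠ 0 ∧ (∀ c : k, w ≠ c • v) ∧ L v = 0 ∧ L w = 0 := by
  have h1 := L.finrank_range_add_finrank_ker
  have h2 : Module.finrank k (LinearMap.range L) ≤ 1 := by
    simpa using Submodule.finrank_le (LinearMap.range L)
  have h3 : 1 < Module.finrank k (LinearMap.ker L) := by omega
  have : Nontrivial (LinearMap.ker L) := Module.nontrivial_of_finrank_pos (R := k) (by omega)
  obtain ⟨v, hv⟩ := exists_ne (0 : LinearMap.ker L)
  obtain ⟨w, hw⟩ := exists_linearIndependent_pair_of_one_lt_finrank h3 hv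
  refine ⟨v, w, fun h => hv (Subtype.ext h), fun c hc => ?_, v.2, w.2⟩
  exact (LinearIndependent.pair_iff' hv).1 hw c (Subtype.ext hc.symm)

theorem exists_pair_formEval_eq_zero (hg : 3 ≤ genus X) (x : X) :
    ∃ η₁ η₂ : differentials X 1, η₁ ≠ 0 ∧ (∀ c : ℂ, η₂ ≠ c • η₁) ∧
      formEval η₁ x 1 = 0 ∧ formEval η₂ x 1 = 0 := by
  have hg : 3 ≤ Module.finrank ℂ (differentials X 1) := hg
  have : Module.Finite ℂ (differentials X 1) := Module.finite_of_finrank_pos (by omega)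
  let L : differentials X 1 →ₗ[ℂ] ℂ :=
    { toFun := fun η => formEval η x 1
      map_add' := fun η η' => rfl
      map_smul' := fun c η => rfl }
  exact exists_pair_mem_ker hg L

theorem not_isHyperelliptic_of_three_le_genus [T2Space X] [CompactSpace X] [ConnectedSpace X]
    (hg : 3 ≤ genus X) : ¬ IsHyperelliptic (SpectralCurve a ha) := by
  classical
  rintro ⟨-, f, hf, hfib⟩
  have hg' : 3 ≤ Module.finrank ℂ (differentials X 1) := hg
  have : Module.Finite ℂ (differentials X 1) := Module.finite_of_finrank_pos (by omega)
  obtain ⟨E₁, hE₁⟩ := exists_finset_trace_pullback hf hfib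
  obtain ⟨E₂, hE₂⟩ := exists_finset_forall_of_eventually (f := f) (Q := fun p =>
    IsRegularPoint f p ∧ speed SpectralCurve.proj p ≠ 0 ∧
    taut (SpectralCurve.incl a ha p) 1 ≠ 0) (fun p₀ => by
      refine (hf.eventually_const_or_isRegularPoint p₀).imp_right fun h => ?_
      filter_upwards [h, eventually_speed_proj_ne_zero p₀, eventually_taut_ne_zero p₀]
        with p e1 e2 e3
      exact ⟨e1, e2, e3⟩)
  obtain ⟨p₁, p₂, hne, h12, hE, hfibre⟩ := exists_fibre_pair hfib (E₁ ∪ E₂)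
  rw [Finset.mem_union, not_or] at hE
  obtain ⟨hr₁, hu₁, ht₁⟩ := hE₂ p₁ hE.2
  obtain ⟨hr₂, hu₂, ht₂⟩ := hE₂ p₂ (h12 ▸ hE.2)
  set c := sphereCoord (f p₁) with hc
  have hfc : f p₁ = c := (coe_sphereCoord hr₁.1).symm
  set N : SpectralCurve a ha → ℂ := fun p =>
    sphereRecip c (f p) - sphereRecip c (f (SpectralCurve.swap p)) with hN
  have hfin : (f ⁻¹' {(c : OnePoint ℂ)}).Finite := by
    rw [← hfc, hfibre]
    simp
  -- The possible poles of N are finite in number: the two points over c and their images under the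
  -- involution.
  have havoid : ∀ p₀, ∀ᶠ p in 𝓝[≠] p₀, f p ≠ c ∧ f (SpectralCurve.swap p) ≠ c := by
    have h1 : ∀ F : Set (SpectralCurve a ha), F.Finite → ∀ p₀, ∀ᶠ p in 𝓝[≠] p₀, p ∉ F := by
      intro F hF p₀
      have := (hF.subset (sdiff_subset (t := {p₀}))).isClosed.isOpen_compl.mem_nhds
        (x := p₀) (by simp)
      filter_upwards [nhdsWithin_le_nhds this, self_mem_nhdsWithin] with p hp hpne hpF
      exact hp ⟨hpF, hpne⟩
    intro p₀
    have hfin' := hfin.preimage (f := SpectralCurve.swap (a := a) (ha := ha))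
      (Function.LeftInverse.injective swap_swap).injOn
    filter_upwards [h1 _ hfin p₀, h1 _ hfin' p₀] with p e1 e2
    exact ⟨e1, e2⟩
  have key : ∀ η : differentials X 1, formEval η (SpectralCurve.proj p₁) 1 = 0 →
      ∃ k : ℂ, ∀ᶠ p in 𝓝[≠] p₁, formEval η (SpectralCurve.proj p) 1 * N p =
        k * taut (SpectralCurve.incl a ha p) 1 := by
    intro η hη₁
    -- Since η/df is anti-invariant and vanishes at p₁, it vanishes at p₂; there π is unramified, so
    -- η itself is zero at π(p₂).
    have hη₂ : formEval η (SpectralCurve.proj p₂) 1 = 0 := by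
      have h := hE₁ p₁ p₂ hne h12 hE.1 η
      rw [formEval_eq, hη₁, mul_zero, zero_div, zero_add, formEval_eq, pow_one] at h
      exact (mul_eq_zero.1 ((div_eq_zero_iff.1 h).resolve_right hr₂.2)).resolve_left hu₂
    have hbd : ∀ p₀ : SpectralCurve a ha, taut (SpectralCurve.incl a ha p₀) 1 ≠ 0 →
        ∃ C : ℝ, ∀ᶠ p in 𝓝[≠] p₀, ‖formRatio η p * sphereRecip c (f p)‖ ≤ C := by
      intro p₀ hp₀
      refine exists_bound_formRatio_mul_sphereRecip hf η hp₀ fun h => ?_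
      have h3 : p₀ ∈ f ⁻¹' {f p₁} := h.trans hfc.symm
      rw [hfibre] at h3
      rcases h3 with rfl | rfl
      · exact ⟨hr₁, hη₁⟩
      · exact ⟨hr₂, hη₂⟩
    -- As η/λ is odd under the involution, the product splits into one function evaluated at p and
    -- at its image, so a single bound covers all four possible poles.
    have hsum : ∀ p : SpectralCurve a ha, formRatio η p * N p =
        formRatio η p * sphereRecip c (f p) + formRatio η (SpectralCurve.swap p) *
          sphereRecip c (f (SpectralCurve.swap p)) := by
      intro p
      rw [formRatio_swap, hN]
      ring
    have hNd : ∀ p, f p ≠ c → f (SpectralCurve.swap p) ≠ c →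
        MDifferentiableAt 𝓘(ℂ) 𝓘(ℂ) N p := fun p h1 h2 =>
      mdifferentiableAt_sub (hf.mdifferentiableAt_sphereRecip h1)
        ((hf.mdifferentiableAt_sphereRecip h2).comp p (mdifferentiable_swap p))
    have hswap : ∀ p₀ : SpectralCurve a ha, Tendsto SpectralCurve.swap (𝓝[≠] p₀)
        (𝓝[≠] (SpectralCurve.swap p₀)) := fun p₀ =>
      tendsto_nhdsWithin_iff.2 ⟨continuous_swap.continuousAt.tendsto.mono_left nhdsWithin_le_nhds,
        by
          filter_upwards [self_mem_nhdsWithin] with p hp h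
          exact hp (Function.LeftInverse.injective swap_swap h)⟩
    obtain ⟨G', hG', hGG'⟩ := exists_isLocallyConstant_of_bounded
      (G := fun p => formRatio η p * N p)
      (fun p₀ => by
        filter_upwards [havoid p₀, eventually_taut_ne_zero p₀] with p h1 h2
        exact mdifferentiableAt_mul (mdifferentiableAt_formRatio η h2) (hNd p h1.1 h1.2))
      (fun p₀ => by
        by_cases hp₀ : taut (SpectralCurve.incl a ha p₀) 1 = 0
        -- A fixed point of the involution does not lie over c, since λ ≠ 0 at p₁ and p₂. So N is
        -- holomorphic there, and it is zero by antisymmetry.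
        · have hsw := (swap_eq_self_iff p₀).2 hp₀
          have hfp : f p₀ ≠ c := by
            intro h
            have h3 : p₀ ∈ f ⁻¹' {f p₁} := h.trans hfc.symm
            rw [hfibre] at h3
            rcases h3 with rfl | rfl
            · exact ht₁ hp₀
            · exact ht₂ hp₀
          exact exists_bound_formRatio_mul η hp₀ (hNd p₀ hfp (by rwa [hsw])) (by simp [hN, hsw])
        · obtain ⟨C, hC⟩ := hbd p₀ hp₀
          obtain ⟨C', hC'⟩ := hbd (SpectralCurve.swap p₀) (by
            rwa [taut_incl_swap, neg_ne_zero])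
          refine ⟨C + C', ?_⟩
          filter_upwards [hC, (hswap p₀).eventually hC'] with p h1 h2
          rw [hsum]
          exact norm_add_le_of_le h1 h2)
    refine ⟨G' p₁, ?_⟩
    filter_upwards [hGG' p₁, nhdsWithin_le_nhds (hG'.eventually_eq p₁),
      eventually_taut_ne_zero p₁] with p h1 h2 h3
    rw [h2, formRatio] at h1
    rw [← h1]
    field_simp
  -- Vanishing at π(p₁) is one linear condition, so genus at least three leaves two independent
  -- one-forms.
  obtain ⟨η₁, η₂, h1, h2, hz₁, hz₂⟩ := exists_pair_formEval_eq_zero hg (SpectralCurve.proj p₁)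
  obtain ⟨k₁, hk₁⟩ := key η₁ hz₁
  obtain ⟨k₂, hk₂⟩ := key η₂ hz₂
  -- If N vanished near p₁, then f would be preserved by the involution there, so p and its image
  -- would form a fibre. As the involution preserves both π and f, η₁/df would take equal as well as
  -- opposite values at the two points, hence vanish.
  have hNne : ∃ᶠ p in 𝓝[≠] p₁, N p ≠ 0 := by
    intro hN0
    have hN0 : ∀ᶠ p in 𝓝[≠] p₁, N p = 0 := hN0.mono fun p hp => not_not.1 hp
    have hff : ∀ᶠ p in 𝓝[≠] p₁, f (SpectralCurve.swap p) = f p := by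
      filter_upwards [hN0, havoid p₁] with p e1 e2
      exact (sphereRecip_injOn c e2.1 e2.2 (sub_eq_zero.1 e1)).symm
    have hE' : ∀ᶠ p in 𝓝 p₁, f p ∉ E₁ ∪ E₂ := hf.continuous.continuousAt.eventually
      ((E₁ ∪ E₂).finite_toSet.isClosed.isOpen_compl.mem_nhds (by simpa using hE))
    obtain ⟨p, e1, e2, e3⟩ := ((eventually_punctured_eventually hff).and
      ((eventually_formEval_proj_ne_zero h1 p₁).and (hE'.filter_mono nhdsWithin_le_nhds))).exists
    rw [Finset.mem_union, not_or] at e3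
    obtain ⟨r, u, t⟩ := hE₂ p e3.2
    have hsp : p ≠ SpectralCurve.swap p := fun h => t ((swap_eq_self_iff p).1 h.symm)
    have htr := hE₁ p (SpectralCurve.swap p) hsp e1.self_of_nhds.symm e3.1 η₁
    have hs1 : speed (SpectralCurve.proj (a := a) (ha := ha)) p =
        speed SpectralCurve.swap p * speed SpectralCurve.proj (SpectralCurve.swap p) :=
      speed_comp (mdifferentiableAt_proj _) (mdifferentiable_swap p)
    have hs2 : speed (fun t => sphereCoord (f t)) p =
        speed SpectralCurve.swap p * speed (fun t => sphereCoord (f t)) (SpectralCurve.swap p) := by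
      rw [← speed_comp (hf.holomorphic_coord _ (by rw [e1.self_of_nhds]; exact r.1))
        (mdifferentiable_swap p)]
      refine speed_congr ?_
      filter_upwards [e1] with t ht
      simp [ht]
    have hσ : speed SpectralCurve.swap p ≠ 0 := fun h => u (by rw [hs1, h, zero_mul])
    rw [proj_swap, hs1, hs2, formEval_mul, pow_one, mul_div_mul_left _ _ hσ] at htr
    have h5 : formEval η₁ (SpectralCurve.proj p)
        (speed SpectralCurve.proj (SpectralCurve.swap p)) /
        speed (fun t => sphereCoord (f t)) (SpectralCurve.swap p) = 0 := by
      linear_combination htr / 2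
    rw [formEval_eq, pow_one] at h5
    have h6 : speed SpectralCurve.proj (SpectralCurve.swap p) ≠ 0 := fun h =>
      u (by rw [hs1, h, mul_zero])
    have h7 : speed (fun t => sphereCoord (f t)) (SpectralCurve.swap p) ≠ 0 := fun h =>
      r.2 (by rw [hs2, h, mul_zero])
    exact div_ne_zero (mul_ne_zero h6 e2) h7 h5
  have hk₁0 : k₁ ≠ 0 := by
    rintro rfl
    obtain ⟨p, e1, e2, e3⟩ := (hNne.and_eventually (hk₁.and
      (eventually_formEval_proj_ne_zero h1 p₁))).exists
    rw [zero_mul] at e2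
    exact mul_ne_zero e3 e1 e2
  -- This combination is chosen so that its product with N is (k₂ - (k₂/k₁)k₁)λ = 0, although both
  -- factors are nonzero at points arbitrarily near p₁.
  have hθ : η₂ - (k₂ / k₁) • η₁ ≠ 0 := fun h => h2 _ (sub_eq_zero.1 h)
  obtain ⟨p, e1, e2, e3, e4⟩ := (hNne.and_eventually (hk₁.and (hk₂.and
    (eventually_formEval_proj_ne_zero hθ p₁)))).exists
  have e5 : formEval (η₂ - (k₂ / k₁) • η₁) (SpectralCurve.proj p) 1 =
    formEval η₂ (SpectralCurve.proj p) 1 - k₂ / k₁ * formEval η₁ (SpectralCurve.proj p) 1 := rfl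
  refine mul_ne_zero e4 e1 ?_
  rw [e5]
  field_simp
  linear_combination k₁ * e3 - k₂ * e2

end DegreeTwo

end RiemannSurface

/-- For n ≥ 2 and g > 1, the condition (n, g) ≠ (2, 2) amounts to `hng`. -/
theorem mainTheorem11 {X : Type*} [TopologicalSpace X] [T2Space X] [CompactSpace X]
    [ConnectedSpace X] [ChartedSpace ℂ X] [IsManifold 𝓘(ℂ) ω X]
    (hg : 1 < RiemannSurface.genus X) (n : ℕ) (hn : 2 ≤ n)
    (hng : 3 ≤ n ∨ 3 ≤ RiemannSurface.genus X)
    (a : RiemannSurface.HitchinBase X n) (ha : RiemannSurface.IsNonsingular a) :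
    ¬ RiemannSurface.IsHyperelliptic (RiemannSurface.SpectralCurve a ha) := by
  by_cases h3 : 3 ≤ n
  · exact RiemannSurface.not_isHyperelliptic_of_three_le hg h3
  · obtain rfl : n = 2 := by omega
    exact RiemannSurface.not_isHyperelliptic_of_three_le_genus (hng.resolve_left h3)
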